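/- All manifolds are smooth ($C^\infty$), finite-dimensional, Hausdorff and second countable. Let $X$ be a manifold of dimension $n$ and $q\ge 0$ an integer. **Jet groupoids.** $\Pi_q$ is the full jet groupoid of $X$: its elements are the $q$-jets $j_q(\varphi)(x)$ of local diffeomorphisms $\varphi$ of $X$, with source $s=x$, target $t=\varphi(x)$ and product $j_q(\psi)(\varphi(x))\,j_q(\varphi)(x)=j_q(\psi\circ\varphi)(x)$. Let $\pi^{q+1}_q:\Pi_{q+1}\to\Pi_q$ be the projection and $K_{q+1}$ the kernel of $\Pi_{q+1}(y,y)\to\Pi_q(y,y)$, for each $y\in X$. For $\mathcal R_q\subseteq\Pi_q$ the prolongation is $\mathcal R_{q+1}=J_1(\mathcal R_q)\cap\Pi_{q+1}$: it consists of the jets $j_{q+1}(\varphi)(x)\in\Pi_{q+1}$ such that the $1$-jet at $x$ of the section $x'\mapsto j_q(\varphi)(x')$ of $s:\Pi_q\to X$ is the $1$-jet at $x$ of some smooth local section of $s:\Pi_q\to X$ with values in $\mathcal R_q$. **Natural bundle.** Let $\pi:\mathcal F\to X$ be a smooth fibre bundle with a smooth right action $(u,f)\mapsto uf$ of $\Pi_q$,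 defined for $\pi(u)=t(f)$, such that $\pi(uf)=s(f)$, $u1_x=u$, $u(fg)=(uf)g$. Assume that the fibres are homogeneous, that is, each isotropy group $\Pi_q(x,x)$ acts transitively on $\mathcal F_x$. The first jet bundle $J_1(\mathcal F)$ of sections of $\mathcal F$ carries the prolonged right action of $\Pi_{q+1}$, $$ j_1(\sigma)(\varphi(x))\cdot j_{q+1}(\varphi)(x)=j_1\bigl(x'\mapsto \sigma(\varphi(x'))\,j_q(\varphi)(x')\bigr)(x). $$ Let $\mathcal F_1=J_1(\mathcal F)/K_{q+1}$ be the bundle of $K_{q+1}$-orbits and $I:J_1(\mathcal F)\to\mathcal F_1$ the projection. Then $\Pi_q$ acts on $\mathcal F_1$ by $I(u_1)f_q=I(u_1f_{q+1})$ for any $f_{q+1}\in\Pi_{q+1}$ over $f_q$, and $\mathcal F_1$ projects onto $\mathcal F$. A map $c:\mathcal F\to\mathcal F_1$ is called $\Pi_q$-equivariant if $c(uf_q)=c(u)f_q$ whenever $uf_q$ is defined; a section $c$ of $\mathcal F_1\to\mathcal F$ is smooth if it lifts locally to smooth maps into $J_1(\mathcal F)$. **Geometric object.** Let $\omega:X\to\mathcal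 F$ be a smooth section. Put $\Phi_\omega(f)=\omega(t(f))f$ for $f\in\Pi_q$, let $\mathcal R_q(\omega)=\{f\in\Pi_q\mid\Phi_\omega(f)=\omega(s(f))\}$ be the symmetry groupoid of $\omega$, and let $\mathcal R_{q+1}(\omega)$ be its prolongation. **Theorem (projection theorem).** The projection $\pi^{q+1}_q:\mathcal R_{q+1}(\omega)\to\mathcal R_q(\omega)$ is surjective if and only if there is a smooth $\Pi_q$-equivariant section $c:\mathcal F\to\mathcal F_1$ such that the Vessiot structure equations $$ I(j_1(\omega)(x))=c(\omega(x))\qquad\text{for all }x\in X $$ hold. For the "if" part any $\Pi_q$-equivariant map $c:\mathcal F\to\mathcal F_1$ (not assumed smooth) that satisfies these equations suffices, and for every such $c$ the sequence $$ 0\to\mathcal R_q(\omega)\to\Pi_q\underset{\omega\circ s}{\overset{\Phi_\omega}{\rightrightarrows}}\mathcal F\underset{c}{\overset{I\circ j_1}{\rightrightarrows}}\mathcal F_1 $$ is exact in the following sense: $\mathcal R_q(\omega)$ is the subset of $\Pi_q$ on which $\Phi_\omega$ and $\omega\circ s$ agree, and for each $u_1\in J_1(\mathcal F)$ lying over $u\in\mathcal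 F$ one has $I(u_1)=c(u)$ if and only if $u_1=j_1(\omega)(t(f))\cdot f$ for some $f\in\Pi_{q+1}$, i.e. if and only if $u_1$ is in the image of the prolongation of $\Phi_\omega$. -/

import Mathlib

open Set Filter
open scoped Manifold ContDiff Topology

noncomputable section

namespace JetGroupoid

/-- The model space of a manifold of dimension `n`. -/
abbrev Eu (n : ℕ) : Type := EuclideanSpace ℝ (Fin n)

section Jets

variable {d m n : ℕ}
  {T : Type*} [TopologicalSpace T] [ChartedSpace (Eu d) T]
  {M : Type*} [TopologicalSpace M] [ChartedSpace (Eu m) M]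
  {N : Type*} [TopologicalSpace N] [ChartedSpace (Eu n) N]

/-- The `k`-th derivative at `x` of `f : M → N` written in the charts `a` of `M` and `b` of `N`. -/
def chartDeriv (a : OpenPartialHomeomorph M (Eu m)) (b : OpenPartialHomeomorph N (Eu n))
    (f : M → N) (x : M) (k : ℕ) : Eu m [×k]→L[ℝ] Eu n :=
  iteratedFDeriv ℝ k (b ∘ f ∘ a.symm) (a x)

variable (m n) in
/-- `f` and `g` have the same value at `x` and, in charts, the same derivatives at `x` up to
order `q`. (For maps that are smooth near `x`, agreement in one pair of charts implies agreement in
all of them.) -/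
def SameJet (q : ℕ) (x : M) (f g : M → N) : Prop :=
  f x = g x ∧ ∀ a ∈ atlas (Eu m) M, ∀ b ∈ atlas (Eu n) N, x ∈ a.source → f x ∈ b.source →
    ∀ k ≤ q, chartDeriv a b f x k = chartDeriv a b g x k

variable (m n M N) in
/-- Equality of `q`-jets. A pair `(x, f)` represents the `q`-jet of `f` at `x`. -/
def jetSetoid (q : ℕ) : Setoid (M × (M → N)) where
  r p p' := p.1 = p'.1 ∧ SameJet m n q p.1 p.2 p'.2
  iseqv :=
    { refl := fun _ => ⟨rfl, rfl, fun _ _ _ _ _ _ _ _ => rfl⟩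
      symm := by
        rintro ⟨x, f⟩ ⟨x', g⟩ ⟨h, h0, h1⟩
        dsimp only at h h0 h1
        subst h
        exact ⟨rfl, h0.symm, fun a ha b hb hx hg k hk =>
          (h1 a ha b hb hx (by rw [h0]; exact hg) k hk).symm⟩
      trans := by
        rintro ⟨x, f⟩ ⟨x', g⟩ ⟨x'', l⟩ ⟨h, h0, h1⟩ ⟨h', h0', h1'⟩
        dsimp only at h h0 h1 h' h0' h1'
        subst h
        subst h'
        exact ⟨rfl, h0.trans h0', fun a ha b hb hx hf k hk =>
          (h1 a ha b hb hx hf k hk).trans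
            (h1' a ha b hb hx (by rw [← h0]; exact hf) k hk)⟩ }

/-- `q`-jets of maps `M → N`. The jets of smooth local maps are singled out below, where they are
needed: `fullJetGroupoid` and `sectionJets`. -/
def Jet (m n q : ℕ) (M N : Type*) [TopologicalSpace M] [ChartedSpace (Eu m) M]
    [TopologicalSpace N] [ChartedSpace (Eu n) N] : Type _ :=
  Quotient (jetSetoid m n M N q)

variable {q : ℕ}

namespace Jet

/-- The `q`-jet of `f` at `x`. -/
def mk (q : ℕ) (x : M) (f : M → N) : Jet m n q M N :=
  Quotient.mk (jetSetoid m n M N q) (x, f)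

/-- The source `x` of the jet of `f` at `x`. -/
def source (j : Jet m n q M N) : M :=
  Quotient.lift (fun p : M × (M → N) => p.1) (fun _ _ (h : _ ∧ _) => h.1) j

/-- The target `f x` of the jet of `f` at `x`. -/
def target (j : Jet m n q M N) : N :=
  Quotient.lift (fun p : M × (M → N) => p.2 p.1)
    (fun p p' (h : p.1 = p'.1 ∧ SameJet m n q p.1 p.2 p'.2) => h.2.1.trans (by rw [h.1])) j

/-- The projection `π^{q+1}_q` from `(q+1)`-jets to `q`-jets. -/
def proj (j : Jet m n (q + 1) M N) : Jet m n q M N :=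
  Quotient.lift (fun p : M × (M → N) => mk q p.1 p.2)
    (fun p p' (h : p.1 = p'.1 ∧ SameJet m n (q + 1) p.1 p.2 p'.2) =>
      Quotient.sound (s := jetSetoid m n M N q)
      ⟨h.1, h.2.1, fun a ha b hb hx hf k hk => h.2.2 a ha b hb hx hf k (Nat.le_succ_of_le hk)⟩) j

/-- The space in which jet coordinates live: the coordinates of the source and the derivatives of
order `0, …, q` (the derivative of order `0` gives the coordinates of the target). -/
abbrev Coord (q m n : ℕ) : Type :=
  Eu m × ((k : Fin (q + 1)) → (Eu m [×(k : ℕ)]→L[ℝ] Eu n))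

open Classical in
/-- The coordinates of a jet with respect to a chart `a` around its source and a chart `b` around
its target (`0` if the jet does not lie over the domains of these charts). -/
def coord (a : atlas (Eu m) M) (b : atlas (Eu n) N) (j : Jet m n q M N) :
    Coord q m n :=
  Quotient.lift
    (fun p : M × (M → N) =>
      if p.1 ∈ a.1.source ∧ p.2 p.1 ∈ b.1.source then
        ((a.1 p.1, fun k => chartDeriv a.1 b.1 p.2 p.1 k) : Coord q m n)
      else 0)
    (by
      rintro ⟨x, f⟩ ⟨x', g⟩ ⟨h, h0, h1⟩
      dsimp only at h h0 h1 ⊢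
      subst h
      by_cases hc : x ∈ a.1.source ∧ f x ∈ b.1.source
      · rw [if_pos hc, if_pos (h0 ▸ hc)]
        refine Prod.ext rfl (funext fun k => ?_)
        exact h1 a.1 a.2 b.1 b.2 hc.1 hc.2 k (Nat.le_of_lt_succ k.2)
      · rw [if_neg hc, if_neg (h0 ▸ hc)]) j

variable (d) in
/-- Smoothness, on an open set `U` of a manifold, of a map `g` into the jet bundle: source and
target are continuous, and all jet coordinates of `g` are smooth where they are defined. -/
def SmoothOn (g : T → Jet m n q M N) (U : Set T) : Prop :=
  ContinuousOn (fun t => (g t).source) U ∧ ContinuousOn (fun t => (g t).target) U ∧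
    ∀ (a : atlas (Eu m) M) (b : atlas (Eu n) N),
      ContMDiffOn 𝓘(ℝ, Eu d) 𝓘(ℝ, Coord q m n) ∞ (fun t => coord a b (g t))
        (U ∩ {t | (g t).source ∈ a.1.source ∧ (g t).target ∈ b.1.source})

end Jet

end Jets

section Groupoid

variable {n : ℕ} {X : Type*} [TopologicalSpace X] [ChartedSpace (Eu n) X]

/-- `φ` is a smooth local diffeomorphism of `X` near `x`. -/
def LocalDiffeoAt (n : ℕ) {X : Type*} [TopologicalSpace X] [ChartedSpace (Eu n) X] (φ : X → X) (x : X) : Prop :=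
  IsLocalDiffeomorphAt 𝓘(ℝ, Eu n) 𝓘(ℝ, Eu n) ∞ φ x

/-- The full jet groupoid `Π_q` of `X`: the `q`-jets of local diffeomorphisms of `X`. The identity
at `x` is the jet of `id`, and the product of the jet of `ψ` at `φ x` with the jet of `φ` at `x` is
the jet of `ψ ∘ φ` at `x`. -/
def fullJetGroupoid (n q : ℕ) (X : Type*) [TopologicalSpace X] [ChartedSpace (Eu n) X] :
    Set (Jet n n q X X) :=
  {f | ∃ (x : X) (φ : X → X), LocalDiffeoAt n φ x ∧ f = Jet.mk q x φ}

variable {q : ℕ}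

/-- The prolongation `R_{q+1} = J_1(R_q) ∩ Π_{q+1}` of `R_q ⊆ Π_q`: the `(q+1)`-jets of local
diffeomorphisms `φ` at `x` such that the `1`-jet at `x` of the section `x' ↦ j_q(φ)(x')` of `Π_q`
is the `1`-jet at `x` of a smooth local section `ψ` of `Π_q → X` (the source projection) with values
in `R_q`. -/
def prolongation (R : Set (Jet n n q X X)) :
    Set (Jet n n (q + 1) X X) :=
  {g | ∃ (x : X) (φ : X → X), LocalDiffeoAt n φ x ∧ g = Jet.mk (q + 1) x φ ∧
    ∃ (U : Set X) (ψ : X → Jet n n q X X),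
      IsOpen U ∧ x ∈ U ∧ Jet.SmoothOn n ψ U ∧ (∀ x' ∈ U, (ψ x').source = x' ∧ ψ x' ∈ R) ∧
      ψ x = Jet.mk q x φ ∧
      ∀ a b : atlas (Eu n) X, x ∈ a.1.source → φ x ∈ b.1.source →
        fderiv ℝ (fun e => Jet.coord a b (ψ (a.1.symm e))) (a.1 x) =
          fderiv ℝ (fun e => Jet.coord a b (Jet.mk q (a.1.symm e) φ)) (a.1 x)}

theorem proj_mem_of_mem_prolongation {R : Set (Jet n n q X X)}
    {g : Jet n n (q + 1) X X} (hg : g ∈ prolongation R) : g.proj ∈ R := by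
  obtain ⟨x, φ, -, rfl, U, ψ, -, hx, -, hR, h, -⟩ := hg
  have h' := (hR x hx).2
  rw [h] at h'
  exact h'

/-- The projection `π^{q+1}_q : R_{q+1} → R_q`. -/
def prolongationProj (R : Set (Jet n n q X X)) (g : prolongation R) : R :=
  ⟨g.1.proj, proj_mem_of_mem_prolongation g.2⟩

end Groupoid

section NaturalBundle

variable {n N : ℕ}
  {X : Type*} [TopologicalSpace X] [ChartedSpace (Eu n) X]
  {Z : Type*} [TopologicalSpace Z] [ChartedSpace (Eu N) Z]

/-- `π : Z → X` is a smooth fibre bundle with typical fibre the manifold `F`. -/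
structure IsFibreBundle (n N m : ℕ)
    {X : Type*} [TopologicalSpace X] [ChartedSpace (Eu n) X]
    {Z : Type*} [TopologicalSpace Z] [ChartedSpace (Eu N) Z]
    (F : Type*) [TopologicalSpace F] [ChartedSpace (Eu m) F] (π : Z → X) : Prop where
  contMDiff : ContMDiff 𝓘(ℝ, Eu N) 𝓘(ℝ, Eu n) ∞ π
  exists_trivialization : ∀ x : X, ∃ e : Bundle.Trivialization F π, x ∈ e.baseSet ∧
    ContMDiffOn 𝓘(ℝ, Eu N) (𝓘(ℝ, Eu n).prod 𝓘(ℝ, Eu m)) ∞ e e.source ∧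
    ContMDiffOn (𝓘(ℝ, Eu n).prod 𝓘(ℝ, Eu m)) 𝓘(ℝ, Eu N) ∞ e.toOpenPartialHomeomorph.symm e.target

/-- A smooth right action of the groupoid `Π_q` on `π : Z → X`, which makes `Z` a natural bundle of
order `q`. The element `act u f = u f` is meaningful for `f ∈ Π_q` with `π u = t(f)` only; its other
values are irrelevant. Smoothness of the action on the fibre product of `Z` and `Π_q` over `X` is
expressed by test maps: smooth maps `(u, g)` from open subsets of Euclidean spaces into the fibre
product are carried to smooth maps. -/
structure NaturalAction (n N q : ℕ)
    {X : Type*} [TopologicalSpace X] [ChartedSpace (Eu n) X]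
    {Z : Type*} [TopologicalSpace Z] [ChartedSpace (Eu N) Z] (π : Z → X) where
  act : Z → Jet n n q X X → Z
  proj_act : ∀ u, ∀ f ∈ fullJetGroupoid n q X, π u = f.target → π (act u f) = f.source
  act_one : ∀ u, act u (Jet.mk q (π u) id) = u
  act_mul : ∀ (u : Z) (x : X) (φ ψ : X → X), LocalDiffeoAt n φ x → LocalDiffeoAt n ψ (φ x) →
    π u = ψ (φ x) →
    act u (Jet.mk q x (ψ ∘ φ)) = act (act u (Jet.mk q (φ x) ψ)) (Jet.mk q x φ)
  smooth_act : ∀ (d : ℕ) (U : Set (Eu d)) (u : Eu d → Z)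
    (g : Eu d → Jet n n q X X), IsOpen U →
    ContMDiffOn 𝓘(ℝ, Eu d) 𝓘(ℝ, Eu N) ∞ u U → Jet.SmoothOn d g U →
    (∀ t ∈ U, g t ∈ fullJetGroupoid n q X ∧ π (u t) = (g t).target) →
    ContMDiffOn 𝓘(ℝ, Eu d) 𝓘(ℝ, Eu N) ∞ (fun t => act (u t) (g t)) U

/-- A geometric object: a smooth section of `π : Z → X`. -/
structure GeometricObject (n N : ℕ)
    {X : Type*} [TopologicalSpace X] [ChartedSpace (Eu n) X]
    {Z : Type*} [TopologicalSpace Z] [ChartedSpace (Eu N) Z] (π : Z → X) where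
  toFun : X → Z
  smooth : ContMDiff 𝓘(ℝ, Eu n) 𝓘(ℝ, Eu N) ∞ toFun
  proj_toFun : ∀ x, π (toFun x) = x

instance (π : Z → X) : CoeFun (GeometricObject n N π) (fun _ => X → Z) := ⟨GeometricObject.toFun⟩

variable (n N) in
/-- `σ` is a smooth section of `π` near `x`. -/
def LocalSectionAt (π : Z → X) (σ : X → Z) (x : X) : Prop :=
  ∀ᶠ x' in 𝓝 x, ContMDiffAt 𝓘(ℝ, Eu n) 𝓘(ℝ, Eu N) ∞ σ x' ∧ π (σ x') = x'

variable (n N) in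
/-- The first jet bundle `J_1(Z)` of `π : Z → X`: the `1`-jets of smooth local sections. -/
def sectionJets (π : Z → X) : Set (Jet n N 1 X Z) :=
  {u | ∃ (x : X) (σ : X → Z), LocalSectionAt n N π σ x ∧ u = Jet.mk 1 x σ}

/-- The section `j_1(ω₀)` of `J_1(Z)`. -/
def GeometricObject.j1 {π : Z → X} (ω₀ : GeometricObject n N π) (x : X) : sectionJets n N π :=
  ⟨Jet.mk 1 x ω₀,
    ⟨x, ω₀, Eventually.of_forall fun x' => ⟨ω₀.smooth x', ω₀.proj_toFun x'⟩, rfl⟩⟩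

namespace NaturalAction

variable {q : ℕ} {π : Z → X} (A : NaturalAction n N q π)

/-- The fibres are homogeneous: the isotropy groups `Π_q(x, x)` act transitively on them. -/
def Homogeneous : Prop :=
  ∀ u v : Z, π u = π v →
    ∃ f ∈ fullJetGroupoid n q X, f.source = π u ∧ f.target = π u ∧ A.act u f = v

/-- `Φ_ω₀(f) = ω₀(t(f)) f`, for `f ∈ Π_q`. -/
def Phi (ω₀ : GeometricObject n N π) (f : Jet n n q X X) : Z :=
  A.act (ω₀ f.target) f

/-- The symmetry groupoid `R_q(ω₀)` of `ω₀`. -/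
def symmetryGroupoid (ω₀ : GeometricObject n N π) : Set (Jet n n q X X) :=
  {f | f ∈ fullJetGroupoid n q X ∧ A.Phi ω₀ f = ω₀ f.source}

/-- The action of a local diffeomorphism `φ` on sections: `x ↦ σ(φ x) j_q(φ)(x)`. -/
def pullback (σ : X → Z) (φ : X → X) (x : X) : Z :=
  A.act (σ (φ x)) (Jet.mk q x φ)

/-- The graph of the action of `Π_{q+1}` on `J_1(Z)`, obtained by prolonging the action of `Π_q` on
`Z`: `A.JetAct u f v` says that `v = u f`. For `u` the `1`-jet of `σ` at `φ x` and `f` the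
`(q+1)`-jet of `φ` at `x`, the element `u f` is the `1`-jet at `x` of `x' ↦ σ(φ x') j_q(φ)(x')`. -/
def JetAct (u : sectionJets n N π) (f : Jet n n (q + 1) X X) (v : sectionJets n N π) : Prop :=
  ∃ (x : X) (φ : X → X) (σ : X → Z), LocalDiffeoAt n φ x ∧ LocalSectionAt n N π σ (φ x) ∧
    u.1 = Jet.mk 1 (φ x) σ ∧ f = Jet.mk (q + 1) x φ ∧ v.1 = Jet.mk 1 x (A.pullback σ φ)

/-- `u` and `v` lie in the same orbit of the kernel `K_{q+1}` of `Π_{q+1}(y, y) → Π_q(y, y)`, for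
some `y`. -/
def KernelRel (u v : sectionJets n N π) : Prop :=
  ∃ (y : X) (k : Jet n n (q + 1) X X),
    k ∈ fullJetGroupoid n (q + 1) X ∧ k.proj = Jet.mk q y id ∧ A.JetAct u k v

/-- The bundle `Z_1 = J_1(Z) / K_{q+1}`. -/
def Quot1 : Type _ := Quot A.KernelRel

/-- The projection `I : J_1(Z) → Z_1`. -/
def I (u : sectionJets n N π) : A.Quot1 := Quot.mk _ u

theorem target_eq_of_kernelRel {u v : sectionJets n N π} (h : A.KernelRel u v) :
    u.1.target = v.1.target := by
  obtain ⟨y, k, -, hk, x, φ, σ, hφ, hσ, hu, rfl, hv⟩ := h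
  have hk' : Jet.mk q x φ = Jet.mk q y id := hk
  have hxy : x = y := congrArg Jet.source hk'
  have hφx : φ x = y := congrArg Jet.target hk'
  subst hxy
  have hπ : π (σ x) = x := by
    have := (mem_of_mem_nhds hσ).2
    rwa [hφx] at this
  rw [hu, hv]
  change σ (φ x) = A.act (σ (φ x)) (Jet.mk q x φ)
  have h1 := A.act_one (σ x)
  rw [hπ] at h1
  rw [hk', hφx, h1]

/-- The projection `Z_1 → Z`. -/
def Quot1.toBundle {A : NaturalAction n N q π} (w : A.Quot1) : Z :=
  Quot.lift (fun u : sectionJets n N π => u.1.target) (fun _ _ h => A.target_eq_of_kernelRel h) w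

/-- The graph of the action of `Π_q` on `Z_1`: `A.QuotAct w f w'` says that `w' = w f`. For
`w = I(u)` and any `(q+1)`-jet `g ∈ Π_{q+1}` over `f`, this is `w f = I(u g)`. -/
def QuotAct (w : A.Quot1) (f : Jet n n q X X) (w' : A.Quot1) : Prop :=
  ∃ (u v : sectionJets n N π) (g : Jet n n (q + 1) X X),
    A.I u = w ∧ g.proj = f ∧ A.JetAct u g v ∧ A.I v = w'

/-- `c : Z → Z_1` is `Π_q`-equivariant: `c(u f) = c(u) f`. -/
def Equivariant (c : Z → A.Quot1) : Prop :=
  ∀ u, ∀ f ∈ fullJetGroupoid n q X, π u = f.target → A.QuotAct (c u) f (c (A.act u f))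

/-- `c : Z → Z_1` is a smooth section of `Z_1 → Z`. Since `I : J_1(Z) → Z_1` is a surjective
submersion, smoothness means that `c` lifts locally to smooth maps into `J_1(Z)`. -/
def SmoothSection (c : Z → A.Quot1) : Prop :=
  (∀ u, (c u).toBundle = u) ∧
    ∀ u₀ : Z, ∃ (U : Set Z) (s : Z → sectionJets n N π), IsOpen U ∧ u₀ ∈ U ∧
      Jet.SmoothOn N (fun u => (s u).1) U ∧ ∀ u ∈ U, A.I (s u) = c u

/-- The Vessiot structure equations `I(j_1(ω₀)) = c(ω₀)`. -/
def StructureEquations (ω₀ : GeometricObject n N π) (c : Z → A.Quot1) : Prop :=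
  ∀ x, A.I (ω₀.j1 x) = c (ω₀ x)

/-- Exactness of `0 → R_q(ω₀) → Π_q ⇉ Z ⇉ Z_1`, with the arrows `Φ_ω₀`, `ω₀ ∘ s` and `I ∘ j_1`, `c`.

At `Π_q`: `R_q(ω₀)` is the part of `Π_q` on which `Φ_ω₀` and `ω₀ ∘ s` agree. At `Z`: the operators
`I ∘ j_1` and `c` agree on a `1`-jet of a section of `Z` exactly if this `1`-jet is in the image of
the prolongation `Π_{q+1} → J_1(Z)`, `f ↦ j_1(ω₀)(t(f)) f` of `Φ_ω₀`. -/
def Exact (ω₀ : GeometricObject n N π) (c : Z → A.Quot1) : Prop :=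
  (∀ f ∈ fullJetGroupoid n q X, f ∈ A.symmetryGroupoid ω₀ ↔ A.Phi ω₀ f = ω₀ f.source) ∧
    ∀ u : sectionJets n N π, A.I u = c u.1.target ↔
      ∃ f ∈ fullJetGroupoid n (q + 1) X, A.JetAct (ω₀.j1 f.target) f u

end NaturalAction

end NaturalBundle

end JetGroupoid

end

/-! The pivot is a description of the prolongation: `j_{q+1}(φ)(x)` lies in `R_{q+1}(ω₀)` if and
only if it fixes the `1`-jet of `ω₀`, that is, `j_1(ω₀)(φ x) · j_{q+1}(φ)(x) = j_1(ω₀)(x)`. One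
direction (`exists_of_mem_prolongation`) is the chain rule, applied to the identity `ω₀(t(ψ)) ψ =
ω₀` for a section `ψ` of `R_q(ω₀)` tangent to `j_q(φ)`. The other (`Homogeneous.mem_prolongation`)
must construct such a `ψ`. A smooth local right inverse of the action, which returns the given jet
when that jet already has the desired value, corrects `j_q(φ)` to a section of `R_q(ω₀)`. The error
to be corrected vanishes to first order at `x`, so the correction leaves the `1`-jet of `j_q(φ)`
unchanged.

This right inverse exists because the orbit maps `f ↦ z f` are submersions
(`Homogeneous.surjective_fderiv_actCoord`). Their rank is constant by equivariance
(`finrank_range_fderiv_actCoord_le`). Were it some `r < N`, the constant rank theorem in the form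
`exists_dimH_image_le_of_finrank_le` would cover an open subset of `Eu N` by countably many sets of
Hausdorff dimension at most `r`.

What remains is groupoid algebra. As `K_{q+1}` is normal, `I(u g)` depends only on `I(u)` and on the
`q`-jet of `g` (`JetAct.I_eq`), and an element of `K_{q+1}` can be absorbed into the acting jet
(`JetAct.exists_of_kernelRel`). Given `c` and a symmetry `j_q(φ)(x)`, equivariance and the structure
equations put `j_1(ω₀) · j_{q+1}(φ)` and `j_1(ω₀)(x)` into one `K_{q+1}`-orbit; absorbing the kernel
element changes `φ` into a map with the same `q`-jet that fixes `j_1(ω₀)`. The same argument with an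
arbitrary `1`-jet in place of `j_1(ω₀)(x)` gives exactness. Conversely, if symmetries lift, then
`c(ω₀ f) = I(j_1(ω₀) g)`, with `g` over `f`, is well defined, since two choices of `f` differ by a
symmetry and its lift fixes `j_1(ω₀)` (`I_pullbackJet_eq`). Smoothness of `c` comes from local
sections of the orbit submersion. -/

noncomputable section

namespace JetGroupoid

/-! ### Iterated derivatives: composition, symmetry, parameters -/

section Calculus

variable {E : Type*} [NormedAddCommGroup E] [NormedSpace ℝ E]
  {F : Type*} [NormedAddCommGroup F] [NormedSpace ℝ F]
  {G : Type*} [NormedAddCommGroup G] [NormedSpace ℝ G]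

/-- The derivatives of `g ∘ f` up to order `q` depend only on those of `g` and `f`. -/
theorem iteratedFDeriv_comp_congr {q : ℕ} {f f' : E → F} {g g' : F → G} {x : E}
    (hf : ContDiffAt ℝ ∞ f x) (hf' : ContDiffAt ℝ ∞ f' x)
    (hg : ContDiffAt ℝ ∞ g (f x)) (hg' : ContDiffAt ℝ ∞ g' (f x)) (h0 : f x = f' x)
    (h1 : ∀ k ≤ q, iteratedFDeriv ℝ k f x = iteratedFDeriv ℝ k f' x)
    (h2 : ∀ k ≤ q, iteratedFDeriv ℝ k g (f x) = iteratedFDeriv ℝ k g' (f x)) :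
    ∀ k ≤ q, iteratedFDeriv ℝ k (g ∘ f) x = iteratedFDeriv ℝ k (g' ∘ f') x := by
  intro k hk
  have hk' : (k : WithTop ℕ∞) ≤ ∞ := by exact_mod_cast le_top
  rw [iteratedFDeriv_comp hg hf hk', iteratedFDeriv_comp (h0 ▸ hg') hf' hk']
  unfold FormalMultilinearSeries.taylorComp
  refine Finset.sum_congr rfl fun c _ => ?_
  unfold FormalMultilinearSeries.compAlongOrderedFinpartition
  have e1 : ftaylorSeries ℝ g (f x) c.length = ftaylorSeries ℝ g' (f' x) c.length := by
    rw [← h0]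
    exact h2 _ (c.length_le.trans hk)
  have e2 : (fun m => ftaylorSeries ℝ f x (c.partSize m)) =
      fun m => ftaylorSeries ℝ f' x (c.partSize m) :=
    funext fun m => h1 _ ((c.partSize_le m).trans hk)
  rw [e1, e2]

theorem iteratedFDeriv_congr_of_eventuallyEq {f f' : E → F} {x : E} (h : f =ᶠ[𝓝 x] f') (k : ℕ) :
    iteratedFDeriv ℝ k f x = iteratedFDeriv ℝ k f' x :=
  (h.iteratedFDeriv ℝ k).eq_of_nhds

/-- The iterated derivatives of a smooth map are symmetric. -/
theorem iteratedFDeriv_comp_perm {f : E → F} {x : E} (hf : ContDiffAt ℝ ∞ f x) {k : ℕ}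
    (v : Fin k → E) (σ : Equiv.Perm (Fin k)) :
    iteratedFDeriv ℝ k f x (v ∘ σ) = iteratedFDeriv ℝ k f x v := by
  suffices H : ∀ (k : ℕ) (x : E), ContDiffAt ℝ k f x → ∀ (v : Fin k → E) (σ : Equiv.Perm (Fin k)),
      iteratedFDeriv ℝ k f x (v ∘ σ) = iteratedFDeriv ℝ k f x v from
    H k x (hf.of_le (by exact_mod_cast le_top)) v σ
  clear! k x
  intro k
  induction k with
  | zero => intro x _ v σ; congr 1; exact Subsingleton.elim _ _
  | succ k ih =>
    intro x hf v σ
    -- Adjacent transpositions generate the permutations. The one exchanging the slots `0` and `1`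
    -- is the symmetry of the second derivative of the `k`-th derivative; the others leave slot `0`
    -- alone and follow by differentiating the induction hypothesis, which holds on a neighbourhood.
    have hσ : σ ∈ Submonoid.closure
        (Set.range fun i : Fin k => Equiv.swap i.castSucc i.succ) := by
      rw [Equiv.Perm.mclosure_swap_castSucc_succ]; trivial
    revert v
    induction hσ using Submonoid.closure_induction with
    | one => intro v; rfl
    | mul σ τ _ _ hσ hτ =>
      intro v
      rw [show v ∘ ⇑(σ * τ) = (v ∘ σ) ∘ τ from rfl, hτ, hσ]
    | mem σ hσ =>
      obtain ⟨i, rfl⟩ := hσ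
      intro v
      dsimp only
      cases k with
      | zero => exact i.elim0
      | succ k =>
        refine Fin.cases ?_ (fun j => ?_) i
        · have hs : IsSymmSndFDerivAt ℝ (iteratedFDeriv ℝ k f) x := by
            refine ContDiffAt.isSymmSndFDerivAt (n := 2) ?_ (by simp)
            refine hf.iteratedFDeriv_right ?_
            push_cast
            rw [add_assoc, add_comm, one_add_one_eq_two]
          have hs' := hs (v 0) (v 1)
          have key : ∀ w : Fin (k + 1 + 1) → E, iteratedFDeriv ℝ (k + 1 + 1) f x w =
              fderiv ℝ (fderiv ℝ (iteratedFDeriv ℝ k f)) x (w 0) (w 1)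
                (Fin.tail (Fin.tail w)) := by
            intro w
            rw [iteratedFDeriv_succ_apply_left]
            have hc := LinearIsometryEquiv.comp_fderiv (𝕜 := ℝ)
              (E := E →L[ℝ] E [×k]→L[ℝ] F) (F := E [×(k + 1)]→L[ℝ] F)
              (continuousMultilinearCurryLeftEquiv ℝ (fun _ : Fin (k + 1) => E) F).symm
              (f := fderiv ℝ (iteratedFDeriv ℝ k f)) (x := x)
            rw [iteratedFDeriv_succ_eq_comp_left, hc]
            rfl
          rw [key, key]
          have e : Fin.tail (Fin.tail (v ∘ ⇑(Equiv.swap (Fin.castSucc (0 : Fin (k + 1)))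
              (Fin.succ 0)))) = Fin.tail (Fin.tail v) := by
            funext l
            simp only [Fin.tail, Function.comp]
            rw [Equiv.swap_apply_of_ne_of_ne (by simp [Fin.ext_iff]) (by simp [Fin.ext_iff])]
          rw [e]
          have e0 : (v ∘ ⇑(Equiv.swap (Fin.castSucc (0 : Fin (k + 1))) (Fin.succ 0))) 0 = v 1 := by
            simp
          have e1 : (v ∘ ⇑(Equiv.swap (Fin.castSucc (0 : Fin (k + 1))) (Fin.succ 0))) 1 = v 0 := by
            simp
          rw [e0, e1, hs']
        · rw [iteratedFDeriv_succ_apply_left, iteratedFDeriv_succ_apply_left]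
          have e0 : (v ∘ ⇑(Equiv.swap (Fin.castSucc j.succ) j.succ.succ)) 0 = v 0 := by
            simp only [Function.comp]
            rw [Equiv.swap_apply_of_ne_of_ne (by simp [Fin.ext_iff]) (by simp [Fin.ext_iff])]
          have e1 : Fin.tail (v ∘ ⇑(Equiv.swap (Fin.castSucc j.succ) j.succ.succ)) =
              Fin.tail v ∘ (Equiv.swap j.castSucc j.succ) := by
            funext l
            simp only [Fin.tail, Function.comp]
            congr 1
            rw [← Fin.succ_castSucc]
            exact (Fin.succ_injective _).swap_apply j.castSucc j.succ l
          rw [e0, e1]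
          have hd : DifferentiableAt ℝ (iteratedFDeriv ℝ (k + 1) f) x := by
            refine ContDiffAt.differentiableAt (n := 1) (hf.iteratedFDeriv_right ?_) one_ne_zero
            push_cast
            rw [add_comm]
          have ev : ∀ᶠ y in 𝓝 x, iteratedFDeriv ℝ (k + 1) f y
              (Fin.tail v ∘ (Equiv.swap j.castSucc j.succ)) =
                iteratedFDeriv ℝ (k + 1) f y (Fin.tail v) := by
            have := hf.eventually (by simp)
            filter_upwards [this] with y hy
            exact ih y (hy.of_le (by exact_mod_cast Nat.le_succ _)) _ _
          have h := Filter.EventuallyEq.fderiv_eq (𝕜 := ℝ) ev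
          have ap : ∀ w, fderiv ℝ (fun y => iteratedFDeriv ℝ (k + 1) f y w) x =
              (ContinuousMultilinearMap.apply ℝ (fun _ : Fin (k + 1) => E) F w).comp
                (fderiv ℝ (iteratedFDeriv ℝ (k + 1) f) x) := by
            intro w
            exact ((ContinuousMultilinearMap.apply ℝ (fun _ : Fin (k + 1) => E) F w).hasFDerivAt.comp
              x hd.hasFDerivAt).fderiv
          rw [ap, ap] at h
          exact DFunLike.congr_fun h (v 0)

/-- Iterated derivatives depend smoothly on parameters. -/
theorem contDiffAt_iteratedFDeriv_param {f : E → F → G} {p : E × F}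
    (hf : ContDiffAt ℝ ∞ (fun p : E × F => f p.1 p.2) p) (k : ℕ) :
    ContDiffAt ℝ ∞ (fun p : E × F => iteratedFDeriv ℝ k (f p.1) p.2) p := by
  induction k with
  | zero =>
    simp only [iteratedFDeriv_zero_eq_comp, Function.comp_def]
    exact (LinearIsometryEquiv.contDiff (n := ∞)
      (continuousMultilinearCurryFin0 ℝ F G).symm).contDiffAt.comp p hf
  | succ k ih =>
    simp only [iteratedFDeriv_succ_eq_comp_left, Function.comp_def]
    refine (LinearIsometryEquiv.contDiff (𝕜 := ℝ) (n := ∞) (E := F →L[ℝ] F [×k]→L[ℝ] G)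
      (F := F [×(k + 1)]→L[ℝ] G) (continuousMultilinearCurryLeftEquiv ℝ (fun _ : Fin (k + 1) => F) G).symm).contDiffAt.comp p
      (f := fun p : E × F => fderiv ℝ (iteratedFDeriv ℝ k (f p.1)) p.2) ?_
    refine ContDiffAt.fderiv (f := fun p : E × F => iteratedFDeriv ℝ k (f p.1))
      (g := fun p => p.2) (n := ∞) (m := ∞) ?_ contDiffAt_snd (by simp)
    exact ContDiffAt.comp (g := fun p : E × F => iteratedFDeriv ℝ k (f p.1) p.2) (p, p.2)
      (f := fun r : (E × F) × F => (r.1.1, r.2)) (by simpa using ih) (by fun_prop)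

end Calculus

/-! ### Inverse functions, submersions and the constant rank theorem -/

section InverseFunction

variable {E : Type*} [NormedAddCommGroup E] [NormedSpace ℝ E] [FiniteDimensional ℝ E]
  {F : Type*} [NormedAddCommGroup F] [NormedSpace ℝ F]

/-- The inverse function theorem, with smoothness of the inverse on an open set. -/
theorem exists_openPartialHomeomorph_of_isInvertible {f : E → F} {s : Set E} (hs : IsOpen s)
    (hf : ContDiffOn ℝ ∞ f s) {a : E} (ha : a ∈ s) (h : (fderiv ℝ f a).IsInvertible) :
    ∃ e : OpenPartialHomeomorph E F, a ∈ e.source ∧ e.source ⊆ s ∧ (⇑e = f) ∧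
      ContDiffOn ℝ ∞ e.symm e.target := by
  obtain ⟨L, hL⟩ := h
  have hfa : ContDiffAt ℝ ∞ f a := hf.contDiffAt (hs.mem_nhds ha)
  have hd : HasFDerivAt f (L : E →L[ℝ] F) a := by
    rw [hL]; exact (hfa.differentiableAt (by simp)).hasFDerivAt
  let e₀ := hfa.toOpenPartialHomeomorph f hd (by simp)
  have hcont : ContinuousOn (fderiv ℝ f) s := hf.continuousOn_fderiv_of_isOpen hs (by simp)
  -- The inverse is smooth at images of points where the derivative is invertible; restricting to
  -- this open set makes it smooth on the whole target.
  let t : Set E := s ∩ fderiv ℝ f ⁻¹' (Set.range ((↑) : (E ≃L[ℝ] F) → E →L[ℝ] F))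
  have ht : IsOpen t := hcont.isOpen_inter_preimage hs ContinuousLinearEquiv.isOpen
  refine ⟨e₀.restrOpen t ht, ?_, ?_, rfl, ?_⟩
  · exact ⟨hfa.mem_toOpenPartialHomeomorph_source hd (by simp), ha, L, hL⟩
  · exact fun x hx => hx.2.1
  · intro y hy
    have hy' := (e₀.restrOpen t ht).map_target hy
    obtain ⟨M, hM⟩ := hy'.2.2
    have hx := hf.contDiffAt (hs.mem_nhds hy'.2.1)
    refine ((e₀.restrOpen t ht).contDiffAt_symm hy (f₀' := M) ?_ hx).contDiffWithinAt
    rw [hM]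
    exact (hx.differentiableAt (by simp)).hasFDerivAt

variable [FiniteDimensional ℝ F]

/-- A submersion `f` has local smooth sections `ρ (·, w)`, which pass through `v` for `w = f v`. -/
theorem exists_contDiffOn_section_of_surjective {f : E → F} {s : Set E} (hs : IsOpen s)
    (hf : ContDiffOn ℝ ∞ f s) {a : E} (ha : a ∈ s) (h : Function.Surjective (fderiv ℝ f a)) :
    ∃ (ρ : E × F → E) (Ω : Set (E × F)), IsOpen Ω ∧ (a, f a) ∈ Ω ∧ ContDiffOn ℝ ∞ ρ Ω ∧
      (∀ p ∈ Ω, ρ p ∈ s ∧ f (ρ p) = p.2) ∧ ∀ᶠ v in 𝓝 a, ρ (v, f v) = v := by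
  obtain ⟨S', hS'⟩ := (fderiv ℝ f a).toLinearMap.exists_rightInverse_of_surjective
    (LinearMap.range_eq_top.2 h)
  let S : F →L[ℝ] E := LinearMap.toContinuousLinearMap S'
  have hS : ∀ w, fderiv ℝ f a (S w) = w := fun w => LinearMap.congr_fun hS' w
  let A := fderiv ℝ f a
  let T : E × F →L[ℝ] E := ContinuousLinearMap.fst ℝ E F + S.comp (ContinuousLinearMap.snd ℝ E F)
  have hT : ∀ p, T p = p.1 + S p.2 := fun p => rfl
  -- With `S` a right inverse of the derivative, `(v, w') ↦ (v, f (v + S w'))` is a local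
  -- diffeomorphism at `(a, 0)`. Solving for `w'` and returning `v + S w'` gives `ρ`; the value `w'
  -- = 0` corresponds to `w = f v`, whence `ρ (v, f v) = v`.
  let g : E × F → E × F := fun p => (p.1, f (T p))
  have hs' : IsOpen (T ⁻¹' s) := hs.preimage T.continuous
  have hg : ContDiffOn ℝ ∞ g (T ⁻¹' s) :=
    contDiff_fst.contDiffOn.prodMk (hf.comp T.contDiff.contDiffOn fun _ h => h)
  have hTa : T (a, 0) = a := by simp [hT]
  have ha' : (a, (0 : F)) ∈ T ⁻¹' s := by simpa [hTa] using ha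
  have hgd : HasFDerivAt g ((ContinuousLinearMap.fst ℝ E F).prod (A.comp T)) (a, 0) := by
    refine hasFDerivAt_fst.prodMk (HasFDerivAt.comp (a, (0 : F)) (g := f) (f := T) ?_ T.hasFDerivAt)
    rw [hTa]
    exact ((hf.contDiffAt (hs.mem_nhds ha)).differentiableAt (by simp)).hasFDerivAt
  have hinv : (fderiv ℝ g (a, 0)).IsInvertible := by
    rw [hgd.fderiv]
    refine ContinuousLinearMap.IsInvertible.of_inverse (g := (ContinuousLinearMap.fst ℝ E F).prod
      (ContinuousLinearMap.snd ℝ E F - A.comp (ContinuousLinearMap.fst ℝ E F))) ?_ ?_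
    · ext p <;> simp [hT, A, hS]
    · ext p <;> simp [hT, A, hS]
  obtain ⟨e, hae, hes, heg, hsm⟩ := exists_openPartialHomeomorph_of_isInvertible hs' hg ha' hinv
  have hfst : ∀ p ∈ e.target, g (e.symm p) = p := fun p hp => by
    rw [← heg]; exact e.right_inv hp
  refine ⟨fun p => T (e.symm p), e.target, e.open_target, ?_, T.contDiff.comp_contDiffOn hsm,
    ?_, ?_⟩
  · have := e.map_source hae
    rw [heg] at this
    simpa [g, hTa] using this
  · intro p hp
    exact ⟨hes (e.map_target hp), congrArg Prod.snd (hfst p hp)⟩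
  · have hc : ContinuousAt (fun v : E => (v, (0 : F))) a := by fun_prop
    filter_upwards [hc.preimage_mem_nhds (e.open_source.mem_nhds hae)] with v hv
    have h1 := e.left_inv hv
    rw [heg] at h1
    have h2 : g (v, 0) = (v, f v) := by simp [g, hT]
    rw [h2] at h1
    simp [h1, hT]

/-- If the rank of the derivative of `f` is maximal at `a`, then `f` maps a neighbourhood of `a` to
a set whose dimension is at most this rank. -/
theorem exists_dimH_image_le_of_finrank_le {f : E → F} {s : Set E} (hs : IsOpen s)
    (hf : ContDiffOn ℝ ∞ f s) {a : E} (ha : a ∈ s)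
    (hr : ∀ v ∈ s, Module.finrank ℝ (LinearMap.range (fderiv ℝ f v).toLinearMap) ≤
      Module.finrank ℝ (LinearMap.range (fderiv ℝ f a).toLinearMap)) :
    ∃ U ∈ 𝓝 a, dimH (f '' U) ≤ Module.finrank ℝ (LinearMap.range (fderiv ℝ f a).toLinearMap) := by
  set R := LinearMap.range (fderiv ℝ f a).toLinearMap with hR
  obtain ⟨pr, hpr⟩ : ∃ pr : F →L[ℝ] R, ∀ x : R, pr x = x := by
    obtain ⟨l, hl⟩ := R.subtype.exists_leftInverse_of_injective (LinearMap.ker_eq_bot.2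
      R.injective_subtype)
    exact ⟨LinearMap.toContinuousLinearMap l, fun x => LinearMap.congr_fun hl x⟩
  have hfd : ∀ v ∈ s, HasFDerivAt f (fderiv ℝ f v) v := fun v hv =>
    ((hf.contDiffAt (hs.mem_nhds hv)).differentiableAt (by simp)).hasFDerivAt
  -- Composed with a projection onto the range at `a`, the map becomes a submersion at `a` and has
  -- sections `ρ`. It will follow that `f (ρ (v, w))` does not depend on `v`, so that near `a` the
  -- map `f` factors through `g`, whose values lie in the `r`-dimensional space `R`.
  let g : E → R := fun v => pr (f v)
  have hgd : ∀ v ∈ s, HasFDerivAt g (pr.comp (fderiv ℝ f v)) v := fun v hv =>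
    pr.hasFDerivAt.comp v (hfd v hv)
  have hg : ContDiffOn ℝ ∞ g s := pr.contDiff.comp_contDiffOn hf
  have hsurj : Function.Surjective (fderiv ℝ g a) := by
    rw [(hgd a ha).fderiv]
    rintro ⟨w, v, rfl⟩
    exact ⟨v, hpr ⟨_, v, rfl⟩⟩
  obtain ⟨ρ, Ω, hΩ, haΩ, hρ, hρs, hρa⟩ := exists_contDiffOn_section_of_surjective hs hg ha hsurj
  obtain ⟨δ, hδ, hball⟩ := Metric.isOpen_iff.1 hΩ _ haΩ
  have hmem : ∀ v ∈ Metric.ball a δ, ∀ w ∈ Metric.ball (g a) δ, (v, w) ∈ Ω := fun v hv w hw =>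
    hball (by rw [← ball_prod_same]; exact ⟨hv, hw⟩)
  have hρd : ∀ p ∈ Ω, HasFDerivAt ρ (fderiv ℝ ρ p) p := fun p hp =>
    ((hρ.contDiffAt (hΩ.mem_nhds hp)).differentiableAt (by simp)).hasFDerivAt
  have hconst : ∀ w ∈ Metric.ball (g a) δ, ∀ v ∈ Metric.ball a δ, f (ρ (v, w)) = f (ρ (a, w)) := by
    intro w hw v hv
    have hd : ∀ v ∈ Metric.ball a δ, HasFDerivAt (fun v => f (ρ (v, w))) (0 : E →L[ℝ] F) v := by
      intro v hv
      have hp := hmem v hv w hw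
      have h1 : HasFDerivAt (fun v => ρ (v, w)) ((fderiv ℝ ρ (v, w)).comp
          (ContinuousLinearMap.inl ℝ E R)) v := (hρd _ hp).comp v (hasFDerivAt_prodMk_left v w)
      have h2 : HasFDerivAt (fun w => ρ (v, w)) ((fderiv ℝ ρ (v, w)).comp
          (ContinuousLinearMap.inr ℝ E R)) w := (hρd _ hp).comp w (hasFDerivAt_prodMk_right v w)
      have h3 := (hfd _ (hρs _ hp).1).comp v h1
      convert! h3 using 1
      symm
      have hgv := (hgd _ (hρs _ hp).1).comp v h1
      have hgw := (hgd _ (hρs _ hp).1).comp w h2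
      have hgv' : HasFDerivAt (g ∘ fun v => ρ (v, w)) (0 : E →L[ℝ] R) v := by
        refine (hasFDerivAt_const w v).congr_of_eventuallyEq ?_
        filter_upwards [Metric.isOpen_ball.mem_nhds hv] with v' hv'
        exact (hρs _ (hmem v' hv' w hw)).2
      have hgw' : HasFDerivAt (g ∘ fun w => ρ (v, w)) (ContinuousLinearMap.id ℝ R) w := by
        refine (hasFDerivAt_id w).congr_of_eventuallyEq ?_
        filter_upwards [Metric.isOpen_ball.mem_nhds hw] with w' hw'
        exact (hρs _ (hmem v hv w' hw')).2
      have ev := hgv.unique hgv'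
      have ew := hgw.unique hgw'
      set A := fderiv ℝ f (ρ (v, w)) with hA
      have hle := hr _ (hρs _ hp).1
      -- Differentiating `g (ρ (v, w)) = w` in `w` shows that `pr` maps the range of `A` onto `R`;
      -- by maximality of the rank it is then injective there. Differentiating in `v` gives vectors
      -- of this range killed by `pr`, hence zero.
      let B : LinearMap.range A.toLinearMap →ₗ[ℝ] R := pr.toLinearMap.domRestrict _
      have hB : Function.Surjective B := fun r =>
        ⟨⟨A _, _, rfl⟩, DFunLike.congr_fun ew r⟩
      have hBi : Function.Injective B := by
        refine (LinearMap.injective_iff_surjective_of_finrank_eq_finrank ?_).2 hB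
        exact le_antisymm hle (LinearMap.finrank_le_finrank_of_surjective hB)
      ext x
      have hx : B ⟨A _, (fderiv ℝ ρ (v, w)).comp (ContinuousLinearMap.inl ℝ E R) x, rfl⟩ = B 0 := by
        rw [map_zero]
        exact DFunLike.congr_fun ev x
      exact congrArg Subtype.val (hBi hx)
    exact (convex_ball a δ).is_const_of_fderivWithin_eq_zero (𝕜 := ℝ)
      (f := fun v => f (ρ (v, w)))
      (fun v hv => (hd v hv).differentiableAt.differentiableWithinAt)
      (fun v hv => by
        rw [fderivWithin_of_isOpen Metric.isOpen_ball hv, (hd v hv).fderiv]) hv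
      (Metric.mem_ball_self hδ)
  have hga : ContinuousAt g a := (hgd a ha).continuousAt
  refine ⟨{v | v ∈ Metric.ball a δ ∧ g v ∈ Metric.ball (g a) δ ∧ ρ (v, g v) = v}, ?_, ?_⟩
  · filter_upwards [Metric.ball_mem_nhds a hδ,
      hga.preimage_mem_nhds (Metric.ball_mem_nhds (g a) hδ), hρa] with v h1 h2 h3
    exact ⟨h1, h2, h3⟩
  · have hsub : f '' {v | v ∈ Metric.ball a δ ∧ g v ∈ Metric.ball (g a) δ ∧ ρ (v, g v) = v} ⊆
        (fun w => f (ρ (a, w))) '' Metric.ball (g a) δ := by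
      rintro _ ⟨v, ⟨h1, h2, h3⟩, rfl⟩
      refine ⟨g v, h2, ?_⟩
      dsimp only
      rw [← hconst _ h2 v h1, h3]
    refine (dimH_mono hsub).trans ?_
    have hsm : ContDiffOn ℝ 1 (fun w => f (ρ (a, w))) (Metric.ball (g a) δ) := by
      refine ContDiffOn.of_le (n := ∞) ?_ (by exact_mod_cast le_top)
      refine hf.comp (hρ.comp (by fun_prop) fun w hw => ?_) fun w hw => ?_
      · exact hmem a (Metric.mem_ball_self hδ) w hw
      · exact (hρs _ (hmem a (Metric.mem_ball_self hδ) w hw)).1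
    refine (hsm.dimH_image_le (convex_ball _ _) le_rfl).trans ?_
    rw [← Real.dimH_univ_eq_finrank R]
    exact dimH_mono (subset_univ _)

end InverseFunction

/-! ### Polynomial representatives of jets -/

section Taylor

instance {E F : Type*} [NormedAddCommGroup E] [NormedSpace ℝ E] [FiniteDimensional ℝ E]
    [NormedAddCommGroup F] [NormedSpace ℝ F] [FiniteDimensional ℝ F] (k : ℕ) :
    FiniteDimensional ℝ (E [×k]→L[ℝ] F) :=
  Module.Finite.of_injective
    (ContinuousMultilinearMap.toMultilinearMapLinear :
      (E [×k]→L[ℝ] F) →ₗ[ℝ] MultilinearMap ℝ (fun _ : Fin k => E) F)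
    ContinuousMultilinearMap.toMultilinearMap_injective

theorem contDiff_multilinear_diagonal (E F : Type*) [NormedAddCommGroup E] [NormedSpace ℝ E]
    [NormedAddCommGroup F] [NormedSpace ℝ F] (k : ℕ) :
    ContDiff ℝ ∞ (fun p : (E [×k]→L[ℝ] F) × E => p.1 (fun _ => p.2)) := by
  induction k with
  | zero =>
    have : (fun p : (E [×0]→L[ℝ] F) × E => p.1 (fun _ => p.2)) =
        fun p => continuousMultilinearCurryFin0 ℝ E F p.1 := by
      funext p
      exact congrArg p.1 (Subsingleton.elim _ _)
    rw [this]
    exact (LinearIsometryEquiv.contDiff _).comp contDiff_fst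
  | succ k ih =>
    let L := continuousMultilinearCurryLeftEquiv ℝ (fun _ : Fin (k + 1) => E) F
    have hL : ContDiff ℝ ∞ (fun p : (E [×(k + 1)]→L[ℝ] F) × E => L p.1) :=
      (LinearIsometryEquiv.contDiff (𝕜 := ℝ) (E := E [×(k + 1)]→L[ℝ] F)
        (F := E →L[ℝ] E [×k]→L[ℝ] F) L).comp contDiff_fst
    have := ih.comp ((hL.clm_apply contDiff_snd).prodMk contDiff_snd)
    convert! this using 1
    funext p
    simp only [Function.comp, L, continuousMultilinearCurryLeftEquiv_apply]
    congr 1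
    funext i
    refine Fin.cases rfl (fun _ => rfl) i

variable {n q : ℕ}

/-- The polynomial map with given derivatives, as coordinates of a jet (for `q = 0` an affine map
with linear part the identity). -/
def taylorMap (v : Jet.Coord q n n) (e : Eu n) : Eu n :=
  ∑ k : Fin (q + 1), ((k : ℕ).factorial : ℝ)⁻¹ • v.2 k (fun _ => e - v.1) +
    if q = 0 then e - v.1 else 0

theorem contDiff_taylorMap :
    ContDiff ℝ ∞ (fun p : Jet.Coord q n n × Eu n => taylorMap p.1 p.2) := by
  unfold taylorMap
  refine ContDiff.add (ContDiff.sum fun k _ => ?_) ?_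
  · refine ContDiff.const_smul (R := ℝ) _ ?_
    refine (contDiff_multilinear_diagonal (Eu n) (Eu n) k).comp
      (f := fun p : Jet.Coord q n n × Eu n => (p.1.2 k, p.2 - p.1.1)) ?_
    refine ContDiff.prodMk ?_ (by fun_prop)
    exact (ContinuousLinearMap.proj (R := ℝ)
      (φ := fun k : Fin (q + 1) => Eu n [×(k : ℕ)]→L[ℝ] Eu n) k).contDiff.comp
        (contDiff_snd.comp contDiff_fst)
  · split_ifs <;> fun_prop

theorem contDiff_taylorMap_right (v : Jet.Coord q n n) : ContDiff ℝ ∞ (taylorMap v) :=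
  ContDiff.comp (g := fun p : Jet.Coord q n n × Eu n => taylorMap p.1 p.2) (f := fun e => (v, e))
    contDiff_taylorMap (contDiff_const.prodMk contDiff_id)

/-- The jet coordinates of `f : Eu n → Eu n` at `x`. -/
def jetCoord (q : ℕ) (f : Eu n → Eu n) (x : Eu n) : Jet.Coord q n n :=
  (x, fun k => iteratedFDeriv ℝ k f x)

/-- A smooth map has the same derivatives as its Taylor polynomial. -/
theorem iteratedFDeriv_taylorMap {f : Eu n → Eu n} {x : Eu n} (hf : ContDiffAt ℝ ∞ f x) :
    ∀ k ≤ q, iteratedFDeriv ℝ k (taylorMap (jetCoord q f x)) x = iteratedFDeriv ℝ k f x := by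
  intro k hk
  rcases Nat.eq_zero_or_pos q with rfl | hq
  · obtain rfl : k = 0 := by omega
    ext v : 1
    simp [taylorMap, jetCoord]
  -- The polynomial is a finite power series. Its `k`-th derivative at the centre is the sum of `p
  -- k` over all permutations of the arguments; by symmetry of the derivatives of `f` these `k!`
  -- terms are equal and cancel the factorial.
  · let p : FormalMultilinearSeries ℝ (Eu n) (Eu n) := fun k =>
      if k < q + 1 then ((k.factorial : ℝ)⁻¹) • iteratedFDeriv ℝ k f x else 0
    have hp : HasFPowerSeriesOnBall (taylorMap (jetCoord q f x)) p x ⊤ := by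
      refine ⟨le_of_eq (p.radius_eq_top_of_eventually_eq_zero ?_).symm, by simp, ?_⟩
      · filter_upwards [eventually_ge_atTop (q + 1)] with k hk
        simp only [p, if_neg (not_lt.2 hk)]
      · intro y _
        have : taylorMap (jetCoord q f x) (x + y) = ∑ k ∈ Finset.range (q + 1), p k fun _ => y := by
          rw [Finset.sum_range]
          simp only [taylorMap, jetCoord, if_neg hq.ne', add_zero, add_sub_cancel_left]
          refine Finset.sum_congr rfl fun k _ => ?_
          simp only [p, if_pos k.2]
          rfl
        rw [this]
        refine hasSum_sum_of_ne_finset_zero fun k hk => ?_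
        have : ¬ k < q + 1 := by simpa using hk
        simp only [p, if_neg this, _root_.zero_apply]
    ext v : 1
    rw [hp.iteratedFDeriv_eq_sum_of_completeSpace]
    have h1 : ∀ σ : Equiv.Perm (Fin k), p k (fun i => v (σ i)) =
        ((k.factorial : ℝ)⁻¹) • iteratedFDeriv ℝ k f x v := by
      intro σ
      have := iteratedFDeriv_comp_perm hf v σ
      simp only [p, if_pos (Nat.lt_succ_of_le hk), _root_.smul_apply, ← this]
      rfl
    simp only [h1, Finset.sum_const, Finset.card_univ, Fintype.card_perm, Fintype.card_fin]
    rw [← Nat.cast_smul_eq_nsmul ℝ, smul_smul, mul_inv_cancel₀ (by positivity), one_smul]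

/-- For `q > 0` the linear part of the polynomial is that of `f`. A `0`-jet has no linear part, and
the identity is added in `taylorMap` to keep the map locally invertible. -/
theorem isInvertible_fderiv_taylorMap {f : Eu n → Eu n} {x : Eu n} (hf : ContDiffAt ℝ ∞ f x)
    (h : (fderiv ℝ f x).IsInvertible) :
    (fderiv ℝ (taylorMap (jetCoord q f x)) x).IsInvertible := by
  rcases Nat.eq_zero_or_pos q with rfl | hq
  · have : taylorMap (jetCoord 0 f x) = fun e => f x + (e - x) := by
      funext e
      simp [taylorMap, jetCoord]
    rw [this]
    have hd : HasFDerivAt (fun e => f x + (e - x)) (ContinuousLinearMap.id ℝ (Eu n)) x := by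
      simpa using ((hasFDerivAt_id (𝕜 := ℝ) x).sub_const x).const_add (f x)
    rw [hd.fderiv]
    exact ⟨ContinuousLinearEquiv.refl ℝ _, rfl⟩
  · have h1 := iteratedFDeriv_taylorMap (q := q) hf 1 hq
    have : fderiv ℝ (taylorMap (jetCoord q f x)) x = fderiv ℝ f x := by
      ext1 v
      have := DFunLike.congr_fun h1 (fun _ => v)
      simpa using this
    rwa [this]

end Taylor

/-! ### Jets in charts: independence of the charts, composition, smooth families -/

section JetCalculus

variable {d m n p : ℕ}
  {M : Type*} [TopologicalSpace M] [ChartedSpace (Eu m) M]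
  {N : Type*} [TopologicalSpace N] [ChartedSpace (Eu n) N]
  {P : Type*} [TopologicalSpace P] [ChartedSpace (Eu p) P]

theorem contMDiffAt_chart [IsManifold 𝓘(ℝ, Eu m) ∞ M] {a : OpenPartialHomeomorph M (Eu m)}
    (ha : a ∈ atlas (Eu m) M) {x : M} (hx : x ∈ a.source) :
    ContMDiffAt 𝓘(ℝ, Eu m) 𝓘(ℝ, Eu m) ∞ a x :=
  (contMDiffOn_of_mem_maximalAtlas (IsManifold.subset_maximalAtlas ha)).contMDiffAt
    (a.open_source.mem_nhds hx)

theorem contMDiffAt_chart_symm [IsManifold 𝓘(ℝ, Eu m) ∞ M] {a : OpenPartialHomeomorph M (Eu m)}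
    (ha : a ∈ atlas (Eu m) M) {e : Eu m} (he : e ∈ a.target) :
    ContMDiffAt 𝓘(ℝ, Eu m) 𝓘(ℝ, Eu m) ∞ a.symm e :=
  (contMDiffOn_symm_of_mem_maximalAtlas (IsManifold.subset_maximalAtlas ha)).contMDiffAt
    (a.open_target.mem_nhds he)

theorem contDiffAt_chart_comp [IsManifold 𝓘(ℝ, Eu m) ∞ M] [IsManifold 𝓘(ℝ, Eu n) ∞ N]
    {a : OpenPartialHomeomorph M (Eu m)} (ha : a ∈ atlas (Eu m) M)
    {b : OpenPartialHomeomorph N (Eu n)} (hb : b ∈ atlas (Eu n) N) {f : M → N} {x : M}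
    (hf : ContMDiffAt 𝓘(ℝ, Eu m) 𝓘(ℝ, Eu n) ∞ f x) (hx : x ∈ a.source) (hfx : f x ∈ b.source) :
    ContDiffAt ℝ ∞ (b ∘ f ∘ a.symm) (a x) := by
  rw [← contMDiffAt_iff_contDiffAt]
  have h1 := contMDiffAt_chart_symm ha (a.map_source hx)
  refine ContMDiffAt.comp (a x) (g := b) (I' := 𝓘(ℝ, Eu n)) ?_
    (ContMDiffAt.comp (a x) (g := f) (I' := 𝓘(ℝ, Eu m)) ?_ h1)
  · simpa [a.left_inv hx] using contMDiffAt_chart hb hfx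
  · simpa [a.left_inv hx] using hf

omit [ChartedSpace (Eu m) M] in
theorem eventually_chart_symm {a : OpenPartialHomeomorph M (Eu m)} {x : M} (hx : x ∈ a.source)
    {p : M → Prop} (h : ∀ᶠ y in 𝓝 x, p y) : ∀ᶠ e in 𝓝 (a x), p (a.symm e) := by
  have := (a.continuousAt_symm (a.map_source hx))
  rw [ContinuousAt, a.left_inv hx] at this
  exact this.eventually h

omit [ChartedSpace (Eu m) M] [ChartedSpace (Eu n) N] [ChartedSpace (Eu p) P] in
theorem chart_comp_eventuallyEq {f : M → N} {g : N → P} {x : M}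
    {a : OpenPartialHomeomorph M (Eu m)} {b : OpenPartialHomeomorph N (Eu n)}
    {c : OpenPartialHomeomorph P (Eu p)} (hf : ContinuousAt f x) (hx : x ∈ a.source)
    (hfx : f x ∈ b.source) :
    c ∘ (g ∘ f) ∘ a.symm =ᶠ[𝓝 (a x)] (c ∘ g ∘ b.symm) ∘ (b ∘ f ∘ a.symm) := by
  filter_upwards [eventually_chart_symm hx (hf.preimage_mem_nhds (b.open_source.mem_nhds hfx))]
    with e he
  simp only [Function.comp]
  rw [b.left_inv he]

theorem SameJet.of_eventuallyEq {q : ℕ} {x : M} {f g : M → N} (h : f =ᶠ[𝓝 x] g) :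
    SameJet m n q x f g :=
  ⟨h.eq_of_nhds, fun _ _ _ _ hx _ k _ => iteratedFDeriv_congr_of_eventuallyEq
    ((eventually_chart_symm hx h).mono fun _ he => by simp [he]) k⟩

theorem SameJet.symm {q : ℕ} {x : M} {f g : M → N} (h : SameJet m n q x f g) :
    SameJet m n q x g f :=
  ((jetSetoid m n M N q).symm (⟨rfl, h⟩ : (jetSetoid m n M N q) (x, f) (x, g))).2

theorem SameJet.trans {q : ℕ} {x : M} {f g l : M → N} (h : SameJet m n q x f g)
    (h' : SameJet m n q x g l) : SameJet m n q x f l :=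
  ((jetSetoid m n M N q).trans (⟨rfl, h⟩ : (jetSetoid m n M N q) (x, f) (x, g))
    (⟨rfl, h'⟩ : (jetSetoid m n M N q) (x, g) (x, l))).2

theorem SameJet.of_le {q q' : ℕ} {x : M} {f g : M → N} (h : SameJet m n q x f g) (hq : q' ≤ q) :
    SameJet m n q' x f g :=
  ⟨h.1, fun a ha b hb hx hf k hk => h.2 a ha b hb hx hf k (hk.trans hq)⟩

/-- With a chart inserted around `f x`, this is the higher chain rule: derivatives of a composition
up to order `q` are built from those of its factors. -/
theorem SameJet.comp [IsManifold 𝓘(ℝ, Eu m) ∞ M] [IsManifold 𝓘(ℝ, Eu n) ∞ N]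
    [IsManifold 𝓘(ℝ, Eu p) ∞ P] {q : ℕ} {x : M} {f f' : M → N} {g g' : N → P}
    (hf : ContMDiffAt 𝓘(ℝ, Eu m) 𝓘(ℝ, Eu n) ∞ f x)
    (hf' : ContMDiffAt 𝓘(ℝ, Eu m) 𝓘(ℝ, Eu n) ∞ f' x)
    (hg : ContMDiffAt 𝓘(ℝ, Eu n) 𝓘(ℝ, Eu p) ∞ g (f x))
    (hg' : ContMDiffAt 𝓘(ℝ, Eu n) 𝓘(ℝ, Eu p) ∞ g' (f x))
    (h : SameJet m n q x f f') (h' : SameJet n p q (f x) g g') :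
    SameJet m p q x (g ∘ f) (g' ∘ f') := by
  refine ⟨by simp only [Function.comp]; rw [h'.1, h.1], fun a ha c hc hx hgx k hk => ?_⟩
  let b := chartAt (Eu n) (f x)
  have hb : b ∈ atlas (Eu n) N := chart_mem_atlas _ _
  have hfb : f x ∈ b.source := mem_chart_source _ _
  have hfb' : f' x ∈ b.source := h.1 ▸ hfb
  unfold chartDeriv
  rw [iteratedFDeriv_congr_of_eventuallyEq (chart_comp_eventuallyEq hf.continuousAt hx hfb),
    iteratedFDeriv_congr_of_eventuallyEq (chart_comp_eventuallyEq hf'.continuousAt hx hfb')]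
  have e : (b ∘ f ∘ a.symm) (a x) = b (f x) := by simp [a.left_inv hx]
  refine iteratedFDeriv_comp_congr (contDiffAt_chart_comp ha hb hf hx hfb)
    (contDiffAt_chart_comp ha hb hf' hx hfb') ?_ ?_ ?_ ?_ ?_ k hk
  · rw [e]; exact contDiffAt_chart_comp hb hc hg hfb hgx
  · rw [e]; exact contDiffAt_chart_comp hb hc hg' hfb (h'.1 ▸ hgx)
  · simp [a.left_inv hx, h.1]
  · exact fun k hk => h.2 a ha b hb hx hfb k hk
  · rw [e]; exact fun k hk => h'.2 b hb c hc hfb hgx k hk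

/-- It is enough to compare jets of smooth maps in one pair of charts. -/
theorem SameJet.of_chart [IsManifold 𝓘(ℝ, Eu m) ∞ M] [IsManifold 𝓘(ℝ, Eu n) ∞ N]
    {q : ℕ} {x : M} {f f' : M → N}
    (hf : ContMDiffAt 𝓘(ℝ, Eu m) 𝓘(ℝ, Eu n) ∞ f x)
    (hf' : ContMDiffAt 𝓘(ℝ, Eu m) 𝓘(ℝ, Eu n) ∞ f' x) (h0 : f x = f' x)
    {a : OpenPartialHomeomorph M (Eu m)} (ha : a ∈ atlas (Eu m) M)
    {b : OpenPartialHomeomorph N (Eu n)} (hb : b ∈ atlas (Eu n) N)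
    (hx : x ∈ a.source) (hfx : f x ∈ b.source)
    (h : ∀ k ≤ q, chartDeriv a b f x k = chartDeriv a b f' x k) :
    SameJet m n q x f f' := by
  refine ⟨h0, fun a' ha' b' hb' hx' hfx' k hk => ?_⟩
  have key : ∀ g : M → N, ContinuousAt g x → g x ∈ b.source →
      b' ∘ g ∘ a'.symm =ᶠ[𝓝 (a' x)] (b' ∘ b.symm) ∘ ((b ∘ g ∘ a.symm) ∘ (a ∘ a'.symm)) := by
    intro g hg hgx
    filter_upwards [eventually_chart_symm hx' (hg.preimage_mem_nhds (b.open_source.mem_nhds hgx)),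
      eventually_chart_symm hx' (a.open_source.mem_nhds hx)] with e he he'
    simp only [Function.comp]
    rw [a.left_inv he', b.left_inv he]
  unfold chartDeriv
  rw [iteratedFDeriv_congr_of_eventuallyEq (key f hf.continuousAt hfx),
    iteratedFDeriv_congr_of_eventuallyEq (key f' hf'.continuousAt (h0 ▸ hfx))]
  have e1 : (a ∘ a'.symm) (a' x) = a x := by simp [a'.left_inv hx']
  have hA : ContDiffAt ℝ ∞ (a ∘ a'.symm) (a' x) :=
    contDiffAt_chart_comp ha' ha contMDiffAt_id hx' hx
  have hB : ContDiffAt ℝ ∞ (b' ∘ b.symm) (b (f x)) :=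
    contDiffAt_chart_comp hb hb' contMDiffAt_id hfx hfx'
  have hF := contDiffAt_chart_comp ha hb hf hx hfx
  have hF' := contDiffAt_chart_comp ha hb hf' hx (h0 ▸ hfx)
  have hFA : ContDiffAt ℝ ∞ ((b ∘ f ∘ a.symm) ∘ (a ∘ a'.symm)) (a' x) :=
    ContDiffAt.comp _ (by rwa [e1]) hA
  have hFA' : ContDiffAt ℝ ∞ ((b ∘ f' ∘ a.symm) ∘ (a ∘ a'.symm)) (a' x) :=
    ContDiffAt.comp _ (by rwa [e1]) hA
  have e2 : ((b ∘ f ∘ a.symm) ∘ (a ∘ a'.symm)) (a' x) = b (f x) := by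
    simp [a'.left_inv hx', a.left_inv hx]
  refine iteratedFDeriv_comp_congr hFA hFA' (by rwa [e2]) (by rwa [e2]) ?_ ?_
    (fun _ _ => rfl) k hk
  · simp [a'.left_inv hx', a.left_inv hx, h0]
  · refine iteratedFDeriv_comp_congr hA hA (by rwa [e1]) (by rwa [e1]) rfl (fun _ _ => rfl) ?_
    rw [e1]
    exact h

theorem Jet.mk_eq_mk {q : ℕ} {x x' : M} {f g : M → N} :
    (Jet.mk q x f : Jet m n q M N) = Jet.mk q x' g ↔ x = x' ∧ SameJet m n q x f g :=
  ⟨fun h => Quotient.exact h, fun h => Quotient.sound (s := jetSetoid m n M N q) h⟩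

theorem Jet.mk_congr {q : ℕ} {x : M} {f g : M → N} (h : f =ᶠ[𝓝 x] g) :
    (Jet.mk q x f : Jet m n q M N) = Jet.mk q x g :=
  Jet.mk_eq_mk.2 ⟨rfl, SameJet.of_eventuallyEq h⟩

theorem Jet.coord_mk {q : ℕ} (a : atlas (Eu m) M) (b : atlas (Eu n) N) {x : M} {f : M → N}
    (hx : x ∈ a.1.source) (hf : f x ∈ b.1.source) :
    Jet.coord a b (Jet.mk q x f) = ((a.1 x, fun k => chartDeriv a.1 b.1 f x k) : Jet.Coord q m n) :=
  if_pos ⟨hx, hf⟩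

section Family

variable {E : Type*} [NormedAddCommGroup E] [NormedSpace ℝ E]
  {H : Type*} [TopologicalSpace H] {I : ModelWithCorners ℝ E H} [I.Boundaryless]
  {T : Type*} [TopologicalSpace T] [ChartedSpace H T] [IsManifold I ∞ T]
  [IsManifold 𝓘(ℝ, Eu m) ∞ M] [IsManifold 𝓘(ℝ, Eu n) ∞ N]

/-- The derivatives of a smooth family of maps are smooth in the parameters. -/
theorem contMDiffAt_chartDeriv {G : T → M → N} {x : T → M} {t₀ : T}
    (hG : ContMDiffAt (I.prod 𝓘(ℝ, Eu m)) 𝓘(ℝ, Eu n) ∞ (fun p : T × M => G p.1 p.2) (t₀, x t₀))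
    (hx : ContMDiffAt I 𝓘(ℝ, Eu m) ∞ x t₀)
    {a : OpenPartialHomeomorph M (Eu m)} (ha : a ∈ atlas (Eu m) M)
    {b : OpenPartialHomeomorph N (Eu n)} (hb : b ∈ atlas (Eu n) N)
    (hxa : x t₀ ∈ a.source) (hxb : G t₀ (x t₀) ∈ b.source) (k : ℕ) :
    ContMDiffAt I 𝓘(ℝ, Eu m [×k]→L[ℝ] Eu n) ∞ (fun t => chartDeriv a b (G t) (x t) k) t₀ := by
  -- In a chart of the parameter manifold the family is a smooth map of two vector variables, and
  -- `contDiffAt_iteratedFDeriv_param` applies.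
  let φ := extChartAt I t₀
  let F : E → Eu m → Eu n := fun τ e => b (G (φ.symm τ) (a.symm e))
  have hφ0 : φ.symm (φ t₀) = t₀ := extChartAt_to_inv t₀
  have hF : ContDiffAt ℝ ∞ (fun p : E × Eu m => F p.1 p.2) (φ t₀, a (x t₀)) := by
    rw [← contMDiffAt_iff_contDiffAt]
    have h1 : ContMDiffAt 𝓘(ℝ, E × Eu m) I ∞ (fun p : E × Eu m => φ.symm p.1)
        (φ t₀, a (x t₀)) := by
      refine ContMDiffAt.comp (φ t₀, a (x t₀)) (g := φ.symm) (I' := 𝓘(ℝ, E)) ?_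
        contDiffAt_fst.contMDiffAt
      exact (contMDiffOn_extChartAt_symm t₀).contMDiffAt (extChartAt_target_mem_nhds t₀)
    have h2 : ContMDiffAt 𝓘(ℝ, E × Eu m) 𝓘(ℝ, Eu m) ∞ (fun p : E × Eu m => a.symm p.2)
        (φ t₀, a (x t₀)) :=
      ContMDiffAt.comp (φ t₀, a (x t₀)) (g := a.symm) (I' := 𝓘(ℝ, Eu m))
        (contMDiffAt_chart_symm ha (a.map_source hxa)) contDiffAt_snd.contMDiffAt
    refine ContMDiffAt.comp (φ t₀, a (x t₀)) (g := b) (I' := 𝓘(ℝ, Eu n)) ?_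
      (ContMDiffAt.comp (φ t₀, a (x t₀)) (g := fun p : T × M => G p.1 p.2)
        (f := fun p : E × Eu m => (φ.symm p.1, a.symm p.2)) ?_ (h1.prodMk h2))
    · simp only [hφ0, a.left_inv hxa]
      exact contMDiffAt_chart hb hxb
    · simpa only [hφ0, a.left_inv hxa] using hG
  have hD := contDiffAt_iteratedFDeriv_param hF k
  have hc : ContMDiffAt I 𝓘(ℝ, E × Eu m) ∞ (fun t => (φ t, a (x t))) t₀ :=
    contMDiffAt_extChartAt.prodMk_space
      (ContMDiffAt.comp t₀ (contMDiffAt_chart ha hxa) hx)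
  refine (ContMDiffAt.comp t₀ (hD.contMDiffAt) hc).congr_of_eventuallyEq ?_
  filter_upwards [extChartAt_source_mem_nhds (I := I) t₀] with t ht
  simp only [Function.comp, chartDeriv]
  have : φ.symm (φ t) = t := φ.left_inv ht
  simp only [F, this]
  rfl

theorem contMDiffAt_coord {q : ℕ} {G : T → M → N} {x : T → M} {t₀ : T}
    (hG : ContMDiffAt (I.prod 𝓘(ℝ, Eu m)) 𝓘(ℝ, Eu n) ∞ (fun p : T × M => G p.1 p.2) (t₀, x t₀))
    (hx : ContMDiffAt I 𝓘(ℝ, Eu m) ∞ x t₀) (a : atlas (Eu m) M) (b : atlas (Eu n) N)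
    (hxa : x t₀ ∈ a.1.source) (hxb : G t₀ (x t₀) ∈ b.1.source) :
    ContMDiffAt I 𝓘(ℝ, Jet.Coord q m n) ∞ (fun t => Jet.coord a b (Jet.mk q (x t) (G t))) t₀ := by
  have h : ContMDiffAt I 𝓘(ℝ, Jet.Coord q m n) ∞
      (fun t => ((a.1 (x t), fun k => chartDeriv a.1 b.1 (G t) (x t) k) : Jet.Coord q m n)) t₀ :=
    (ContMDiffAt.comp t₀ (contMDiffAt_chart a.2 hxa) hx).prodMk_space
      (contMDiffAt_pi_space.2 fun k => contMDiffAt_chartDeriv hG hx a.2 b.2 hxa hxb k)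
  refine h.congr_of_eventuallyEq ?_
  have hc : ContinuousAt (fun t => G t (x t)) t₀ :=
    ContinuousAt.comp (g := fun p : T × M => G p.1 p.2)
      (f := fun t => (t, x t)) hG.continuousAt
      (continuousAt_id.prodMk hx.continuousAt)
  filter_upwards [hx.continuousAt.preimage_mem_nhds (a.1.open_source.mem_nhds hxa),
    hc.preimage_mem_nhds (b.1.open_source.mem_nhds hxb)] with t h1 h2
  exact Jet.coord_mk a b h1 h2

end Family

/-- The jets of a smooth family of maps form a smooth map into the jet bundle. -/
theorem smoothOn_mk {T : Type*} [TopologicalSpace T] [ChartedSpace (Eu d) T]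
    [IsManifold 𝓘(ℝ, Eu d) ∞ T] [IsManifold 𝓘(ℝ, Eu m) ∞ M] [IsManifold 𝓘(ℝ, Eu n) ∞ N]
    {q : ℕ} {G : T → M → N} {x : T → M} {U : Set T}
    (hG : ∀ t ∈ U, ContMDiffAt (𝓘(ℝ, Eu d).prod 𝓘(ℝ, Eu m)) 𝓘(ℝ, Eu n) ∞
      (fun p : T × M => G p.1 p.2) (t, x t))
    (hx : ∀ t ∈ U, ContMDiffAt 𝓘(ℝ, Eu d) 𝓘(ℝ, Eu m) ∞ x t) :
    Jet.SmoothOn d (fun t => (Jet.mk q (x t) (G t) : Jet m n q M N)) U := by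
  refine ⟨fun t ht => (hx t ht).continuousAt.continuousWithinAt, fun t ht => ?_, fun a b t ht => ?_⟩
  · exact (ContinuousAt.comp (g := fun p : T × M => G p.1 p.2)
      (f := fun t => (t, x t)) (hG t ht).continuousAt
      (continuousAt_id.prodMk (hx t ht).continuousAt)).continuousWithinAt
  · exact (contMDiffAt_coord (hG t ht.1) (hx t ht.1) a b ht.2.1 ht.2.2).contMDiffWithinAt

end JetCalculus

/-! ### Local diffeomorphisms in charts -/

section LocalDiffeo

variable {n : ℕ} {X : Type*} [TopologicalSpace X] [ChartedSpace (Eu n) X]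

theorem LocalDiffeoAt.contMDiffAt {φ : X → X} {x : X} (h : LocalDiffeoAt n φ x) :
    ContMDiffAt 𝓘(ℝ, Eu n) 𝓘(ℝ, Eu n) ∞ φ x :=
  IsLocalDiffeomorphAt.contMDiffAt h

theorem LocalDiffeoAt.eventually {φ : X → X} {x : X} (h : LocalDiffeoAt n φ x) :
    ∀ᶠ y in 𝓝 x, LocalDiffeoAt n φ y := by
  obtain ⟨Φ, hx, hΦ⟩ := h
  filter_upwards [Φ.open_source.mem_nhds hx] with y hy
  exact ⟨Φ, hy, hΦ⟩

theorem LocalDiffeoAt.comp {φ ψ : X → X} {x : X} (h : LocalDiffeoAt n φ x)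
    (h' : LocalDiffeoAt n ψ (φ x)) : LocalDiffeoAt n (ψ ∘ φ) x :=
  IsLocalDiffeomorphAt.comp (K := 𝓘(ℝ, Eu n)) _ h h'

theorem localDiffeoAt_id (x : X) : LocalDiffeoAt n (id : X → X) x :=
  (Diffeomorph.refl 𝓘(ℝ, Eu n) X ∞).isLocalDiffeomorph x

theorem LocalDiffeoAt.exists_inverse {φ : X → X} {x : X} (h : LocalDiffeoAt n φ x) :
    ∃ ψ : X → X, LocalDiffeoAt n ψ (φ x) ∧ ψ ∘ φ =ᶠ[𝓝 x] id ∧ φ ∘ ψ =ᶠ[𝓝 (φ x)] id :=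
  ⟨_, h.localInverse_isLocalDiffeomorphAt, h.localInverse_eventuallyEq_left,
    h.localInverse_eventuallyEq_right⟩

variable [IsManifold 𝓘(ℝ, Eu n) ∞ X]

theorem LocalDiffeoAt.isInvertible_fderiv {φ : X → X} {x : X} (h : LocalDiffeoAt n φ x)
    {a b : OpenPartialHomeomorph X (Eu n)} (ha : a ∈ atlas (Eu n) X) (hb : b ∈ atlas (Eu n) X)
    (hx : x ∈ a.source) (hφx : φ x ∈ b.source) :
    (fderiv ℝ (b ∘ φ ∘ a.symm) (a x)).IsInvertible := by
  obtain ⟨ψ, hψ, h1, h2⟩ := h.exists_inverse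
  have hψx : ψ (φ x) = x := h1.eq_of_nhds
  have hf := contDiffAt_chart_comp ha hb h.contMDiffAt hx hφx
  have hg := contDiffAt_chart_comp hb ha hψ.contMDiffAt hφx (by rwa [hψx])
  have e1 : (b ∘ φ ∘ a.symm) (a x) = b (φ x) := by simp [a.left_inv hx]
  have e2 : (a ∘ ψ ∘ b.symm) (b (φ x)) = a x := by simp [b.left_inv hφx, hψx]
  have hfd := (hf.differentiableAt (by simp)).hasFDerivAt
  have hgd := (hg.differentiableAt (by simp)).hasFDerivAt
  have i1 : (a ∘ ψ ∘ b.symm) ∘ (b ∘ φ ∘ a.symm) =ᶠ[𝓝 (a x)] id := by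
    filter_upwards [(chart_comp_eventuallyEq (g := ψ) (c := a) h.contMDiffAt.continuousAt hx
      hφx).symm, eventually_chart_symm hx h1, a.open_target.mem_nhds (a.map_source hx)]
      with e he he' hea
    rw [he]
    simp only [Function.comp, id] at he' ⊢
    rw [he', a.right_inv hea]
  have i2 : (b ∘ φ ∘ a.symm) ∘ (a ∘ ψ ∘ b.symm) =ᶠ[𝓝 (b (φ x))] id := by
    filter_upwards [(chart_comp_eventuallyEq (g := φ) (c := b) (b := a) hψ.contMDiffAt.continuousAt
      hφx (by rwa [hψx])).symm, eventually_chart_symm hφx h2,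
      b.open_target.mem_nhds (b.map_source hφx)] with e he he' hea
    rw [he]
    simp only [Function.comp, id] at he' ⊢
    rw [he', b.right_inv hea]
  refine ContinuousLinearMap.IsInvertible.of_inverse
    (g := fderiv ℝ (a ∘ ψ ∘ b.symm) (b (φ x))) ?_ ?_
  · rw [← e2] at hfd
    have := (hfd.comp _ hgd).congr_of_eventuallyEq i2.symm
    rw [e2] at this
    exact this.unique (hasFDerivAt_id _)
  · rw [← e1] at hgd
    have := (hgd.comp _ hfd).congr_of_eventuallyEq i1.symm
    rw [e1] at this
    exact this.unique (hasFDerivAt_id _)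

/-- A chart as a partial diffeomorphism. -/
def chartPartialDiffeomorph {a : OpenPartialHomeomorph X (Eu n)} (ha : a ∈ atlas (Eu n) X) :
    PartialDiffeomorph 𝓘(ℝ, Eu n) 𝓘(ℝ, Eu n) X (Eu n) ∞ where
  toPartialEquiv := a.toPartialEquiv
  open_source := a.open_source
  open_target := a.open_target
  contMDiffOn_toFun := contMDiffOn_of_mem_maximalAtlas (IsManifold.subset_maximalAtlas ha)
  contMDiffOn_invFun := contMDiffOn_symm_of_mem_maximalAtlas (IsManifold.subset_maximalAtlas ha)

theorem localDiffeoAt_of_chart {a b : OpenPartialHomeomorph X (Eu n)} (ha : a ∈ atlas (Eu n) X)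
    (hb : b ∈ atlas (Eu n) X) {f : Eu n → Eu n} (hf : ContDiff ℝ ∞ f) {x : X} (hx : x ∈ a.source)
    (h : (fderiv ℝ f (a x)).IsInvertible) (hfx : f (a x) ∈ b.target) :
    LocalDiffeoAt n (b.symm ∘ f ∘ a) x := by
  obtain ⟨e, hae, -, he, hsm⟩ := exists_openPartialHomeomorph_of_isInvertible isOpen_univ
    hf.contDiffOn (mem_univ (a x)) h
  let Φ : PartialDiffeomorph 𝓘(ℝ, Eu n) 𝓘(ℝ, Eu n) (Eu n) (Eu n) ∞ :=
    { toPartialEquiv := e.toPartialEquiv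
      open_source := e.open_source
      open_target := e.open_target
      contMDiffOn_toFun := by
        change ContMDiffOn _ _ _ e _
        rw [he]; exact hf.contMDiff.contMDiffOn
      contMDiffOn_invFun := hsm.contMDiffOn }
  have h1 : IsLocalDiffeomorphAt 𝓘(ℝ, Eu n) 𝓘(ℝ, Eu n) ∞ a x :=
    ⟨chartPartialDiffeomorph ha, hx, fun _ _ => rfl⟩
  have h2 : IsLocalDiffeomorphAt 𝓘(ℝ, Eu n) 𝓘(ℝ, Eu n) ∞ f (a x) :=
    ⟨Φ, hae, fun _ _ => by rw [← he]; rfl⟩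
  have h3 : IsLocalDiffeomorphAt 𝓘(ℝ, Eu n) 𝓘(ℝ, Eu n) ∞ b.symm (f (a x)) :=
    ⟨(chartPartialDiffeomorph hb).symm, hfx, fun _ _ => rfl⟩
  exact IsLocalDiffeomorphAt.comp (K := 𝓘(ℝ, Eu n)) _ h1
    (IsLocalDiffeomorphAt.comp (K := 𝓘(ℝ, Eu n)) _ h2 h3)

theorem exists_localDiffeoAt (x y : X) : ∃ φ : X → X, LocalDiffeoAt n φ x ∧ φ x = y := by
  let a := chartAt (Eu n) x
  let b := chartAt (Eu n) y
  have hy : b y ∈ b.target := mem_chart_target _ _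
  refine ⟨b.symm ∘ (fun e => b y + (e - a x)) ∘ a, localDiffeoAt_of_chart (chart_mem_atlas _ _)
    (chart_mem_atlas _ _) (by fun_prop) (mem_chart_source _ _) ?_ (by simpa [a] using hy), ?_⟩
  · have hd : HasFDerivAt (fun e => b y + (e - a x)) (ContinuousLinearMap.id ℝ (Eu n)) (a x) := by
      simpa using ((hasFDerivAt_id (𝕜 := ℝ) (a x)).sub_const (a x)).const_add (b y)
    rw [hd.fderiv]
    exact ⟨ContinuousLinearEquiv.refl ℝ _, rfl⟩
  · simp [b]

end LocalDiffeo

/-! ### Recovering a jet from its coordinates -/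

section JetMap

variable {n q : ℕ} {X : Type*} [TopologicalSpace X] [ChartedSpace (Eu n) X]

/-- The map with prescribed jet coordinates `v` at its source, and with prescribed target `y`. -/
def jetMap (a b : OpenPartialHomeomorph X (Eu n)) (y : Eu n) (v : Jet.Coord q n n) (p : X) : X :=
  b.symm (y + (taylorMap v (a p) - taylorMap v v.1))

/-- The coordinates, except for those of the target, of jets of local diffeomorphisms with source
in the domain of the chart `a`. -/
def regularCoord (q : ℕ) (a : OpenPartialHomeomorph X (Eu n)) : Set (Jet.Coord q n n) :=
  {v | v.1 ∈ a.target ∧ (fderiv ℝ (taylorMap v) v.1).IsInvertible}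

omit [ChartedSpace (Eu n) X] in
theorem isOpen_regularCoord (a : OpenPartialHomeomorph X (Eu n)) :
    IsOpen (regularCoord q a) := by
  have h : Continuous (fun v : Jet.Coord q n n => fderiv ℝ (taylorMap v) v.1) := by
    have : ContDiff ℝ 0 (fun v : Jet.Coord q n n => fderiv ℝ (taylorMap v) v.1) :=
      ContDiff.fderiv (contDiff_taylorMap (q := q) (n := n)) contDiff_fst (by simp)
    exact this.continuous
  exact (a.open_target.preimage continuous_fst).inter
    ((ContinuousLinearEquiv.isOpen (𝕜 := ℝ) (E := Eu n) (F := Eu n)).preimage h)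

omit [ChartedSpace (Eu n) X] in
-- The translation in `jetMap` moves the target to `y` whatever the order-zero coordinate of `v` is.
-- Thus, for `y` the coordinates of `π z`, every `v` in the open set `regularCoord` gives a jet that
-- can act on `z`, and orbit maps are defined on open subsets of a vector space.
theorem jetMap_source {a b : OpenPartialHomeomorph X (Eu n)} (y : Eu n) {v : Jet.Coord q n n}
    (hv : v ∈ regularCoord q a) : jetMap a b y v (a.symm v.1) = b.symm y := by
  simp [jetMap, a.right_inv hv.1]

variable [IsManifold 𝓘(ℝ, Eu n) ∞ X]

theorem localDiffeoAt_jetMap {a b : OpenPartialHomeomorph X (Eu n)} (ha : a ∈ atlas (Eu n) X)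
    (hb : b ∈ atlas (Eu n) X) {y : Eu n} (hy : y ∈ b.target) {v : Jet.Coord q n n}
    (hv : v ∈ regularCoord q a) : LocalDiffeoAt n (jetMap a b y v) (a.symm v.1) := by
  have hT : ContDiff ℝ ∞ (taylorMap v) := contDiff_taylorMap_right v
  refine localDiffeoAt_of_chart ha hb (f := fun e => y + (taylorMap v e - taylorMap v v.1))
    (by fun_prop) (a.map_target hv.1) ?_ (by simpa [a.right_inv hv.1] using hy)
  rw [a.right_inv hv.1]
  have hT' : HasFDerivAt (taylorMap v) (fderiv ℝ (taylorMap v) v.1) v.1 :=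
    (hT.contDiffAt.differentiableAt (by simp)).hasFDerivAt
  have hd : HasFDerivAt (fun e => y + (taylorMap v e - taylorMap v v.1))
      (fderiv ℝ (taylorMap v) v.1) v.1 := (hT'.sub_const (taylorMap v v.1)).const_add y
  rw [hd.fderiv]
  exact hv.2

theorem contMDiffAt_jetMap {a b : OpenPartialHomeomorph X (Eu n)} (ha : a ∈ atlas (Eu n) X)
    (hb : b ∈ atlas (Eu n) X) {y : Eu n} (hy : y ∈ b.target) {v : Jet.Coord q n n}
    (hv : v ∈ regularCoord q a) :
    ContMDiffAt (𝓘(ℝ, Eu n × Jet.Coord q n n).prod 𝓘(ℝ, Eu n)) 𝓘(ℝ, Eu n) ∞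
      (fun r : (Eu n × Jet.Coord q n n) × X => jetMap a b r.1.1 r.1.2 r.2) ((y, v), a.symm v.1) := by
  have h1 : ContMDiffAt (𝓘(ℝ, Eu n × Jet.Coord q n n).prod 𝓘(ℝ, Eu n))
      𝓘(ℝ, (Eu n × Jet.Coord q n n) × Eu n) ∞
      (fun r : (Eu n × Jet.Coord q n n) × X => (r.1, a r.2)) ((y, v), a.symm v.1) :=
    contMDiffAt_fst.prodMk_space (ContMDiffAt.comp ((y, v), a.symm v.1) (I' := 𝓘(ℝ, Eu n)) (g := a)
      (contMDiffAt_chart ha (a.map_target hv.1)) contMDiffAt_snd)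
  have h2 : ContDiff ℝ ∞ (fun r : (Eu n × Jet.Coord q n n) × Eu n =>
      r.1.1 + (taylorMap r.1.2 r.2 - taylorMap r.1.2 r.1.2.1)) := by
    refine ContDiff.add (by fun_prop) (ContDiff.sub ?_ ?_)
    · exact contDiff_taylorMap.comp (f := fun r : (Eu n × Jet.Coord q n n) × Eu n =>
        (r.1.2, r.2)) (by fun_prop)
    · exact contDiff_taylorMap.comp (f := fun r : (Eu n × Jet.Coord q n n) × Eu n =>
        (r.1.2, r.1.2.1)) (by fun_prop)
  refine ContMDiffAt.comp ((y, v), a.symm v.1) (I' := 𝓘(ℝ, Eu n)) (g := b.symm) ?_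
    (ContMDiffAt.comp ((y, v), a.symm v.1) (g := fun r : (Eu n × Jet.Coord q n n) × Eu n =>
      r.1.1 + (taylorMap r.1.2 r.2 - taylorMap r.1.2 r.1.2.1)) (h2.contMDiff.contMDiffAt) h1)
  simpa [a.right_inv hv.1] using contMDiffAt_chart_symm hb hy

/-- A smooth family of parameters yields a smooth family of maps. -/
theorem contMDiffAt_jetMap_family {E : Type*} [NormedAddCommGroup E] [NormedSpace ℝ E]
    {H : Type*} [TopologicalSpace H] {I : ModelWithCorners ℝ E H}
    {T : Type*} [TopologicalSpace T] [ChartedSpace H T] {a b : OpenPartialHomeomorph X (Eu n)}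
    (ha : a ∈ atlas (Eu n) X) (hb : b ∈ atlas (Eu n) X) {y : T → Eu n} {v : T → Jet.Coord q n n}
    {t : T} (hy : ContMDiffAt I 𝓘(ℝ, Eu n) ∞ y t)
    (hv : ContMDiffAt I 𝓘(ℝ, Jet.Coord q n n) ∞ v t)
    (hyt : y t ∈ b.target) (hvt : v t ∈ regularCoord q a) :
    ContMDiffAt (I.prod 𝓘(ℝ, Eu n)) 𝓘(ℝ, Eu n) ∞
      (fun r : T × X => jetMap a b (y r.1) (v r.1) r.2) (t, a.symm (v t).1) := by
  refine ContMDiffAt.comp (t, a.symm (v t).1) (f := fun r : T × X => ((y r.1, v r.1), r.2))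
    (contMDiffAt_jetMap ha hb hyt hvt) ?_
  refine ContMDiffAt.prodMk ?_ contMDiffAt_snd
  exact ContMDiffAt.comp (t, a.symm (v t).1) (f := fun r : T × X => r.1)
    (g := fun t => (y t, v t)) (hy.prodMk_space hv) contMDiffAt_fst

theorem coord_mem_regularCoord {φ : X → X} {x : X} (h : LocalDiffeoAt n φ x)
    (a b : atlas (Eu n) X) (hx : x ∈ a.1.source) (hφx : φ x ∈ b.1.source) :
    Jet.coord a b (Jet.mk q x φ) ∈ regularCoord q a.1 := by
  rw [Jet.coord_mk a b hx hφx]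
  exact ⟨a.1.map_source hx, isInvertible_fderiv_taylorMap
    (contDiffAt_chart_comp a.2 b.2 h.contMDiffAt hx hφx) (h.isInvertible_fderiv a.2 b.2 hx hφx)⟩

/-- A jet can be recovered from its coordinates. -/
theorem mk_jetMap_coord {φ : X → X} {x : X} (h : LocalDiffeoAt n φ x)
    (a b : atlas (Eu n) X) (hx : x ∈ a.1.source) (hφx : φ x ∈ b.1.source) :
    (Jet.mk q (a.1.symm (Jet.coord a b (Jet.mk q x φ)).1)
      (jetMap a.1 b.1 (b.1 (φ x)) (Jet.coord a b (Jet.mk q x φ))) : Jet n n q X X) =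
    Jet.mk q x φ := by
  have hv := coord_mem_regularCoord (q := q) h a b hx hφx
  have hd := localDiffeoAt_jetMap a.2 b.2 (b.1.map_source hφx) hv
  set v : Jet.Coord q n n := Jet.coord a b (Jet.mk q x φ) with hvdef
  have hv' : v = jetCoord q (b.1 ∘ φ ∘ a.1.symm) (a.1 x) := Jet.coord_mk a b hx hφx
  have hv1 : v.1 = a.1 x := by rw [hv']; rfl
  have hvx : a.1.symm v.1 = x := by rw [hv1, a.1.left_inv hx]
  have hf := contDiffAt_chart_comp a.2 b.2 h.contMDiffAt hx hφx
  have hval : jetMap a.1 b.1 (b.1 (φ x)) v x = φ x := by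
    have := jetMap_source (b := b.1) (b.1 (φ x)) hv
    rwa [hvx, b.1.left_inv hφx] at this
  rw [hvx] at hd ⊢
  refine Jet.mk_eq_mk.2 ⟨rfl, SameJet.of_chart hd.contMDiffAt h.contMDiffAt hval a.2 b.2 hx
    (by rwa [hval]) fun k hk => ?_⟩
  have hT := iteratedFDeriv_taylorMap (q := q) hf
  -- For coordinates that come from a jet with this target, the translation in `jetMap` is trivial.
  have hT0 : taylorMap v v.1 = b.1 (φ x) := by
    have := DFunLike.congr_fun (hT 0 (Nat.zero_le _)) 0
    simp only [iteratedFDeriv_zero_apply, ← hv', Function.comp, a.1.left_inv hx] at this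
    rw [hv1, this]
  unfold chartDeriv
  rw [← hT k hk, ← hv']
  refine iteratedFDeriv_congr_of_eventuallyEq ?_ k
  have hc : ContinuousAt (taylorMap v) (a.1 x) :=
    (contDiff_taylorMap_right v).continuous.continuousAt
  have hmem : taylorMap v (a.1 x) ∈ b.1.target := by
    rw [← hv1, hT0]; exact b.1.map_source hφx
  filter_upwards [a.1.open_target.mem_nhds (a.1.map_source hx),
    hc.preimage_mem_nhds (b.1.open_target.mem_nhds hmem)] with e he he'
  simp only [Function.comp, jetMap, a.1.right_inv he, hT0, add_sub_cancel]
  exact b.1.right_inv he'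

end JetMap

/-! ### Smoothness of the action and pullback of sections -/

namespace NaturalAction

variable {n N q : ℕ}
  {X : Type*} [TopologicalSpace X] [ChartedSpace (Eu n) X]
  {Z : Type*} [TopologicalSpace Z] [ChartedSpace (Eu N) Z]
  {π : Z → X} (A : NaturalAction n N q π)

/-- The action of the jet with coordinates `v` (its target being determined by `z`). -/
def actCoord (a b : OpenPartialHomeomorph X (Eu n)) (z : Z) (v : Jet.Coord q n n) : Z :=
  A.act z (Jet.mk q (a.symm v.1) (jetMap a b (b (π z)) v))

variable [IsManifold 𝓘(ℝ, Eu n) ∞ X] [IsManifold 𝓘(ℝ, Eu N) ∞ Z]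

/-- Smoothness of the action is given on test maps from Euclidean spaces only. A chart of `Z` and a
linear isomorphism `ℓ` identify the pairs `(z, v)` with points of an open subset of one Euclidean
space; the universal test map on it yields joint smoothness. -/
theorem contMDiffAt_actCoord (hπ : ContMDiff 𝓘(ℝ, Eu N) 𝓘(ℝ, Eu n) ∞ π)
    {a b : OpenPartialHomeomorph X (Eu n)} (ha : a ∈ atlas (Eu n) X) (hb : b ∈ atlas (Eu n) X)
    {z : Z} {v : Jet.Coord q n n} (hz : π z ∈ b.source) (hv : v ∈ regularCoord q a) :
    ContMDiffAt (𝓘(ℝ, Eu N).prod 𝓘(ℝ, Jet.Coord q n n)) 𝓘(ℝ, Eu N) ∞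
      (fun p : Z × Jet.Coord q n n => A.actCoord a b p.1 p.2) (z, v) := by
  let c := chartAt (Eu N) z
  let ℓ : (Eu N × Jet.Coord q n n) ≃L[ℝ] Eu (Module.finrank ℝ (Eu N × Jet.Coord q n n)) :=
    toEuclidean
  let W : Set (Eu N × Jet.Coord q n n) :=
    (c.target ∩ c.symm ⁻¹' (π ⁻¹' b.source)) ×ˢ regularCoord q a
  have hW : IsOpen W := (c.isOpen_inter_preimage_symm (b.open_source.preimage hπ.continuous)).prod
    (isOpen_regularCoord a)
  let U := ℓ.symm ⁻¹' W
  have hU : IsOpen U := hW.preimage ℓ.symm.continuous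
  let u : Eu (Module.finrank ℝ (Eu N × Jet.Coord q n n)) → Z := fun t => c.symm (ℓ.symm t).1
  have hu : ∀ t ∈ U, ContMDiffAt 𝓘(ℝ, Eu (Module.finrank ℝ (Eu N × Jet.Coord q n n)))
      𝓘(ℝ, Eu N) ∞ u t := fun t ht =>
    ContMDiffAt.comp t (I' := 𝓘(ℝ, Eu N)) (g := c.symm)
      (contMDiffAt_chart_symm (chart_mem_atlas _ _) ht.1.1)
      (contDiff_fst.comp ℓ.symm.contDiff).contMDiff.contMDiffAt
  have hsm : ContMDiffOn 𝓘(ℝ, Eu (Module.finrank ℝ (Eu N × Jet.Coord q n n))) 𝓘(ℝ, Eu N) ∞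
      (fun t => A.actCoord a b (u t) (ℓ.symm t).2) U := by
    refine A.smooth_act _ U u _ hU (fun t ht => (hu t ht).contMDiffWithinAt) ?_ ?_
    · refine smoothOn_mk (G := fun t => jetMap a b (b (π (u t))) (ℓ.symm t).2)
        (x := fun t => a.symm (ℓ.symm t).2.1) (fun t ht => ?_) (fun t ht => ?_)
      · refine contMDiffAt_jetMap_family (y := fun t => b (π (u t)))
          (v := fun t => (ℓ.symm t).2) ha hb ?_
          (contDiff_snd.comp ℓ.symm.contDiff).contMDiff.contMDiffAt (b.map_source ht.1.2) ht.2
        exact ContMDiffAt.comp t (I' := 𝓘(ℝ, Eu n)) (contMDiffAt_chart hb ht.1.2)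
          (hπ.contMDiffAt.comp t (hu t ht))
      · exact ContMDiffAt.comp t (I' := 𝓘(ℝ, Eu n)) (contMDiffAt_chart_symm ha ht.2.1)
          (contDiff_fst.comp (contDiff_snd.comp ℓ.symm.contDiff)).contMDiff.contMDiffAt
    · intro t ht
      refine ⟨⟨_, _, localDiffeoAt_jetMap ha hb (b.map_source ht.1.2) ht.2, rfl⟩, ?_⟩
      have := jetMap_source (b := b) (b (π (u t))) ht.2
      rw [b.left_inv ht.1.2] at this
      exact this.symm
  have hc : ContMDiffAt (𝓘(ℝ, Eu N).prod 𝓘(ℝ, Jet.Coord q n n))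
      𝓘(ℝ, Eu (Module.finrank ℝ (Eu N × Jet.Coord q n n))) ∞
      (fun p : Z × Jet.Coord q n n => ℓ (c p.1, p.2)) (z, v) := by
    refine ContMDiffAt.comp (z, v) (I' := 𝓘(ℝ, Eu N × Jet.Coord q n n)) (g := ℓ)
      ℓ.contDiff.contMDiff.contMDiffAt (ContMDiffAt.prodMk_space ?_ contMDiffAt_snd)
    exact ContMDiffAt.comp (z, v) (I' := 𝓘(ℝ, Eu N)) (g := c)
      (contMDiffAt_chart (chart_mem_atlas _ _) (mem_chart_source _ _)) contMDiffAt_fst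
  have hzU : ℓ (c z, v) ∈ U := by
    have hzs : z ∈ c.source := mem_chart_source _ _
    refine ⟨⟨?_, ?_⟩, ?_⟩
    · simpa using c.map_source hzs
    · simpa [c.left_inv hzs] using hz
    · simpa using hv
  refine (ContMDiffAt.comp (z, v) (hsm.contMDiffAt (hU.mem_nhds hzU)) hc).congr_of_eventuallyEq ?_
  have : ∀ᶠ p : Z × Jet.Coord q n n in 𝓝 (z, v), p.1 ∈ c.source :=
    continuousAt_fst.preimage_mem_nhds (c.open_source.mem_nhds (mem_chart_source _ _))
  filter_upwards [this] with p hp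
  simp [u, c.left_inv hp]

omit [IsManifold 𝓘(ℝ, Eu N) ∞ Z] in
theorem actCoord_coord {φ : X → X} {x : X} (h : LocalDiffeoAt n φ x)
    (a b : atlas (Eu n) X) (hx : x ∈ a.1.source) (hφx : φ x ∈ b.1.source) {z : Z}
    (hz : π z = φ x) :
    A.actCoord a.1 b.1 z (Jet.coord a b (Jet.mk q x φ)) = A.act z (Jet.mk q x φ) := by
  unfold actCoord
  rw [hz, mk_jetMap_coord h a b hx hφx]

/-- The action is smooth along smooth families. -/
theorem contMDiffAt_act (hπ : ContMDiff 𝓘(ℝ, Eu N) 𝓘(ℝ, Eu n) ∞ π)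
    {E : Type*} [NormedAddCommGroup E] [NormedSpace ℝ E]
    {H : Type*} [TopologicalSpace H] {I : ModelWithCorners ℝ E H} [I.Boundaryless]
    {T : Type*} [TopologicalSpace T] [ChartedSpace H T] [IsManifold I ∞ T]
    {u : T → Z} {x : T → X} {G : T → X → X} {t₀ : T}
    (hu : ContMDiffAt I 𝓘(ℝ, Eu N) ∞ u t₀) (hx : ContMDiffAt I 𝓘(ℝ, Eu n) ∞ x t₀)
    (hG : ContMDiffAt (I.prod 𝓘(ℝ, Eu n)) 𝓘(ℝ, Eu n) ∞ (fun p : T × X => G p.1 p.2) (t₀, x t₀))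
    (hd : ∀ᶠ t in 𝓝 t₀, LocalDiffeoAt n (G t) (x t)) (hπu : ∀ᶠ t in 𝓝 t₀, π (u t) = G t (x t)) :
    ContMDiffAt I 𝓘(ℝ, Eu N) ∞ (fun t => A.act (u t) (Jet.mk q (x t) (G t))) t₀ := by
  let a : atlas (Eu n) X := ⟨chartAt (Eu n) (x t₀), chart_mem_atlas _ _⟩
  let b : atlas (Eu n) X := ⟨chartAt (Eu n) (G t₀ (x t₀)), chart_mem_atlas _ _⟩
  have ha : x t₀ ∈ a.1.source := mem_chart_source _ _
  have hb : G t₀ (x t₀) ∈ b.1.source := mem_chart_source _ _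
  have hcoord := contMDiffAt_coord (q := q) hG hx a b ha hb
  have hz : π (u t₀) ∈ b.1.source := by rw [hπu.self_of_nhds]; exact hb
  -- The family of jets enters through its coordinates, which vary smoothly and determine the jets.
  refine (ContMDiffAt.comp t₀ (A.contMDiffAt_actCoord hπ a.2 b.2 hz
    (coord_mem_regularCoord hd.self_of_nhds a b ha hb)) (hu.prodMk hcoord)).congr_of_eventuallyEq ?_
  have hc : ContinuousAt (fun t => G t (x t)) t₀ :=
    ContinuousAt.comp (g := fun p : T × X => G p.1 p.2)
      (f := fun t => (t, x t)) hG.continuousAt (continuousAt_id.prodMk hx.continuousAt)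
  filter_upwards [hd, hπu, hx.continuousAt.preimage_mem_nhds (a.1.open_source.mem_nhds ha),
    hc.preimage_mem_nhds (b.1.open_source.mem_nhds hb)] with t h1 h2 h3 h4
  exact (A.actCoord_coord h1 a b h3 h4 h2).symm

omit [IsManifold 𝓘(ℝ, Eu n) ∞ X] [IsManifold 𝓘(ℝ, Eu N) ∞ Z] in
theorem proj_act_mk {z : Z} {φ : X → X} {x : X} (h : LocalDiffeoAt n φ x) (hz : π z = φ x) :
    π (A.act z (Jet.mk q x φ)) = x :=
  A.proj_act z _ ⟨x, φ, h, rfl⟩ hz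

theorem localSectionAt_pullback (hπ : ContMDiff 𝓘(ℝ, Eu N) 𝓘(ℝ, Eu n) ∞ π) {σ : X → Z}
    {φ : X → X} {x : X} (h : LocalDiffeoAt n φ x) (hσ : LocalSectionAt n N π σ (φ x)) :
    LocalSectionAt n N π (A.pullback σ φ) x := by
  have hφ := h.contMDiffAt
  filter_upwards [h.eventually.eventually_nhds, (hφ.continuousAt.eventually hσ).eventually_nhds]
    with y hy hy'
  refine ⟨A.contMDiffAt_act hπ (u := fun y => σ (φ y)) (x := id) (G := fun _ => φ) ?_ contMDiffAt_id
    ?_ hy ?_, A.proj_act_mk hy.self_of_nhds hy'.self_of_nhds.2⟩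
  · exact hy'.self_of_nhds.1.comp y hy.self_of_nhds.contMDiffAt
  · exact hy.self_of_nhds.contMDiffAt.comp (y, y) contMDiffAt_snd
  · exact hy'.mono fun _ h => h.2

omit [IsManifold 𝓘(ℝ, Eu n) ∞ X] [IsManifold 𝓘(ℝ, Eu N) ∞ Z] in
theorem pullback_comp_eventuallyEq {σ : X → Z} {φ ψ : X → X} {x : X} (hφ : LocalDiffeoAt n φ x)
    (hψ : LocalDiffeoAt n ψ (φ x)) (hσ : LocalSectionAt n N π σ (ψ (φ x))) :
    A.pullback σ (ψ ∘ φ) =ᶠ[𝓝 x] A.pullback (A.pullback σ ψ) φ := by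
  have h1 := hφ.contMDiffAt.continuousAt
  have h2 := hψ.contMDiffAt.continuousAt
  filter_upwards [hφ.eventually, h1.eventually hψ.eventually,
    h1.eventually (h2.eventually hσ)] with y hy hy' hy''
  exact A.act_mul _ y φ ψ hy hy' hy''.2

omit [IsManifold 𝓘(ℝ, Eu n) ∞ X] [IsManifold 𝓘(ℝ, Eu N) ∞ Z] in
theorem pullback_eventuallyEq_of_eventuallyEq {σ : X → Z} {φ φ' : X → X} {x : X}
    (h : φ =ᶠ[𝓝 x] φ') : A.pullback σ φ =ᶠ[𝓝 x] A.pullback σ φ' := by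
  filter_upwards [h.eventually_nhds] with y hy
  unfold pullback
  rw [Jet.mk_congr hy, hy.self_of_nhds]

omit [IsManifold 𝓘(ℝ, Eu n) ∞ X] [IsManifold 𝓘(ℝ, Eu N) ∞ Z] in
theorem pullback_id_eventuallyEq {σ : X → Z} {x : X} (hσ : LocalSectionAt n N π σ x) :
    A.pullback σ id =ᶠ[𝓝 x] σ := by
  filter_upwards [hσ] with y hy
  have := A.act_one (σ y)
  rw [hy.2] at this
  exact this

end NaturalAction

/-! ### First derivatives of jet coordinates -/

section FirstOrder

theorem fderiv_eq_iff_iteratedFDeriv_one_eq {E F : Type*} [NormedAddCommGroup E] [NormedSpace ℝ E]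
    [NormedAddCommGroup F] [NormedSpace ℝ F] {f g : E → F} {x : E} :
    fderiv ℝ f x = fderiv ℝ g x ↔ iteratedFDeriv ℝ 1 f x = iteratedFDeriv ℝ 1 g x := by
  refine ⟨fun h => ?_, fun h => ?_⟩
  · ext v
    simp [h]
  · ext v
    simpa using DFunLike.congr_fun h (fun _ => v)

theorem sameJet_one_iff {m n : ℕ} {M : Type*} [TopologicalSpace M] [ChartedSpace (Eu m) M]
    {N : Type*} [TopologicalSpace N] [ChartedSpace (Eu n) N] {x : M} {f g : M → N} :
    SameJet m n 1 x f g ↔ f x = g x ∧ ∀ a ∈ atlas (Eu m) M, ∀ b ∈ atlas (Eu n) N, x ∈ a.source →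
      f x ∈ b.source → fderiv ℝ (b ∘ f ∘ a.symm) (a x) = fderiv ℝ (b ∘ g ∘ a.symm) (a x) := by
  refine ⟨fun h => ⟨h.1, fun a ha b hb hx hf => ?_⟩, fun h => ⟨h.1, fun a ha b hb hx hf k hk => ?_⟩⟩
  · exact fderiv_eq_iff_iteratedFDeriv_one_eq.2 (h.2 a ha b hb hx hf 1 le_rfl)
  · interval_cases k
    · ext v
      simp [chartDeriv, a.left_inv hx, h.1]
    · exact fderiv_eq_iff_iteratedFDeriv_one_eq.1 (h.2 a ha b hb hx hf)

variable {n q : ℕ}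

theorem hasFDerivAt_jetCoord {f : Eu n → Eu n} {x : Eu n} (hf : ContDiffAt ℝ ∞ f x) :
    HasFDerivAt (jetCoord q f) ((ContinuousLinearMap.id ℝ (Eu n)).prod
      (ContinuousLinearMap.pi fun k : Fin (q + 1) => fderiv ℝ (iteratedFDeriv ℝ (k : ℕ) f) x)) x := by
  refine (hasFDerivAt_id x).prodMk (hasFDerivAt_pi.2 fun k => ?_)
  exact ((hf.iteratedFDeriv_right (m := ∞) (i := k) (by exact_mod_cast le_top)).differentiableAt
    (by simp)).hasFDerivAt

/-- Differentiating the coordinate of order `k` gives the derivative of order `k + 1`. This is why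
the action on `1`-jets of sections requires `(q+1)`-jets. -/
theorem fderiv_jetCoord_congr {f g : Eu n → Eu n} {x : Eu n} (hf : ContDiffAt ℝ ∞ f x)
    (hg : ContDiffAt ℝ ∞ g x)
    (h : ∀ k ≤ q + 1, iteratedFDeriv ℝ k f x = iteratedFDeriv ℝ k g x) :
    fderiv ℝ (jetCoord q f) x = fderiv ℝ (jetCoord q g) x := by
  rw [(hasFDerivAt_jetCoord hf).fderiv, (hasFDerivAt_jetCoord hg).fderiv]
  congr 2
  funext k
  rw [fderiv_iteratedFDeriv, fderiv_iteratedFDeriv]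
  simp only [Function.comp]
  rw [h _ (by omega)]

variable {X : Type*} [TopologicalSpace X] [ChartedSpace (Eu n) X]

theorem coord_mk_chart_eventuallyEq {φ : X → X} {x : X} (h : ContinuousAt φ x)
    (a b : atlas (Eu n) X) (hx : x ∈ a.1.source) (hφx : φ x ∈ b.1.source) :
    (fun e => Jet.coord a b (Jet.mk q (a.1.symm e) φ : Jet n n q X X)) =ᶠ[𝓝 (a.1 x)]
      jetCoord q (b.1 ∘ φ ∘ a.1.symm) := by
  filter_upwards [a.1.open_target.mem_nhds (a.1.map_source hx),
    eventually_chart_symm hx (h.preimage_mem_nhds (b.1.open_source.mem_nhds hφx))] with e he he'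
  rw [Jet.coord_mk a b (a.1.map_target he) he']
  simp only [chartDeriv, a.1.right_inv he]
  rfl

end FirstOrder

/-! ### The chain rule for the action on sections -/

namespace NaturalAction

variable {n N q : ℕ}
  {X : Type*} [TopologicalSpace X] [ChartedSpace (Eu n) X]
  {Z : Type*} [TopologicalSpace Z] [ChartedSpace (Eu N) Z]
  {π : Z → X} (A : NaturalAction n N q π)

/-- The action in charts. -/
def actChart (a b : OpenPartialHomeomorph X (Eu n)) (c c' : OpenPartialHomeomorph Z (Eu N))
    (p : Eu N × Jet.Coord q n n) : Eu N :=
  c' (A.actCoord a b (c.symm p.1) p.2)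

variable [IsManifold 𝓘(ℝ, Eu n) ∞ X] [IsManifold 𝓘(ℝ, Eu N) ∞ Z]

theorem contDiffAt_actChart (hπ : ContMDiff 𝓘(ℝ, Eu N) 𝓘(ℝ, Eu n) ∞ π)
    {a b : OpenPartialHomeomorph X (Eu n)} (ha : a ∈ atlas (Eu n) X) (hb : b ∈ atlas (Eu n) X)
    {c c' : OpenPartialHomeomorph Z (Eu N)} (hc : c ∈ atlas (Eu N) Z) (hc' : c' ∈ atlas (Eu N) Z)
    {z : Z} (hzc : z ∈ c.source) (hz : π z ∈ b.source) {v : Jet.Coord q n n}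
    (hv : v ∈ regularCoord q a) (h : A.actCoord a b z v ∈ c'.source) :
    ContDiffAt ℝ ∞ (A.actChart a b c c') (c z, v) := by
  rw [← contMDiffAt_iff_contDiffAt]
  refine ContMDiffAt.comp (c z, v) (I' := 𝓘(ℝ, Eu N)) (g := c') ?_
    (ContMDiffAt.comp (c z, v) (g := fun p : Z × Jet.Coord q n n => A.actCoord a b p.1 p.2)
      (f := fun p : Eu N × Jet.Coord q n n => (c.symm p.1, p.2))
      (I' := 𝓘(ℝ, Eu N).prod 𝓘(ℝ, Jet.Coord q n n)) ?_ ?_)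
  · simpa only [c.left_inv hzc] using contMDiffAt_chart hc' h
  · simpa only [c.left_inv hzc] using A.contMDiffAt_actCoord hπ ha hb hz hv
  · refine ContMDiffAt.prodMk ?_ contDiffAt_snd.contMDiffAt
    exact ContMDiffAt.comp (c z, v) (I' := 𝓘(ℝ, Eu N)) (g := c.symm)
      (contMDiffAt_chart_symm hc (c.map_source hzc)) contDiffAt_fst.contMDiffAt

/-- The chain rule for the action, in charts. -/
theorem hasFDerivAt_actCoord (hπ : ContMDiff 𝓘(ℝ, Eu N) 𝓘(ℝ, Eu n) ∞ π)
    {a b : OpenPartialHomeomorph X (Eu n)} (ha : a ∈ atlas (Eu n) X) (hb : b ∈ atlas (Eu n) X)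
    {c c' : OpenPartialHomeomorph Z (Eu N)} (hc : c ∈ atlas (Eu N) Z) (hc' : c' ∈ atlas (Eu N) Z)
    {z : Eu n → Z} {v : Eu n → Jet.Coord q n n} {e : Eu n}
    {z' : Eu n →L[ℝ] Eu N} {v' : Eu n →L[ℝ] Jet.Coord q n n}
    (hze : ContinuousAt z e) (hz' : HasFDerivAt (c ∘ z) z' e) (hv' : HasFDerivAt v v' e)
    (hzc : z e ∈ c.source) (hz : π (z e) ∈ b.source)
    (hv : v e ∈ regularCoord q a) (h : A.actCoord a b (z e) (v e) ∈ c'.source) :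
    HasFDerivAt (fun e => c' (A.actCoord a b (z e) (v e)))
      ((fderiv ℝ (A.actChart a b c c') (c (z e), v e)).comp (z'.prod v')) e := by
  have h1 := ((A.contDiffAt_actChart hπ ha hb hc hc' hzc hz hv h).differentiableAt
    (by simp)).hasFDerivAt
  refine (HasFDerivAt.comp e h1 (hz'.prodMk hv')).congr_of_eventuallyEq ?_
  filter_upwards [hze.preimage_mem_nhds (c.open_source.mem_nhds hzc)] with e' he'
  simp [actChart, c.left_inv he']

omit [IsManifold 𝓘(ℝ, Eu N) ∞ Z] in
theorem pullback_chart_eventuallyEq {σ : X → Z} {φ : X → X} {x : X} (h : LocalDiffeoAt n φ x)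
    (hσ : LocalSectionAt n N π σ (φ x)) (a b : atlas (Eu n) X) (hx : x ∈ a.1.source)
    (hφx : φ x ∈ b.1.source) :
    A.pullback σ φ ∘ a.1.symm =ᶠ[𝓝 (a.1 x)] fun e => A.actCoord a.1 b.1 ((σ ∘ φ) (a.1.symm e))
      (Jet.coord a b (Jet.mk q (a.1.symm e) φ)) := by
  have hφ := h.contMDiffAt.continuousAt
  filter_upwards [eventually_chart_symm hx h.eventually, eventually_chart_symm hx
    (a.1.open_source.mem_nhds hx), eventually_chart_symm hx
    (hφ.preimage_mem_nhds (b.1.open_source.mem_nhds hφx)),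
    eventually_chart_symm hx (hφ.eventually hσ)] with e h1 h2 h3 h4
  exact (A.actCoord_coord h1 a b h2 h3 h4.2).symm

/-- The derivative of a section transformed by a local diffeomorphism. -/
theorem hasFDerivAt_pullback (hπ : ContMDiff 𝓘(ℝ, Eu N) 𝓘(ℝ, Eu n) ∞ π)
    {σ : X → Z} {φ : X → X} {x : X} (h : LocalDiffeoAt n φ x)
    (hσ : LocalSectionAt n N π σ (φ x)) (a b : atlas (Eu n) X) (hx : x ∈ a.1.source)
    (hφx : φ x ∈ b.1.source) {c c' : OpenPartialHomeomorph Z (Eu N)} (hc : c ∈ atlas (Eu N) Z)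
    (hc' : c' ∈ atlas (Eu N) Z) (hcx : σ (φ x) ∈ c.source) (hc'x : A.pullback σ φ x ∈ c'.source) :
    HasFDerivAt (c' ∘ A.pullback σ φ ∘ a.1.symm)
      ((fderiv ℝ (A.actChart a.1 b.1 c c') (c (σ (φ x)), Jet.coord a b (Jet.mk q x φ))).comp
        ((fderiv ℝ (c ∘ (σ ∘ φ) ∘ a.1.symm) (a.1 x)).prod
          (fderiv ℝ (jetCoord q (b.1 ∘ φ ∘ a.1.symm)) (a.1 x)))) (a.1 x) := by
  have hφ := h.contMDiffAt
  have hσφ : ContMDiffAt 𝓘(ℝ, Eu n) 𝓘(ℝ, Eu N) ∞ (σ ∘ φ) x := hσ.self_of_nhds.1.comp x hφ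
  have hcd := contDiffAt_chart_comp a.2 hc hσφ hx hcx
  have hac := a.1.continuousAt_symm (a.1.map_source hx)
  have hcont : ContinuousAt (fun e => (σ ∘ φ) (a.1.symm e)) (a.1 x) :=
    ContinuousAt.comp (g := σ ∘ φ) (by rw [a.1.left_inv hx]; exact hσφ.continuousAt) hac
  have hj := (hasFDerivAt_jetCoord (q := q)
    (contDiffAt_chart_comp a.2 b.2 hφ hx hφx)).differentiableAt.hasFDerivAt.congr_of_eventuallyEq
      (coord_mk_chart_eventuallyEq hφ.continuousAt a b hx hφx)
  have key := A.hasFDerivAt_actCoord hπ a.2 b.2 hc hc' hcont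
    (hcd.differentiableAt (by simp)).hasFDerivAt hj
  simp only [a.1.left_inv hx] at key
  refine (key hcx (by rw [Function.comp, hσ.self_of_nhds.2]; exact hφx)
    (coord_mem_regularCoord h a b hx hφx) ?_).congr_of_eventuallyEq ?_
  · change A.actCoord a.1 b.1 (σ (φ x)) _ ∈ _
    rw [A.actCoord_coord h a b hx hφx hσ.self_of_nhds.2]
    exact hc'x
  · exact (A.pullback_chart_eventuallyEq h hσ a b hx hφx).fun_comp c'

/-- The `1`-jet of `σ(φ x) j_q(φ)(x)` depends only on the `1`-jet of `σ` and the `(q+1)`-jet of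
`φ`. -/
theorem sameJet_pullback (hπ : ContMDiff 𝓘(ℝ, Eu N) 𝓘(ℝ, Eu n) ∞ π)
    {σ σ' : X → Z} {φ φ' : X → X} {x : X} (h : LocalDiffeoAt n φ x) (h' : LocalDiffeoAt n φ' x)
    (hσ : LocalSectionAt n N π σ (φ x)) (hσ' : LocalSectionAt n N π σ' (φ x))
    (hφφ' : SameJet n n (q + 1) x φ φ') (hσσ' : SameJet n N 1 (φ x) σ σ') :
    SameJet n N 1 x (A.pullback σ φ) (A.pullback σ' φ') := by
  have hv : (Jet.mk q x φ : Jet n n q X X) = Jet.mk q x φ' :=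
    Jet.mk_eq_mk.2 ⟨rfl, hφφ'.of_le (Nat.le_succ q)⟩
  have h0 : A.pullback σ φ x = A.pullback σ' φ' x := by
    unfold pullback
    rw [hv, ← hφφ'.1, hσσ'.1]
  refine sameJet_one_iff.2 ⟨h0, fun a ha c' hc' hx hc'x => ?_⟩
  let a' : atlas (Eu n) X := ⟨a, ha⟩
  let b : atlas (Eu n) X := ⟨chartAt (Eu n) (φ x), chart_mem_atlas _ _⟩
  have hb : φ x ∈ b.1.source := mem_chart_source _ _
  have hb' : φ' x ∈ b.1.source := by rw [← hφφ'.1]; exact hb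
  have hcs : σ (φ x) ∈ (chartAt (Eu N) (σ (φ x))).source := mem_chart_source _ _
  have e1 := A.hasFDerivAt_pullback hπ h hσ a' b hx hb (chart_mem_atlas (Eu N) (σ (φ x))) hc'
    hcs hc'x
  have e2 := A.hasFDerivAt_pullback hπ h' (hφφ'.1 ▸ hσ') a' b hx hb'
    (chart_mem_atlas (Eu N) (σ (φ x))) hc' (by rw [← hφφ'.1, ← hσσ'.1]; exact hcs)
    (by rw [← h0]; exact hc'x)
  rw [e1.fderiv, e2.fderiv, ← hv, ← hφφ'.1, ← hσσ'.1]
  -- By the chain rule both derivatives are the derivative of the action, at a common point,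
  -- composed with the derivative of the pair formed by `σ ∘ φ` and `j_q(φ)`. The first entry is
  -- governed by the `1`-jets of `σ` and `φ`, the second by the `(q+1)`-jet of `φ`.
  congr 2
  · have hcomp : SameJet n N 1 x (σ ∘ φ) (σ' ∘ φ') :=
      SameJet.comp h.contMDiffAt h'.contMDiffAt hσ.self_of_nhds.1 hσ'.self_of_nhds.1
        (hφφ'.of_le (by omega)) hσσ'
    exact (sameJet_one_iff.1 hcomp).2 a ha _ (chart_mem_atlas _ _) hx hcs
  · exact fderiv_jetCoord_congr (contDiffAt_chart_comp ha b.2 h.contMDiffAt hx hb)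
      (contDiffAt_chart_comp ha b.2 h'.contMDiffAt hx hb') fun k hk => hφφ'.2 a ha _ b.2 hx hb k hk

end NaturalAction

theorem GeometricObject.localSectionAt {n N : ℕ} {X : Type*} [TopologicalSpace X]
    [ChartedSpace (Eu n) X] {Z : Type*} [TopologicalSpace Z] [ChartedSpace (Eu N) Z] {π : Z → X}
    (ω₀ : GeometricObject n N π) (x : X) : LocalSectionAt n N π ω₀ x :=
  Eventually.of_forall fun y => ⟨ω₀.smooth y, ω₀.proj_toFun y⟩

/-! ### The prolonged action and the quotient by the kernel -/

namespace NaturalAction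

variable {n N q : ℕ}
  {X : Type*} [TopologicalSpace X] [ChartedSpace (Eu n) X] [IsManifold 𝓘(ℝ, Eu n) ∞ X]
  {Z : Type*} [TopologicalSpace Z] [ChartedSpace (Eu N) Z] [IsManifold 𝓘(ℝ, Eu N) ∞ Z]
  {π : Z → X} {A : NaturalAction n N q π}

/-- The definition of `JetAct` asks for some representatives; by `sameJet_pullback` any
representatives compute the product, so the graph is that of a function. -/
theorem jetAct_mk_iff (hπ : ContMDiff 𝓘(ℝ, Eu N) 𝓘(ℝ, Eu n) ∞ π) {u v : sectionJets n N π}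
    {x : X} {φ : X → X} {σ : X → Z} (hφ : LocalDiffeoAt n φ x)
    (hσ : LocalSectionAt n N π σ (φ x)) (hu : u.1 = Jet.mk 1 (φ x) σ) :
    A.JetAct u (Jet.mk (q + 1) x φ) v ↔ v.1 = Jet.mk 1 x (A.pullback σ φ) := by
  refine ⟨?_, fun h => ⟨x, φ, σ, hφ, hσ, hu, rfl, h⟩⟩
  rintro ⟨x', φ', σ', hφ', hσ', hu', hf, hv⟩
  obtain ⟨rfl, hφφ'⟩ := Jet.mk_eq_mk.1 hf
  obtain ⟨h0, hσσ'⟩ := Jet.mk_eq_mk.1 (hu.symm.trans hu')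
  rw [hv]
  exact Jet.mk_eq_mk.2 ⟨rfl, (A.sameJet_pullback hπ hφ hφ' hσ (h0 ▸ hσ') hφφ' hσσ').symm⟩

/-- The element of the jet bundle obtained by letting a local diffeomorphism act on a section. -/
def pullbackJet (A : NaturalAction n N q π) (hπ : ContMDiff 𝓘(ℝ, Eu N) 𝓘(ℝ, Eu n) ∞ π)
    {x : X} {φ : X → X} {σ : X → Z} (hφ : LocalDiffeoAt n φ x)
    (hσ : LocalSectionAt n N π σ (φ x)) : sectionJets n N π :=
  ⟨Jet.mk 1 x (A.pullback σ φ), x, _, A.localSectionAt_pullback hπ hφ hσ, rfl⟩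

omit [IsManifold 𝓘(ℝ, Eu n) ∞ X] [IsManifold 𝓘(ℝ, Eu N) ∞ Z] in
theorem kernelRel_iff {u v : sectionJets n N π} :
    A.KernelRel u v ↔ ∃ (x : X) (κ : X → X) (σ : X → Z), LocalDiffeoAt n κ x ∧
      SameJet n n q x κ id ∧ LocalSectionAt n N π σ x ∧ u.1 = Jet.mk 1 x σ ∧
      v.1 = Jet.mk 1 x (A.pullback σ κ) := by
  constructor
  · rintro ⟨y, k, -, hk, x, κ, σ, hκ, hσ, hu, rfl, hv⟩
    obtain ⟨rfl, hs⟩ := Jet.mk_eq_mk.1 (show Jet.mk q x κ = Jet.mk q y id from hk)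
    have hx : κ x = x := hs.1
    rw [hx] at hσ hu
    exact ⟨x, κ, σ, hκ, hs, hσ, hu, hv⟩
  · rintro ⟨x, κ, σ, hκ, hs, hσ, hu, hv⟩
    have hx : κ x = x := hs.1
    refine ⟨x, Jet.mk (q + 1) x κ, ⟨x, κ, hκ, rfl⟩, Jet.mk_eq_mk.2 ⟨rfl, hs⟩, x, κ, σ, hκ, ?_, ?_,
      rfl, hv⟩
    · rwa [hx]
    · rwa [hx]

/-- Associativity of the prolonged action: `τ` may be any representative of the `1`-jet of `σ`
transformed by `ψ`. -/
theorem sameJet_pullback_comp (hπ : ContMDiff 𝓘(ℝ, Eu N) 𝓘(ℝ, Eu n) ∞ π) {σ τ : X → Z}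
    {φ ψ : X → X} {x : X} (hφ : LocalDiffeoAt n φ x) (hψ : LocalDiffeoAt n ψ (φ x))
    (hσ : LocalSectionAt n N π σ (ψ (φ x))) (hτ : LocalSectionAt n N π τ (φ x))
    (h : SameJet n N 1 (φ x) (A.pullback σ ψ) τ) :
    SameJet n N 1 x (A.pullback σ (ψ ∘ φ)) (A.pullback τ φ) :=
  (SameJet.of_eventuallyEq (A.pullback_comp_eventuallyEq hφ hψ hσ)).trans
    (A.sameJet_pullback hπ hφ hφ (A.localSectionAt_pullback hπ hψ hσ) hτ
      ((SameJet.of_eventuallyEq (Eventually.of_forall fun _ => rfl))) h)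

/-- A `Quot` identifies along the generated equivalence relation. Identities, inverses and products
in `K_{q+1}` show that the orbit relation is already an equivalence, so equality in `Z_1` means
membership in one orbit (`I_eq_iff`). -/
theorem kernelRel_equivalence (hπ : ContMDiff 𝓘(ℝ, Eu N) 𝓘(ℝ, Eu n) ∞ π) :
    Equivalence A.KernelRel where
  refl := by
    rintro ⟨_, x, σ, hσ, rfl⟩
    exact kernelRel_iff.2 ⟨x, id, σ, localDiffeoAt_id x, SameJet.of_eventuallyEq EventuallyEq.rfl,
      hσ, rfl, (Jet.mk_congr (A.pullback_id_eventuallyEq hσ)).symm⟩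
  symm := by
    intro u v h
    obtain ⟨x, κ, σ, hκ, hs, hσ, hu, hv⟩ := kernelRel_iff.1 h
    obtain ⟨κ', hκ', h1, h2⟩ := hκ.exists_inverse
    have hx : κ x = x := hs.1
    have hx' : κ' x = x := by have := h1.eq_of_nhds; rwa [Function.comp, hx] at this
    rw [hx] at hκ' h2
    refine kernelRel_iff.2 ⟨x, κ', A.pullback σ κ, hκ', ?_, ?_, hv, ?_⟩
    · have := SameJet.comp (g := κ') (g' := κ') hκ.contMDiffAt contMDiffAt_id
        (by rw [hx]; exact hκ'.contMDiffAt) (by rw [hx]; exact hκ'.contMDiffAt) hs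
        (SameJet.of_eventuallyEq EventuallyEq.rfl)
      exact this.symm.trans (SameJet.of_eventuallyEq h1)
    · exact A.localSectionAt_pullback hπ hκ (by rwa [hx])
    · rw [hu]
      refine Jet.mk_congr ?_
      refine (A.pullback_id_eventuallyEq hσ).symm.trans ?_
      refine (A.pullback_eventuallyEq_of_eventuallyEq h2).symm.trans ?_
      exact A.pullback_comp_eventuallyEq hκ' (by rwa [hx']) (by rwa [hx', hx])
  trans := by
    intro u v w h h'
    obtain ⟨x, κ, σ, hκ, hs, hσ, hu, hv⟩ := kernelRel_iff.1 h
    obtain ⟨x', κ', τ, hκ', hs', hτ, hv', hw⟩ := kernelRel_iff.1 h'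
    obtain ⟨rfl, hστ⟩ := Jet.mk_eq_mk.1 (hv.symm.trans hv')
    have hx : κ x = x := hs.1
    have hx' : κ' x = x := hs'.1
    refine kernelRel_iff.2 ⟨x, κ ∘ κ', σ, hκ'.comp (by rwa [hx']), ?_, hσ, hu, ?_⟩
    · exact SameJet.comp hκ'.contMDiffAt contMDiffAt_id (by rw [hx']; exact hκ.contMDiffAt)
        contMDiffAt_id hs' (by rwa [hx'])
    · rw [hw]
      refine Jet.mk_eq_mk.2 ⟨rfl, ?_⟩
      exact (sameJet_pullback_comp hπ hκ' (by rwa [hx']) (by rwa [hx', hx]) (by rwa [hx'])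
        (by rwa [hx'])).symm

theorem I_eq_iff (hπ : ContMDiff 𝓘(ℝ, Eu N) 𝓘(ℝ, Eu n) ∞ π) {u v : sectionJets n N π} :
    A.I u = A.I v ↔ A.KernelRel u v :=
  ⟨fun h => (kernelRel_equivalence hπ).eqvGen_iff.1 (Quot.eqvGen_exact h), fun h => Quot.sound h⟩

/-- The action of `Π_q` on `Z_1` is well defined. -/
theorem JetAct.I_eq (hπ : ContMDiff 𝓘(ℝ, Eu N) 𝓘(ℝ, Eu n) ∞ π) {u u' v v' : sectionJets n N π}
    {g g' : Jet n n (q + 1) X X} (h : A.JetAct u g v) (h' : A.JetAct u' g' v')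
    (hg : g.proj = g'.proj) (hu : A.I u = A.I u') : A.I v = A.I v' := by
  obtain ⟨y, κ, σ, hκ, hs, hσ, huσ, hu'σ⟩ := kernelRel_iff.1 ((I_eq_iff hπ).1 hu)
  obtain ⟨x, φ, σ₁, hφ, hσ₁, hu₁, rfl, hv⟩ := h
  obtain ⟨x', φ', σ₁', hφ', hσ₁', hu₁', rfl, hv'⟩ := h'
  obtain ⟨rfl, hφφ'⟩ := Jet.mk_eq_mk.1 (show Jet.mk q x φ = Jet.mk q x' φ' from hg)
  have hx : φ x = φ' x := hφφ'.1
  obtain ⟨rfl, hσσ₁⟩ := Jet.mk_eq_mk.1 (huσ.symm.trans hu₁)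
  obtain ⟨-, hσσ₁'⟩ := Jet.mk_eq_mk.1 (hu'σ.symm.trans hu₁')
  have hκx : κ (φ x) = φ x := hs.1
  obtain ⟨ψ, hψ, h1, h2⟩ := hφ.exists_inverse
  have hψx : ψ (φ x) = x := h1.eq_of_nhds
  have hκφ' : LocalDiffeoAt n (κ ∘ φ') x := hφ'.comp (by rwa [← hx])
  have hκφ'x : (κ ∘ φ') x = φ x := by rw [Function.comp, ← hx, hκx]
  have hχ : LocalDiffeoAt n (ψ ∘ κ ∘ φ') x := hκφ'.comp (by rwa [hκφ'x])
  have hχx : (ψ ∘ κ ∘ φ') x = x := by rw [Function.comp, hκφ'x, hψx]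
  have hrefl : ∀ {q : ℕ} {x : X} {f : X → X}, SameJet n n q x f f :=
    SameJet.of_eventuallyEq EventuallyEq.rfl
  -- With `u' = u κ` and `ψ` a local inverse of `φ`, one has `v' = u κ φ' = (u φ)(ψ κ φ')`. The
  -- factor `ψ κ φ'` has the `q`-jet of the identity, because `κ` does and `φ`, `φ'` have the same
  -- `q`-jet; this is the normality of the kernel.
  refine (I_eq_iff hπ).2 (kernelRel_iff.2 ⟨x, ψ ∘ κ ∘ φ', A.pullback σ φ, hχ, ?_,
    A.localSectionAt_pullback hπ hφ hσ, ?_, ?_⟩)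
  · have e1 : SameJet n n q x (κ ∘ φ') φ :=
      (SameJet.comp (g' := id) hφ'.contMDiffAt hφ'.contMDiffAt (by rw [← hx]; exact hκ.contMDiffAt)
        contMDiffAt_id hrefl (by rwa [← hx])).trans hφφ'.symm
    exact (SameJet.comp (g' := ψ) hκφ'.contMDiffAt hφ.contMDiffAt
      (by rw [hκφ'x]; exact hψ.contMDiffAt) (by rw [hκφ'x]; exact hψ.contMDiffAt) e1 hrefl).trans
      (SameJet.of_eventuallyEq h1)
  · rw [hv]
    exact Jet.mk_eq_mk.2 ⟨rfl, A.sameJet_pullback hπ hφ hφ hσ₁ hσ hrefl hσσ₁.symm⟩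
  · rw [hv']
    refine Jet.mk_eq_mk.2 ⟨rfl, ?_⟩
    have e1 : SameJet n N 1 x (A.pullback σ (κ ∘ φ')) (A.pullback σ₁' φ') :=
      sameJet_pullback_comp hπ hφ' (by rwa [← hx]) (by rwa [← hx, hκx]) hσ₁' (by rwa [← hx])
    refine e1.symm.trans (SameJet.of_eventuallyEq ?_)
    have e2 : κ ∘ φ' =ᶠ[𝓝 x] φ ∘ (ψ ∘ κ ∘ φ') := by
      have hc := hκφ'.contMDiffAt.continuousAt
      rw [ContinuousAt, hκφ'x] at hc
      exact (hc.eventually h2).mono fun y hy => hy.symm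
    refine (A.pullback_eventuallyEq_of_eventuallyEq e2).trans ?_
    exact A.pullback_comp_eventuallyEq hχ (by rwa [hχx]) (by rwa [hχx])

/-- Elements of the kernel can be absorbed into the acting jet. -/
theorem JetAct.exists_of_kernelRel (hπ : ContMDiff 𝓘(ℝ, Eu N) 𝓘(ℝ, Eu n) ∞ π)
    {u v w : sectionJets n N π} {x : X} {φ : X → X} (hφ : LocalDiffeoAt n φ x)
    (h : A.JetAct u (Jet.mk (q + 1) x φ) v) (hvw : A.I v = A.I w) :
    ∃ φ' : X → X, LocalDiffeoAt n φ' x ∧ SameJet n n q x φ φ' ∧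
      A.JetAct u (Jet.mk (q + 1) x φ') w := by
  obtain ⟨y, κ, τ, hκ, hs, hτ, hvτ, hw⟩ := kernelRel_iff.1 ((I_eq_iff hπ).1 hvw)
  obtain ⟨x', φ₁, σ, hφ₁, hσ, hu, hf, hv⟩ := h
  obtain ⟨rfl, hφφ₁⟩ := Jet.mk_eq_mk.1 hf
  rw [← hφφ₁.1] at hσ hu
  have hv' := (jetAct_mk_iff (A := A) hπ hφ hσ hu).1 ⟨x, φ₁, σ, hφ₁, hφφ₁.1 ▸ hσ, hφφ₁.1 ▸ hu, hf, hv⟩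
  obtain ⟨rfl, hστ⟩ := Jet.mk_eq_mk.1 (hv'.symm.trans hvτ)
  have hκx : κ x = x := hs.1
  -- From `v = u φ` and `w = v κ` follows `w = u (φ κ)`, and `φ ∘ κ` has the same `q`-jet at `x` as
  -- `φ`.
  have hφκ : LocalDiffeoAt n (φ ∘ κ) x := hκ.comp (by rwa [hκx])
  have hφκx : (φ ∘ κ) x = φ x := by rw [Function.comp, hκx]
  refine ⟨φ ∘ κ, hφκ, ?_, ?_⟩
  · exact (SameJet.comp (g := φ) (g' := φ) hκ.contMDiffAt contMDiffAt_id
      (by rw [hκx]; exact hφ.contMDiffAt) (by rw [hκx]; exact hφ.contMDiffAt) hs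
      (SameJet.of_eventuallyEq EventuallyEq.rfl)).symm
  · refine (jetAct_mk_iff hπ hφκ (by rwa [hφκx]) (by rwa [hφκx])).2 ?_
    rw [hw]
    exact Jet.mk_eq_mk.2 ⟨rfl, (sameJet_pullback_comp hπ hκ (by rwa [hκx]) (by rwa [hκx])
      (by rwa [hκx]) (by rwa [hκx])).symm⟩

end NaturalAction

/-! ### Orbit maps of a homogeneous bundle are submersions -/

theorem finrank_range_le_of_comp_eq {K V V' E E' : Type*} [Field K]
    [AddCommGroup V] [Module K V] [AddCommGroup V'] [Module K V'] [AddCommGroup E] [Module K E]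
    [AddCommGroup E'] [Module K E'] [FiniteDimensional K E'] {f : V →ₗ[K] E} {g : V' →ₗ[K] E'}
    {r : V →ₗ[K] V'} {l : E →ₗ[K] E'} (h : ∀ v, g (r v) = l (f v)) (hl : Function.Injective l) :
    Module.finrank K (LinearMap.range f) ≤ Module.finrank K (LinearMap.range g) := by
  let L : LinearMap.range f →ₗ[K] LinearMap.range g :=
    (l.domRestrict (LinearMap.range f)).codRestrict _ (by
      rintro ⟨_, v, rfl⟩
      exact ⟨r v, h v⟩)
  refine LinearMap.finrank_le_finrank_of_injective (f := L) fun x y hxy => ?_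
  exact Subtype.ext (hl (congrArg Subtype.val hxy))

namespace NaturalAction

variable {n N q : ℕ}
  {X : Type*} [TopologicalSpace X] [ChartedSpace (Eu n) X] [IsManifold 𝓘(ℝ, Eu n) ∞ X]
  {Z : Type*} [TopologicalSpace Z] [ChartedSpace (Eu N) Z]
  {π : Z → X} {A : NaturalAction n N q π}

/-- Homogeneity concerns one fibre at a time. Translations in charts join any two points of `X`,
connected or not, and carry `z` into the fibre of `z'`. -/
theorem Homogeneous.exists_act_eq (hA : A.Homogeneous) (z z' : Z) :
    ∃ φ : X → X, LocalDiffeoAt n φ (π z') ∧ φ (π z') = π z ∧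
      A.act z (Jet.mk q (π z') φ) = z' := by
  obtain ⟨τ, hτ, hτz⟩ := exists_localDiffeoAt (n := n) (π z') (π z)
  have h1 := A.proj_act_mk hτ hτz.symm
  obtain ⟨f, ⟨x, κ, hκ, rfl⟩, hs, ht, hf⟩ := hA (A.act z (Jet.mk q (π z') τ)) z' h1
  rw [h1] at hs ht
  change x = π z' at hs
  change κ x = π z' at ht
  subst hs
  refine ⟨τ ∘ κ, hκ.comp (by rwa [ht]), by rw [Function.comp, ht, hτz], ?_⟩
  rw [A.act_mul z (π z') κ τ hκ (by rwa [ht]) (by rw [ht, hτz]), ht, hf]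

variable [IsManifold 𝓘(ℝ, Eu N) ∞ Z]

theorem contMDiffAt_actCoord_right (hπ : ContMDiff 𝓘(ℝ, Eu N) 𝓘(ℝ, Eu n) ∞ π)
    {a b : OpenPartialHomeomorph X (Eu n)} (ha : a ∈ atlas (Eu n) X) (hb : b ∈ atlas (Eu n) X)
    {z : Z} {v : Jet.Coord q n n} (hz : π z ∈ b.source) (hv : v ∈ regularCoord q a) :
    ContMDiffAt 𝓘(ℝ, Jet.Coord q n n) 𝓘(ℝ, Eu N) ∞ (A.actCoord a b z) v :=
  ContMDiffAt.comp v (g := fun p : Z × Jet.Coord q n n => A.actCoord a b p.1 p.2)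
    (f := fun v => (z, v)) (A.contMDiffAt_actCoord hπ ha hb hz hv) (contMDiffAt_const.prodMk contMDiffAt_id)

theorem contDiffAt_actCoord_right (hπ : ContMDiff 𝓘(ℝ, Eu N) 𝓘(ℝ, Eu n) ∞ π)
    {a b : OpenPartialHomeomorph X (Eu n)} (ha : a ∈ atlas (Eu n) X) (hb : b ∈ atlas (Eu n) X)
    {c : OpenPartialHomeomorph Z (Eu N)} (hc : c ∈ atlas (Eu N) Z)
    {z : Z} {v : Jet.Coord q n n} (hz : π z ∈ b.source) (hv : v ∈ regularCoord q a)
    (h : A.actCoord a b z v ∈ c.source) :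
    ContDiffAt ℝ ∞ (fun v => c (A.actCoord a b z v)) v := by
  rw [← contMDiffAt_iff_contDiffAt]
  exact ContMDiffAt.comp v (contMDiffAt_chart hc h) (contMDiffAt_actCoord_right hπ ha hb hz hv)

theorem isOpen_actCoord_right_preimage (hπ : ContMDiff 𝓘(ℝ, Eu N) 𝓘(ℝ, Eu n) ∞ π)
    {a b : OpenPartialHomeomorph X (Eu n)} (ha : a ∈ atlas (Eu n) X) (hb : b ∈ atlas (Eu n) X)
    (c : OpenPartialHomeomorph Z (Eu N)) {z : Z} (hz : π z ∈ b.source) :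
    IsOpen (regularCoord q a ∩ A.actCoord a b z ⁻¹' c.source) :=
  ContinuousOn.isOpen_inter_preimage (fun _ hv =>
    (contMDiffAt_actCoord_right hπ ha hb hz hv).continuousAt.continuousWithinAt)
    (isOpen_regularCoord a) c.open_source

omit [IsManifold 𝓘(ℝ, Eu N) ∞ Z] in
theorem proj_actCoord {a b : OpenPartialHomeomorph X (Eu n)} (ha : a ∈ atlas (Eu n) X)
    (hb : b ∈ atlas (Eu n) X) {z : Z} {v : Jet.Coord q n n} (hz : π z ∈ b.source)
    (hv : v ∈ regularCoord q a) : π (A.actCoord a b z v) = a.symm v.1 :=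
  A.proj_act_mk (localDiffeoAt_jetMap ha hb (b.map_source hz) hv) (by
    rw [jetMap_source _ hv, b.left_inv hz])

/-- The local transformation of `Z` induced by a local diffeomorphism of `X`. -/
theorem contMDiffAt_act_local (hπ : ContMDiff 𝓘(ℝ, Eu N) 𝓘(ℝ, Eu n) ∞ π) {χ χ' : X → X} {x : X}
    (hχ' : LocalDiffeoAt n χ' x) (hχ : LocalDiffeoAt n χ (χ' x)) (h : χ ∘ χ' =ᶠ[𝓝 x] id) {z : Z}
    (hz : π z = x) :
    ContMDiffAt 𝓘(ℝ, Eu N) 𝓘(ℝ, Eu N) ∞ (fun ζ => A.act ζ (Jet.mk q (χ' (π ζ)) χ)) z := by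
  subst hz
  have hc : ContMDiffAt 𝓘(ℝ, Eu N) 𝓘(ℝ, Eu n) ∞ (fun ζ => χ' (π ζ)) z :=
    hχ'.contMDiffAt.comp z hπ.contMDiffAt
  refine A.contMDiffAt_act hπ (u := id) (G := fun _ => χ) contMDiffAt_id hc ?_ ?_ ?_
  · exact hχ.contMDiffAt.comp (z, χ' (π z)) contMDiffAt_snd
  · exact hc.continuousAt.eventually hχ.eventually
  · exact (hπ.continuous.continuousAt.eventually h).mono fun _ h => h.symm

set_option maxHeartbeats 1000000 in
/-- The rank of the orbit map `v ↦ z v` is constant: it does not depend on the jet `v`, nor on the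
charts. -/
theorem finrank_range_fderiv_actCoord_le (hπ : ContMDiff 𝓘(ℝ, Eu N) 𝓘(ℝ, Eu n) ∞ π) {z : Z}
    {a b : atlas (Eu n) X} {c : OpenPartialHomeomorph Z (Eu N)} (hc : c ∈ atlas (Eu N) Z)
    {v : Jet.Coord q n n} (hv : v ∈ regularCoord q a.1) (hz : π z ∈ b.1.source)
    (hvc : A.actCoord a.1 b.1 z v ∈ c.source)
    {a' b' : atlas (Eu n) X} {c' : OpenPartialHomeomorph Z (Eu N)} (hc' : c' ∈ atlas (Eu N) Z)
    {x : X} {φ : X → X} (hφ : LocalDiffeoAt n φ x) (hφz : φ x = π z) (hx : x ∈ a'.1.source)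
    (hφx : φ x ∈ b'.1.source) (hxc : A.act z (Jet.mk q x φ) ∈ c'.source) :
    Module.finrank ℝ
        (LinearMap.range (fderiv ℝ (fun v => c (A.actCoord a.1 b.1 z v)) v).toLinearMap) ≤
      Module.finrank ℝ (LinearMap.range (fderiv ℝ (fun v => c' (A.actCoord a'.1 b'.1 z v))
        (Jet.coord a' b' (Jet.mk q x φ))).toLinearMap) := by
  have hbz := b.1.map_source hz
  set φ₀ := jetMap a.1 b.1 (b.1 (π z)) v with hφ₀def
  set x₀ := a.1.symm v.1 with hx₀
  have hφ₀ : LocalDiffeoAt n φ₀ x₀ := localDiffeoAt_jetMap a.2 b.2 hbz hv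
  have hφ₀z : φ₀ x₀ = π z := by rw [hφ₀def, jetMap_source _ hv, b.1.left_inv hz]
  obtain ⟨ψ, hψ, hψ1, hψ2⟩ := hφ₀.exists_inverse
  have hψx : ψ (φ₀ x₀) = x₀ := hψ1.eq_of_nhds
  rw [hφ₀z, ← hφz] at hψ hψ2 hψx
  have hχ : LocalDiffeoAt n (ψ ∘ φ) x := hφ.comp hψ
  -- Since `χ` is `φ` followed by the inverse of `φ₀`, one has `z φ = (z φ₀) χ`. The action of `χ`
  -- on `Z` near `z₁ = z φ₀` is `L`; it has the left inverse `L'` given by the inverse of `χ`, so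
  -- its derivative is injective.
  set χ := ψ ∘ φ with hχdef
  have hχx : χ x = x₀ := hψx
  obtain ⟨χ', hχ', h1, h2⟩ := hχ.exists_inverse
  have hχ'x : χ' x₀ = x := by rw [← hχx]; exact h1.eq_of_nhds
  rw [hχx] at hχ' h2
  have hφχ : φ₀ ∘ χ =ᶠ[𝓝 x] φ := hφ.contMDiffAt.continuousAt.eventually hψ2
  set z₁ := A.actCoord a.1 b.1 z v with hz₁
  have hπz₁ : π z₁ = x₀ := proj_actCoord a.2 b.2 hz hv
  let L : Z → Z := fun ζ => A.act ζ (Jet.mk q (χ' (π ζ)) χ)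
  let L' : Z → Z := fun ζ => A.act ζ (Jet.mk q (χ (π ζ)) χ')
  have hLz₁ : L z₁ = A.act z (Jet.mk q x φ) := by
    have e := A.act_mul z x χ φ₀ hχ (by rwa [hχx]) (by rw [hχx, hφ₀z])
    rw [Jet.mk_congr hφχ, hχx] at e
    rw [e]
    simp only [L, hπz₁, hχ'x]
    rfl
  have hπL : π (L z₁) = x := by rw [hLz₁]; exact A.proj_act_mk hφ hφz.symm
  have hL : ContMDiffAt 𝓘(ℝ, Eu N) 𝓘(ℝ, Eu N) ∞ L z₁ :=
    contMDiffAt_act_local hπ hχ' (by rwa [hχ'x]) h2 hπz₁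
  have hL' : ContMDiffAt 𝓘(ℝ, Eu N) 𝓘(ℝ, Eu N) ∞ L' (L z₁) :=
    contMDiffAt_act_local hπ hχ (by rwa [hχx]) h1 hπL
  have hπc : Tendsto π (𝓝 z₁) (𝓝 x₀) := by rw [← hπz₁]; exact hπ.continuous.continuousAt
  have hχ'c : Tendsto χ' (𝓝 x₀) (𝓝 x) := by
    have := hχ'.contMDiffAt.continuousAt; rwa [ContinuousAt, hχ'x] at this
  have hL'L : ∀ᶠ ζ in 𝓝 z₁, L' (L ζ) = ζ := by
    filter_upwards [hπc.eventually h2.eventually_nhds, hπc.eventually hχ'.eventually,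
      hπc.eventually (hχ'c.eventually hχ.eventually)] with ζ e1 e2 e3
    have e1' : χ (χ' (π ζ)) = π ζ := e1.self_of_nhds
    have e4 : π (L ζ) = χ' (π ζ) := A.proj_act_mk e3 e1'.symm
    simp only [L', e4, e1']
    have := A.act_mul ζ (π ζ) χ' χ e2 e3 e1'.symm
    rw [Jet.mk_congr e1, A.act_one] at this
    exact this.symm
  have hLc : L z₁ ∈ c'.source := by rwa [hLz₁]
  let L₁ := c' ∘ L ∘ c.symm
  let L₂ := c ∘ L' ∘ c'.symm
  have hL₁ : DifferentiableAt ℝ L₁ (c z₁) :=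
    (contDiffAt_chart_comp hc hc' hL hvc hLc).differentiableAt (by simp)
  have hL'Lz : L' (L z₁) = z₁ := hL'L.self_of_nhds
  have hL₂ : DifferentiableAt ℝ L₂ (L₁ (c z₁)) := by
    have := (contDiffAt_chart_comp hc' hc hL' hLc (by rwa [hL'Lz])).differentiableAt
      (by simp : (∞ : WithTop ℕ∞) ≠ 0)
    simpa [L₁, c.left_inv hvc] using this
  have hLL : L₂ ∘ L₁ =ᶠ[𝓝 (c z₁)] id := by
    filter_upwards [(chart_comp_eventuallyEq (g := L') (c := c) hL.continuousAt hvc hLc).symm,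
      eventually_chart_symm hvc hL'L, c.open_target.mem_nhds (c.map_source hvc)] with e he he' hec
    refine he.trans ?_
    simp only [Function.comp, id, he', c.right_inv hec]
  have hinj : Function.Injective (fderiv ℝ L₁ (c z₁)) := by
    have hcomp := (hL₂.hasFDerivAt.comp _ hL₁.hasFDerivAt).unique
      ((hasFDerivAt_id (c z₁)).congr_of_eventuallyEq hLL)
    exact Function.LeftInverse.injective (g := fderiv ℝ L₂ (L₁ (c z₁)))
      fun w => DFunLike.congr_fun hcomp w
  -- the induced map on jet coordinates
  let G : Jet.Coord q n n → X → X := fun v => jetMap a.1 b.1 (b.1 (π z)) v ∘ χ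
  let y : Jet.Coord q n n → X := fun v => χ' (a.1.symm v.1)
  let R : Jet.Coord q n n → Jet.Coord q n n := fun v => Jet.coord a' b' (Jet.mk q (y v) (G v))
  have hyv : y v = x := hχ'x
  have hGv : G v =ᶠ[𝓝 x] φ := hφχ
  have has : ContMDiffAt 𝓘(ℝ, Jet.Coord q n n) 𝓘(ℝ, Eu n) ∞
      (fun v : Jet.Coord q n n => a.1.symm v.1) v :=
    ContMDiffAt.comp v (contMDiffAt_chart_symm a.2 hv.1) contDiffAt_fst.contMDiffAt
  have hy : ContMDiffAt 𝓘(ℝ, Jet.Coord q n n) 𝓘(ℝ, Eu n) ∞ y v :=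
    ContMDiffAt.comp v hχ'.contMDiffAt has
  have hG : ContMDiffAt (𝓘(ℝ, Jet.Coord q n n).prod 𝓘(ℝ, Eu n)) 𝓘(ℝ, Eu n) ∞
      (fun p : Jet.Coord q n n × X => G p.1 p.2) (v, y v) := by
    refine ContMDiffAt.comp (v, y v) (f := fun p : Jet.Coord q n n × X => (p.1, χ p.2))
      (g := fun p : Jet.Coord q n n × X => jetMap a.1 b.1 (b.1 (π z)) p.1 p.2)
      (I' := 𝓘(ℝ, Jet.Coord q n n).prod 𝓘(ℝ, Eu n)) ?_ ?_
    · simp only [hyv, hχx]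
      exact contMDiffAt_jetMap_family (y := fun _ => b.1 (π z)) (v := fun v => v) a.2 b.2
        contMDiffAt_const contMDiffAt_id hbz hv
    · refine contMDiffAt_fst.prodMk (ContMDiffAt.comp (v, y v) (g := χ)
        (f := fun p : Jet.Coord q n n × X => p.2) (I' := 𝓘(ℝ, Eu n)) ?_ contMDiffAt_snd)
      simp only [hyv]
      exact hχ.contMDiffAt
  have hRd : ContMDiffAt 𝓘(ℝ, Jet.Coord q n n) 𝓘(ℝ, Jet.Coord q n n) ∞ R v := by
    refine contMDiffAt_coord hG hy a' b' (by rwa [hyv]) ?_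
    rw [hyv, hGv.self_of_nhds]
    exact hφx
  have hRv : R v = Jet.coord a' b' (Jet.mk q x φ) := by
    simp only [R, hyv]
    rw [Jet.mk_congr hGv]
  have hR : DifferentiableAt ℝ R v := hRd.contDiffAt.differentiableAt (by simp)
  have hyc : Tendsto y (𝓝 v) (𝓝 x) := by
    have := hy.continuousAt; rwa [ContinuousAt, hyv] at this
  -- Composing jets with `χ` corresponds to applying `L` to their values. Differentiating this
  -- relation expresses the derivative at `R v` after that of `R` as an injective map after the
  -- derivative at `v`, which bounds the rank at `v` by that at `R v`.
  have hact : ∀ᶠ w in 𝓝 v, A.actCoord a'.1 b'.1 z (R w) = L (A.actCoord a.1 b.1 z w) := by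
    filter_upwards [(isOpen_regularCoord a.1).mem_nhds hv,
      has.continuousAt.eventually h2, hyc.eventually hχ.eventually,
      hyc.eventually (a'.1.open_source.mem_nhds hx)] with w hw e1 e2 e3
    have e1' : χ (y w) = a.1.symm w.1 := e1
    have hj := localDiffeoAt_jetMap a.2 b.2 hbz hw
    have hjs : jetMap a.1 b.1 (b.1 (π z)) w (a.1.symm w.1) = π z := by
      rw [jetMap_source _ hw, b.1.left_inv hz]
    have hGw : LocalDiffeoAt n (G w) (y w) := e2.comp (by rwa [e1'])
    have hGw' : G w (y w) = π z := by simp only [G, Function.comp, e1', hjs]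
    simp only [R]
    rw [A.actCoord_coord hGw a' b' e3 (by rw [hGw', ← hφz]; exact hφx) hGw'.symm]
    simp only [G]
    rw [A.act_mul z (y w) χ _ e2 (by rwa [e1']) (by rw [e1', hjs]), e1']
    simp only [L, proj_actCoord a.2 b.2 hz hw]
    rfl
  have hv₁ := coord_mem_regularCoord (q := q) hφ a' b' hx hφx
  have hD2 : DifferentiableAt ℝ (fun v => c' (A.actCoord a'.1 b'.1 z v)) (R v) := by
    rw [hRv]
    refine (contDiffAt_actCoord_right hπ a'.2 b'.2 hc' (hφz ▸ hφx) hv₁ ?_).differentiableAt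
      (by simp)
    rw [A.actCoord_coord hφ a' b' hx hφx hφz.symm]
    exact hxc
  have hD1 : DifferentiableAt ℝ (fun v => c (A.actCoord a.1 b.1 z v)) v :=
    (contDiffAt_actCoord_right hπ a.2 b.2 hc hz hv hvc).differentiableAt (by simp)
  have hfun : (fun v => c' (A.actCoord a'.1 b'.1 z v)) ∘ R =ᶠ[𝓝 v]
      L₁ ∘ fun v => c (A.actCoord a.1 b.1 z v) := by
    have hop := (isOpen_actCoord_right_preimage hπ a.2 b.2 c hz).mem_nhds ⟨hv, hvc⟩
    filter_upwards [hact, hop] with w h1 h2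
    simp only [Function.comp, L₁, h1, c.left_inv h2.2]
  have hcomp := (hD2.hasFDerivAt.comp v hR.hasFDerivAt).unique
    ((HasFDerivAt.comp v (g := L₁) hL₁.hasFDerivAt hD1.hasFDerivAt).congr_of_eventuallyEq hfun)
  rw [← hRv]
  exact finrank_range_le_of_comp_eq (fun w => DFunLike.congr_fun hcomp w) hinj

/-- The orbit map of a point of a homogeneous bundle is a submersion. -/
theorem Homogeneous.surjective_fderiv_actCoord [SecondCountableTopology X] (hA : A.Homogeneous)
    (hπ : ContMDiff 𝓘(ℝ, Eu N) 𝓘(ℝ, Eu n) ∞ π) {z : Z} (a b : atlas (Eu n) X)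
    {c : OpenPartialHomeomorph Z (Eu N)} (hc : c ∈ atlas (Eu N) Z) {x : X} {φ : X → X}
    (hφ : LocalDiffeoAt n φ x) (hφz : φ x = π z) (hx : x ∈ a.1.source)
    (hφx : φ x ∈ b.1.source) (hxc : A.act z (Jet.mk q x φ) ∈ c.source) :
    Function.Surjective (fderiv ℝ (fun v => c (A.actCoord a.1 b.1 z v))
      (Jet.coord a b (Jet.mk q x φ))) := by
  set D := (fderiv ℝ (fun v => c (A.actCoord a.1 b.1 z v))
      (Jet.coord a b (Jet.mk q x φ))).toLinearMap with hD
  set r := Module.finrank ℝ (LinearMap.range D) with hr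
  by_contra hns
  have hrN : r < N := by
    have hne : LinearMap.range D ≠ ⊤ := fun h => hns (LinearMap.range_eq_top.1 h)
    have := Submodule.finrank_lt hne
    simpa using this
  have hbz : π z ∈ b.1.source := hφz ▸ hφx
  have hxc' : A.actCoord a.1 b.1 z (Jet.coord a b (Jet.mk q x φ)) ∈ c.source := by
    rwa [A.actCoord_coord hφ a b hx hφx hφz.symm]
  have hv₀ := coord_mem_regularCoord (q := q) hφ a b hx hφx
  -- The coordinates, in the chart at `p`, of the jets with target `π z` that carry `z` into the
  -- chart domain of `c`. By homogeneity their images, for `p` in a countable set, cover `c.target`.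
  let C : X → Set (Jet.Coord q n n) := fun p => {v | ∃ (x : X) (φ : X → X), LocalDiffeoAt n φ x ∧
    φ x = π z ∧ x ∈ (chartAt (Eu n) p).source ∧ A.act z (Jet.mk q x φ) ∈ c.source ∧
    v = Jet.coord (⟨chartAt (Eu n) p, chart_mem_atlas _ _⟩ : atlas (Eu n) X) b (Jet.mk q x φ)}
  have hdim : ∀ p, dimH ((fun v => c (A.actCoord (chartAt (Eu n) p) b.1 z v)) '' C p) ≤ r := by
    intro p
    let a' : atlas (Eu n) X := ⟨chartAt (Eu n) p, chart_mem_atlas _ _⟩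
    let s := regularCoord q a'.1 ∩ A.actCoord a'.1 b.1 z ⁻¹' c.source
    have hs : IsOpen s := isOpen_actCoord_right_preimage hπ a'.2 b.2 c hbz
    have hloc : ∀ v ∈ C p, ∃ U ∈ 𝓝 v, dimH ((fun v => c (A.actCoord a'.1 b.1 z v)) '' U) ≤ r := by
      rintro v ⟨x', φ', hφ', hφ'z, hx', hc', rfl⟩
      have hφ'b : φ' x' ∈ b.1.source := by rw [hφ'z]; exact hbz
      have hreg := coord_mem_regularCoord (q := q) hφ' a' b hx' hφ'b
      have hmem : A.actCoord a'.1 b.1 z (Jet.coord a' b (Jet.mk q x' φ')) ∈ c.source := by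
        rwa [A.actCoord_coord hφ' a' b hx' hφ'b hφ'z.symm]
      -- Comparison with the given jet bounds the rank here by `r`. Below, the same comparison
      -- bounds the rank at all nearby coordinates by the rank here, which is the maximality needed
      -- for the constant rank theorem.
      have hle := finrank_range_fderiv_actCoord_le hπ hc hreg hbz hmem hc hφ hφz hx hφx hxc
      obtain ⟨U, hU, hU'⟩ := exists_dimH_image_le_of_finrank_le hs
        (f := fun v => c (A.actCoord a'.1 b.1 z v)) (fun w hw =>
          (contDiffAt_actCoord_right hπ a'.2 b.2 hc hbz hw.1 hw.2).contDiffWithinAt)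
        (a := Jet.coord a' b (Jet.mk q x' φ')) ⟨hreg, hmem⟩ (fun w hw =>
          finrank_range_fderiv_actCoord_le hπ hc hw.1 hbz hw.2 hc hφ' hφ'z hx' hφ'b hc')
      exact ⟨U, hU, hU'.trans (by exact_mod_cast hle)⟩
    choose! U hU hU' using hloc
    -- Hausdorff dimension passes to countable unions without loss, so the local bounds suffice by
    -- the Lindelöf property.
    obtain ⟨t, htC, htc, hcov⟩ := TopologicalSpace.countable_cover_nhdsWithin
      (fun v hv => mem_nhdsWithin_of_mem_nhds (hU v hv))
    have hsub : (fun v => c (A.actCoord a'.1 b.1 z v)) '' C p ⊆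
        ⋃ v ∈ t, (fun v => c (A.actCoord a'.1 b.1 z v)) '' U v := by
      rw [← image_iUnion₂]
      exact image_mono hcov
    refine (dimH_mono hsub).trans ?_
    rw [dimH_bUnion htc]
    exact iSup₂_le fun v hv => hU' v (htC hv)
  obtain ⟨S, hSc, hS⟩ := TopologicalSpace.countable_cover_nhds
    (fun p : X => (chartAt (Eu n) p).open_source.mem_nhds (mem_chart_source _ p))
  have hcover : c.target ⊆ ⋃ p ∈ S, (fun v => c (A.actCoord (chartAt (Eu n) p) b.1 z v)) '' C p := by
    intro w hw
    obtain ⟨φ', hφ', hφ'z, hact⟩ := hA.exists_act_eq z (c.symm w)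
    have hmem : π (c.symm w) ∈ ⋃ p ∈ S, (chartAt (Eu n) p).source := hS ▸ mem_univ _
    obtain ⟨p, hpS, hp⟩ := mem_iUnion₂.1 hmem
    refine mem_iUnion₂.2 ⟨p, hpS, _, ⟨_, φ', hφ', hφ'z, hp, ?_, rfl⟩, ?_⟩
    · rw [hact]; exact c.map_target hw
    · dsimp only
      have e := A.actCoord_coord hφ' (⟨chartAt (Eu n) p, chart_mem_atlas _ _⟩ : atlas (Eu n) X) b hp
        (by rw [hφ'z]; exact hbz) hφ'z.symm
      dsimp only at e
      rw [e, hact, c.right_inv hw]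
  have h1 : dimH c.target ≤ r := by
    refine (dimH_mono hcover).trans ?_
    rw [dimH_bUnion hSc]
    exact iSup₂_le fun p _ => hdim p
  -- A nonempty open subset of `Eu N` has dimension `N > r`, a contradiction.
  have h2 : dimH c.target = N := by
    rw [Real.dimH_of_nonempty_interior (E := Eu N)]
    · simp
    · rw [c.open_target.interior_eq]
      exact ⟨_, c.map_source hxc⟩
  rw [h2] at h1
  exact absurd (by exact_mod_cast h1) (not_le.2 hrN)

end NaturalAction

/-! ### The prolonged symmetry groupoid is the stabilizer of `j_1(ω₀)` -/

namespace NaturalAction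

variable {n N q : ℕ}
  {X : Type*} [TopologicalSpace X] [ChartedSpace (Eu n) X] [IsManifold 𝓘(ℝ, Eu n) ∞ X]
  {Z : Type*} [TopologicalSpace Z] [ChartedSpace (Eu N) Z] [IsManifold 𝓘(ℝ, Eu N) ∞ Z]
  {π : Z → X} {A : NaturalAction n N q π}

/-- The coordinates of the target, as a function of the coordinates of a jet. -/
def targetCoord (n q : ℕ) : Jet.Coord q n n →L[ℝ] Eu n :=
  (ContinuousMultilinearMap.apply ℝ (fun _ : Fin 0 => Eu n) (Eu n) 0).comp
    ((ContinuousLinearMap.proj (R := ℝ)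
      (φ := fun k : Fin (q + 1) => Eu n [×(k : ℕ)]→L[ℝ] Eu n) 0).comp
      (ContinuousLinearMap.snd ℝ _ _))

omit [IsManifold 𝓘(ℝ, Eu n) ∞ X] in
theorem targetCoord_coord (a b : atlas (Eu n) X) {x : X} {φ : X → X} (hx : x ∈ a.1.source)
    (hφx : φ x ∈ b.1.source) :
    targetCoord n q (Jet.coord a b (Jet.mk q x φ)) = b.1 (φ x) := by
  rw [Jet.coord_mk a b hx hφx]
  have : iteratedFDeriv ℝ 0 (b.1 ∘ φ ∘ a.1.symm) (a.1 x) 0 = b.1 (φ x) := by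
    simp [a.1.left_inv hx]
  exact this

/-- Jets in the prolongation of the symmetry groupoid preserve the `1`-jet of the geometric
object. -/
theorem exists_of_mem_prolongation (hπ : ContMDiff 𝓘(ℝ, Eu N) 𝓘(ℝ, Eu n) ∞ π)
    (ω₀ : GeometricObject n N π) {g : Jet n n (q + 1) X X}
    (hg : g ∈ prolongation (A.symmetryGroupoid ω₀)) :
    ∃ (x : X) (φ : X → X), LocalDiffeoAt n φ x ∧ g = Jet.mk (q + 1) x φ ∧
      SameJet n N 1 x ω₀ (A.pullback ω₀ φ) := by
  obtain ⟨x, φ, hφ, rfl, U, ψ, hU, hxU, hψ, hψR, hψx, hfd⟩ := hg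
  refine ⟨x, φ, hφ, rfl, ?_⟩
  have h0 : A.pullback ω₀ φ x = ω₀ x := by
    have := (hψR x hxU).2.2
    rw [hψx] at this
    exact this
  refine sameJet_one_iff.2 ⟨h0.symm, fun a ha c' hc' hx hc'x => ?_⟩
  let a' : atlas (Eu n) X := ⟨a, ha⟩
  let b : atlas (Eu n) X := ⟨chartAt (Eu n) (φ x), chart_mem_atlas _ _⟩
  let c := chartAt (Eu N) (ω₀ (φ x))
  have hc : c ∈ atlas (Eu N) Z := chart_mem_atlas _ _
  have hb : φ x ∈ b.1.source := mem_chart_source _ _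
  have hcx : ω₀ (φ x) ∈ c.source := mem_chart_source _ _
  have htx : (ψ x).target = φ x := by rw [hψx]; rfl
  have htc : ContinuousAt (fun x' => (ψ x').target) x := hψ.2.1.continuousAt (hU.mem_nhds hxU)
  have hnear : ∀ᶠ x' in 𝓝 x, x' ∈ U ∧ x' ∈ a.source ∧ (ψ x').target ∈ b.1.source := by
    filter_upwards [hU.mem_nhds hxU, a.open_source.mem_nhds hx,
      htc.preimage_mem_nhds (b.1.open_source.mem_nhds (by rw [htx]; exact hb))] with x' h1 h2 h3
    exact ⟨h1, h2, h3⟩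
  let v : Eu n → Jet.Coord q n n := fun e => Jet.coord a' b (ψ (a.symm e))
  let z : Eu n → Z := fun e => ω₀ (ψ (a.symm e)).target
  have hve : v (a x) = Jet.coord a' b (Jet.mk q x φ) := by simp only [v, a.left_inv hx, hψx]
  have hze : z (a x) = ω₀ (φ x) := by simp only [z, a.left_inv hx, htx]
  have hvd : DifferentiableAt ℝ v (a x) := by
    have h1 : ContMDiffAt 𝓘(ℝ, Eu n) 𝓘(ℝ, Jet.Coord q n n) ∞ (fun x' => Jet.coord a' b (ψ x')) x :=
      (hψ.2.2 a' b).contMDiffAt (hnear.mono fun x' h => by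
        refine ⟨h.1, ?_, h.2.2⟩
        rw [(hψR x' h.1).1]
        exact h.2.1)
    have h2 : ContMDiffAt 𝓘(ℝ, Eu n) 𝓘(ℝ, Jet.Coord q n n) ∞ v (a x) :=
      ContMDiffAt.comp (a x) (I' := 𝓘(ℝ, Eu n)) (g := fun x' => Jet.coord a' b (ψ x'))
        (f := a.symm) (by rwa [a.left_inv hx]) (contMDiffAt_chart_symm ha (a.map_source hx))
    exact h2.contDiffAt.differentiableAt (by simp)
  have hv' : fderiv ℝ v (a x) = fderiv ℝ (jetCoord q (b.1 ∘ φ ∘ a.symm)) (a x) := by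
    rw [← (coord_mk_chart_eventuallyEq hφ.contMDiffAt.continuousAt a' b hx hb).fderiv_eq]
    exact hfd a' b hx hb
  have hzc : ContinuousAt z (a x) := by
    refine ContinuousAt.comp (g := fun x' => ω₀ (ψ x').target) ?_
      (a.continuousAt_symm (a.map_source hx))
    rw [a.left_inv hx]
    exact ω₀.smooth.continuous.continuousAt.comp htc
  have hωb : DifferentiableAt ℝ (c ∘ ω₀ ∘ b.1.symm) (b.1 (φ x)) :=
    (contDiffAt_chart_comp b.2 hc ω₀.smooth.contMDiffAt hb hcx).differentiableAt (by simp)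
  have hj := hasFDerivAt_jetCoord (q := q) (contDiffAt_chart_comp ha b.2 hφ.contMDiffAt hx hb)
  have hjet : ∀ᶠ x' in 𝓝 x, ∃ φ' : X → X, LocalDiffeoAt n φ' x' ∧ ψ x' = Jet.mk q x' φ' := by
    filter_upwards [hU.mem_nhds hxU] with x' hx'
    obtain ⟨x'', φ', hφ', he⟩ := (hψR x' hx').2.1
    have : x'' = x' := by rw [← (hψR x' hx').1, he]; rfl
    subst this
    exact ⟨φ', hφ', he⟩
  have htv : ∀ᶠ e in 𝓝 (a x), targetCoord n q (v e) = b.1 (ψ (a.symm e)).target := by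
    filter_upwards [eventually_chart_symm hx hnear, eventually_chart_symm hx hjet]
      with e h1 ⟨φ', h2, h3⟩
    simp only [v]
    rw [h3] at h1 ⊢
    exact targetCoord_coord a' b h1.2.1 h1.2.2
  have hev : targetCoord n q (v (a x)) = b.1 (φ x) := by
    rw [hve]; exact targetCoord_coord a' b hx hb
  -- Tangency of `ψ` to `j_q(φ)` is a statement on jet coordinates. The coordinate of order zero is
  -- that of the target, so `ω₀ ∘ t ∘ ψ` and `ω₀ ∘ φ` have the same derivative at `x`; this goes
  -- with `hcφ`.
  have hcz : HasFDerivAt (c ∘ z) ((fderiv ℝ (c ∘ ω₀ ∘ b.1.symm) (b.1 (φ x))).comp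
      ((targetCoord n q).comp (fderiv ℝ v (a x)))) (a x) := by
    have h1 : HasFDerivAt (fun e => targetCoord n q (v e))
        ((targetCoord n q).comp (fderiv ℝ v (a x))) (a x) :=
      (targetCoord n q).hasFDerivAt.comp _ hvd.hasFDerivAt
    have h2 := hωb.hasFDerivAt
    rw [← hev] at h2
    have h3 := HasFDerivAt.comp (a x) h2 h1
    rw [hev] at h3
    refine h3.congr_of_eventuallyEq ?_
    filter_upwards [htv, eventually_chart_symm hx hnear] with e he he'
    simp only [Function.comp, he, z, b.1.left_inv he'.2.2]
  have hcφ : fderiv ℝ (c ∘ (ω₀ ∘ φ) ∘ a.symm) (a x) =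
      (fderiv ℝ (c ∘ ω₀ ∘ b.1.symm) (b.1 (φ x))).comp
        ((targetCoord n q).comp (fderiv ℝ v (a x))) := by
    rw [hv', (chart_comp_eventuallyEq hφ.contMDiffAt.continuousAt hx hb).fderiv_eq]
    have e1 : (b.1 ∘ φ ∘ a.symm) (a x) = b.1 (φ x) := by simp [a.left_inv hx]
    have h1 : HasFDerivAt (b.1 ∘ φ ∘ a.symm)
        ((targetCoord n q).comp (fderiv ℝ (jetCoord q (b.1 ∘ φ ∘ a.symm)) (a x))) (a x) := by
      have h2 := (targetCoord n q).hasFDerivAt.comp (a x) hj.differentiableAt.hasFDerivAt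
      refine h2.congr_of_eventuallyEq (Eventually.of_forall fun e => ?_)
      exact (iteratedFDeriv_zero_apply (𝕜 := ℝ) (f := b.1 ∘ φ ∘ a.symm) (x := e) 0).symm
    have h3 := hωb.hasFDerivAt
    rw [← e1] at h3
    rw [(h3.comp (a x) h1).fderiv, e1]
  have hact : A.actCoord a b.1 (z (a x)) (v (a x)) = ω₀ x := by
    rw [hve, hze, ← h0]
    exact A.actCoord_coord hφ a' b hx hb (ω₀.proj_toFun _)
  have key := A.hasFDerivAt_actCoord hπ ha b.2 hc hc' hzc hcz hvd.hasFDerivAt (by rwa [hze])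
    (by rw [hze, ω₀.proj_toFun]; exact hb)
    (by rw [hve]; exact coord_mem_regularCoord hφ a' b hx hb) (by rwa [hact])
  -- As `ψ` takes values in the symmetry groupoid, `ω₀` is near `x` the result of letting `ψ` act on
  -- `ω₀ ∘ t ∘ ψ`. Its derivative therefore is given by the same chain rule as that of the pullback
  -- by `φ`.
  have hω : c' ∘ ω₀ ∘ a.symm =ᶠ[𝓝 (a x)] fun e => c' (A.actCoord a b.1 (z e) (v e)) := by
    filter_upwards [eventually_chart_symm hx hnear, eventually_chart_symm hx hjet]
      with e h1 ⟨φ', h2, h3⟩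
    have h4 := (hψR _ h1.1).2.2
    simp only [Function.comp, v, z]
    rw [h3] at h1 h4 ⊢
    have h5 := A.actCoord_coord h2 a' b h1.2.1 h1.2.2 (ω₀.proj_toFun (φ' (a.symm e)))
    exact congrArg c' (h5.trans h4).symm
  rw [hω.fderiv_eq, key.fderiv, (A.hasFDerivAt_pullback hπ hφ (ω₀.localSectionAt _) a' b hx hb hc
    hc' hcx (by rwa [h0])).fderiv, hze, hve, ← hv', hcφ]

/-- A change of charts in the jet bundle. The prolongation condition refers to all pairs of charts,
whereas the section of the symmetry groupoid is constructed in one. -/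
theorem contDiffAt_coord_jetMap (a b a' b' : atlas (Eu n) X) {y : Eu n} {v : Jet.Coord q n n}
    (hy : y ∈ b.1.target) (hv : v ∈ regularCoord q a.1) (ha' : a.1.symm v.1 ∈ a'.1.source)
    (hb' : b.1.symm y ∈ b'.1.source) :
    ContDiffAt ℝ ∞ (fun r : Eu n × Jet.Coord q n n =>
      Jet.coord a' b' (Jet.mk q (a.1.symm r.2.1) (jetMap a.1 b.1 r.1 r.2))) (y, v) := by
  have hfst : ContMDiffAt 𝓘(ℝ, Eu n × Jet.Coord q n n) 𝓘(ℝ, Eu n) ∞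
      (fun r : Eu n × Jet.Coord q n n => r.2.1) (y, v) :=
    (by fun_prop : ContDiffAt ℝ ∞ (fun r : Eu n × Jet.Coord q n n => r.2.1) (y, v)).contMDiffAt
  have hsrc : jetMap a.1 b.1 y v (a.1.symm v.1) = b.1.symm y := jetMap_source _ hv
  have hx : ContMDiffAt 𝓘(ℝ, Eu n × Jet.Coord q n n) 𝓘(ℝ, Eu n) ∞
      (fun r : Eu n × Jet.Coord q n n => a.1.symm r.2.1) (y, v) :=
    ContMDiffAt.comp (y, v) (I' := 𝓘(ℝ, Eu n)) (g := a.1.symm)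
      (f := fun r : Eu n × Jet.Coord q n n => r.2.1) (contMDiffAt_chart_symm a.2 hv.1) hfst
  have := contMDiffAt_coord (q := q)
    (G := fun r : Eu n × Jet.Coord q n n => jetMap a.1 b.1 r.1 r.2)
    (x := fun r => a.1.symm r.2.1) (contMDiffAt_jetMap a.2 b.2 hy hv) hx a' b' ha'
    (by simpa only [hsrc] using hb')
  exact this.contDiffAt

theorem isOpen_actChart_domain (hπ : ContMDiff 𝓘(ℝ, Eu N) 𝓘(ℝ, Eu n) ∞ π)
    {a b : OpenPartialHomeomorph X (Eu n)} (ha : a ∈ atlas (Eu n) X) (hb : b ∈ atlas (Eu n) X)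
    (c c' : OpenPartialHomeomorph Z (Eu N)) :
    IsOpen (((c.target ∩ c.symm ⁻¹' (π ⁻¹' b.source)) ×ˢ regularCoord q a) ∩
      (fun p : Eu N × Jet.Coord q n n => A.actCoord a b (c.symm p.1) p.2) ⁻¹' c'.source) := by
  refine ContinuousOn.isOpen_inter_preimage (fun p hp => ?_)
    ((c.isOpen_inter_preimage_symm (b.open_source.preimage hπ.continuous)).prod
      (isOpen_regularCoord a)) c'.open_source
  refine ContinuousAt.continuousWithinAt ?_
  refine ContinuousAt.comp (g := fun p : Z × Jet.Coord q n n => A.actCoord a b p.1 p.2)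
    (f := fun p : Eu N × Jet.Coord q n n => (c.symm p.1, p.2))
    (A.contMDiffAt_actCoord hπ ha hb hp.1.2 hp.2).continuousAt ?_
  exact ((c.continuousAt_symm hp.1.1).comp continuousAt_fst).prodMk continuousAt_snd

set_option maxHeartbeats 1000000 in
/-- Jets that preserve the `1`-jet of the geometric object belong to the prolongation of its
symmetry groupoid. -/
theorem Homogeneous.mem_prolongation [SecondCountableTopology X] (hA : A.Homogeneous)
    (hπ : ContMDiff 𝓘(ℝ, Eu N) 𝓘(ℝ, Eu n) ∞ π) (ω₀ : GeometricObject n N π) {x : X} {φ : X → X}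
    (hφ : LocalDiffeoAt n φ x) (h : SameJet n N 1 x ω₀ (A.pullback ω₀ φ)) :
    Jet.mk (q + 1) x φ ∈ prolongation (A.symmetryGroupoid ω₀) := by
  let a : atlas (Eu n) X := ⟨chartAt (Eu n) x, chart_mem_atlas _ _⟩
  let b : atlas (Eu n) X := ⟨chartAt (Eu n) (φ x), chart_mem_atlas _ _⟩
  let c := chartAt (Eu N) (ω₀ (φ x))
  let c' := chartAt (Eu N) (ω₀ x)
  have hc : c ∈ atlas (Eu N) Z := chart_mem_atlas _ _
  have hc' : c' ∈ atlas (Eu N) Z := chart_mem_atlas _ _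
  have hxa : x ∈ a.1.source := mem_chart_source _ _
  have hb : φ x ∈ b.1.source := mem_chart_source _ _
  have hcx : ω₀ (φ x) ∈ c.source := mem_chart_source _ _
  have hc'x : ω₀ x ∈ c'.source := mem_chart_source _ _
  have hpull : A.pullback ω₀ φ x ∈ c'.source := h.1 ▸ hc'x
  have hv₀ := coord_mem_regularCoord (q := q) hφ a b hxa hb
  have hact₀ := A.actCoord_coord hφ a b hxa hb (ω₀.proj_toFun (φ x))
  -- The first component records the point acted on. A local right inverse of `Θ` thus leaves this
  -- point fixed and changes the jet so as to reach a prescribed value. That `Θ` is a submersion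
  -- follows from the same property of the orbit map.
  let Θ : Eu N × Jet.Coord q n n → Eu N × Eu N := fun p => (p.1, A.actChart a.1 b.1 c c' p)
  set s := ((c.target ∩ c.symm ⁻¹' (π ⁻¹' b.1.source)) ×ˢ regularCoord q a.1) ∩
      (fun p : Eu N × Jet.Coord q n n => A.actCoord a.1 b.1 (c.symm p.1) p.2) ⁻¹' c'.source with hs
  have hso : IsOpen s := isOpen_actChart_domain hπ a.2 b.2 c c'
  have hchart : ∀ p ∈ s, ContDiffAt ℝ ∞ (A.actChart a.1 b.1 c c') p := by
    rintro ⟨ζ, v⟩ ⟨⟨⟨h1, h2⟩, h3⟩, h4⟩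
    have := A.contDiffAt_actChart hπ a.2 b.2 hc hc' (c.map_target h1) h2 h3 h4
    rwa [c.right_inv h1] at this
  have hΘ : ContDiffOn ℝ ∞ Θ s := fun p hp =>
    (contDiffAt_fst.prodMk (hchart p hp)).contDiffWithinAt
  -- the coordinates of the jets of `φ`
  let v₀ : X → Jet.Coord q n n := fun x' => Jet.coord a b (Jet.mk q x' φ)
  let p₀ : X → Eu N × Jet.Coord q n n := fun x' => (c (ω₀ (φ x')), v₀ x')
  have hp₀ : p₀ x ∈ s := by
    refine ⟨⟨⟨c.map_source hcx, ?_⟩, hv₀⟩, ?_⟩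
    · simp only [p₀, mem_preimage, c.left_inv hcx, ω₀.proj_toFun]
      exact hb
    · simp only [p₀, v₀, mem_preimage, c.left_inv hcx]
      rw [hact₀]
      exact hpull
  have hsurj : Function.Surjective (fderiv ℝ Θ (p₀ x)) := by
    have hd := ((hchart _ hp₀).differentiableAt (by simp)).hasFDerivAt
    have hΘd : HasFDerivAt Θ _ (p₀ x) := hasFDerivAt_fst.prodMk hd
    have hright : HasFDerivAt (fun v => c' (A.actCoord a.1 b.1 (ω₀ (φ x)) v))
        ((fderiv ℝ (A.actChart a.1 b.1 c c') (p₀ x)).comp (ContinuousLinearMap.inr ℝ _ _))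
        (v₀ x) := by
      have := HasFDerivAt.comp (v₀ x) hd (hasFDerivAt_prodMk_right (c (ω₀ (φ x))) (v₀ x))
      refine this.congr_of_eventuallyEq (Eventually.of_forall fun v => ?_)
      simp [actChart, c.left_inv hcx]
    have hsub := hA.surjective_fderiv_actCoord hπ (z := ω₀ (φ x)) a b hc' hφ
      (ω₀.proj_toFun _).symm hxa hb hpull
    rw [hright.fderiv] at hsub
    rw [hΘd.fderiv]
    rintro ⟨ζ', w'⟩
    obtain ⟨v', hv'⟩ := hsub (w' - fderiv ℝ (A.actChart a.1 b.1 c c') (p₀ x) (ζ', 0))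
    refine ⟨(ζ', v'), Prod.ext rfl ?_⟩
    have e : ((ζ', v') : Eu N × Jet.Coord q n n) = (ζ', 0) + (0, v') := by simp
    change fderiv ℝ (A.actChart a.1 b.1 c c') (p₀ x) (ζ', v') = w'
    rw [e, map_add]
    change _ + ((fderiv ℝ (A.actChart a.1 b.1 c c') (p₀ x)).comp
      (ContinuousLinearMap.inr ℝ _ _)) v' = w'
    rw [hv']
    abel
  obtain ⟨ρ, Ω, hΩ, hpΩ, hρ, hρs, hρ₀⟩ := exists_contDiffOn_section_of_surjective hso hΘ hp₀ hsurj
  -- In `(p₀, Θ p₀)` the value of the pullback of `ω₀` is replaced by the desired value `ω₀`. Hence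
  -- `ρ ∘ i` provides jets in the symmetry groupoid, while `ρ (p₀, Θ p₀) = p₀` near `x` returns the
  -- jets of `φ`.
  let i : X → (Eu N × Jet.Coord q n n) × (Eu N × Eu N) := fun x' =>
    (p₀ x', (c (ω₀ (φ x')), c' (ω₀ x')))
  let v : X → Jet.Coord q n n := fun x' => (ρ (i x')).2
  have hΘp : ∀ᶠ x' in 𝓝 x, Θ (p₀ x') = (c (ω₀ (φ x')), c' (A.pullback ω₀ φ x')) := by
    have hcont := hφ.contMDiffAt.continuousAt
    filter_upwards [hφ.eventually, a.1.open_source.mem_nhds hxa,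
      hcont.preimage_mem_nhds (b.1.open_source.mem_nhds hb),
      (ω₀.smooth.continuous.continuousAt.comp hcont).preimage_mem_nhds
        (c.open_source.mem_nhds hcx)] with x' h1 h2 h3 h4
    simp only [Θ, p₀, v₀, actChart]
    rw [c.left_inv (show ω₀ (φ x') ∈ c.source from h4),
      A.actCoord_coord h1 a b h2 h3 (ω₀.proj_toFun _)]
    rfl
  have hix : i x = (p₀ x, Θ (p₀ x)) := by
    rw [hΘp.self_of_nhds, ← h.1]
  have hpsm : ∀ x', LocalDiffeoAt n φ x' → x' ∈ a.1.source → φ x' ∈ b.1.source →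
      ω₀ (φ x') ∈ c.source → ContMDiffAt 𝓘(ℝ, Eu n) 𝓘(ℝ, Eu N × Jet.Coord q n n) ∞ p₀ x' := by
    intro x' h1 h2 h3 h4
    refine ContMDiffAt.prodMk_space ?_ ?_
    · exact ContMDiffAt.comp x' (contMDiffAt_chart hc h4)
        (ω₀.smooth.contMDiffAt.comp x' h1.contMDiffAt)
    · exact contMDiffAt_coord (G := fun _ => φ) (x := id)
        (h1.contMDiffAt.comp (x', x') contMDiffAt_snd) contMDiffAt_id a b h2 h3
  have hism : ∀ x', LocalDiffeoAt n φ x' → x' ∈ a.1.source → φ x' ∈ b.1.source →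
      ω₀ (φ x') ∈ c.source → ω₀ x' ∈ c'.source → ContMDiffAt 𝓘(ℝ, Eu n)
        𝓘(ℝ, (Eu N × Jet.Coord q n n) × (Eu N × Eu N)) ∞ i x' := by
    intro x' h1 h2 h3 h4 h5
    refine (hpsm x' h1 h2 h3 h4).prodMk_space (ContMDiffAt.prodMk_space ?_ ?_)
    · exact ContMDiffAt.comp x' (contMDiffAt_chart hc h4)
        (ω₀.smooth.contMDiffAt.comp x' h1.contMDiffAt)
    · exact ContMDiffAt.comp x' (contMDiffAt_chart hc' h5) ω₀.smooth.contMDiffAt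
  have hic := (hism x hφ hxa hb hcx hc'x).continuousAt
  have hiΩ : i x ∈ Ω := by rw [hix]; exact hpΩ
  have hgood : ∀ᶠ x' in 𝓝 x, LocalDiffeoAt n φ x' ∧ x' ∈ a.1.source ∧ φ x' ∈ b.1.source ∧
      ω₀ (φ x') ∈ c.source ∧ ω₀ x' ∈ c'.source ∧ i x' ∈ Ω := by
    have hcont := hφ.contMDiffAt.continuousAt
    filter_upwards [hφ.eventually, a.1.open_source.mem_nhds hxa,
      hcont.preimage_mem_nhds (b.1.open_source.mem_nhds hb),
      (ω₀.smooth.continuous.continuousAt.comp hcont).preimage_mem_nhds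
        (c.open_source.mem_nhds hcx), ω₀.smooth.continuous.continuousAt.preimage_mem_nhds
        (c'.open_source.mem_nhds hc'x), hic.preimage_mem_nhds (hΩ.mem_nhds hiΩ)]
      with x' h1 h2 h3 h4 h5 h6
    exact ⟨h1, h2, h3, h4, h5, h6⟩
  obtain ⟨U, hUgood, hU, hxU⟩ := eventually_nhds_iff.1 hgood
  have hvreg : ∀ x' ∈ U, v x' ∈ regularCoord q a.1 ∧
      A.actCoord a.1 b.1 (ω₀ (φ x')) (v x') = ω₀ x' ∧ a.1.symm (v x').1 = x' := by
    intro x' hx'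
    obtain ⟨h1, h2, h3, h4, h5, h6⟩ := hUgood x' hx'
    obtain ⟨⟨⟨⟨h7, h8⟩, h9⟩, h10⟩, h11⟩ := hρs _ h6
    have e1 : (ρ (i x')).1 = c (ω₀ (φ x')) := congrArg Prod.fst h11
    have e2 : c' (A.actCoord a.1 b.1 (c.symm (ρ (i x')).1) (ρ (i x')).2) = c' (ω₀ x') :=
      congrArg Prod.snd h11
    have e3 := c'.injOn h10 h5 e2
    change A.actCoord a.1 b.1 (c.symm (ρ (i x')).1) (ρ (i x')).2 = ω₀ x' at e3
    rw [e1, c.left_inv h4] at e3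
    refine ⟨h9, e3, ?_⟩
    rw [← proj_actCoord (A := A) a.2 b.2 (z := ω₀ (φ x')) (by rw [ω₀.proj_toFun]; exact h3) h9, e3,
      ω₀.proj_toFun]
  have hvsm : ∀ x' ∈ U, ContMDiffAt 𝓘(ℝ, Eu n) 𝓘(ℝ, Jet.Coord q n n) ∞ v x' := by
    intro x' hx'
    obtain ⟨h1, h2, h3, h4, h5, h6⟩ := hUgood x' hx'
    exact ContMDiffAt.comp x' (I' := 𝓘(ℝ, (Eu N × Jet.Coord q n n) × (Eu N × Eu N)))
      (g := fun r => (ρ r).2) (f := i)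
      (contDiffAt_snd.comp _ (hρ.contDiffAt (hΩ.mem_nhds h6))).contMDiffAt
      (hism x' h1 h2 h3 h4 h5)
  have hvx : v x = v₀ x := by
    have := hρ₀.self_of_nhds
    rw [← hix] at this
    exact congrArg Prod.snd this
  -- `v` and `v₀` have the same derivative at `x`
  have hvder : ∀ a' ∈ atlas (Eu n) X, x ∈ a'.source →
      fderiv ℝ (v ∘ a'.symm) (a' x) = fderiv ℝ (v₀ ∘ a'.symm) (a' x) := by
    intro a' ha' hx'
    have hsymm := contMDiffAt_chart_symm ha' (a'.map_source hx')
    have hdiff : ∀ {E : Type} [NormedAddCommGroup E] [NormedSpace ℝ E] (f : X → E),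
        ContMDiffAt 𝓘(ℝ, Eu n) 𝓘(ℝ, E) ∞ f x → DifferentiableAt ℝ (f ∘ a'.symm) (a' x) := by
      intro E _ _ f hf
      have : ContMDiffAt 𝓘(ℝ, Eu n) 𝓘(ℝ, E) ∞ (f ∘ a'.symm) (a' x) :=
        ContMDiffAt.comp (a' x) (by rwa [a'.left_inv hx']) hsymm
      exact this.contDiffAt.differentiableAt (by simp)
    have hpd := (hdiff p₀ (hpsm x hφ hxa hb hcx)).hasFDerivAt
    have hζ : DifferentiableAt ℝ ((fun x' => c (ω₀ (φ x'))) ∘ a'.symm) (a' x) :=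
      hdiff (fun x' => c (ω₀ (φ x'))) (ContMDiffAt.comp x (contMDiffAt_chart hc hcx)
        (ω₀.smooth.contMDiffAt.comp x hφ.contMDiffAt))
    have hw : DifferentiableAt ℝ (c' ∘ ω₀ ∘ a'.symm) (a' x) :=
      (contDiffAt_chart_comp ha' hc' ω₀.smooth.contMDiffAt hx' hc'x).differentiableAt (by simp)
    have hw' : DifferentiableAt ℝ (c' ∘ A.pullback ω₀ φ ∘ a'.symm) (a' x) :=
      (contDiffAt_chart_comp ha' hc' (A.localSectionAt_pullback hπ hφ
        (ω₀.localSectionAt _)).self_of_nhds.1 hx' hpull).differentiableAt (by simp)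
    have hww' := (sameJet_one_iff.1 h).2 a' ha' c' hc' hx' hc'x
    have hi1 : HasFDerivAt (i ∘ a'.symm) _ (a' x) :=
      hpd.prodMk (hζ.hasFDerivAt.prodMk hw.hasFDerivAt)
    have hi2 : HasFDerivAt (fun e => (p₀ (a'.symm e), Θ (p₀ (a'.symm e)))) _ (a' x) :=
      (hpd.prodMk (hζ.hasFDerivAt.prodMk hw'.hasFDerivAt)).congr_of_eventuallyEq
        ((eventually_chart_symm hx' hΘp).mono fun e he => Prod.ext rfl he)
    -- This is where the hypothesis on `1`-jets enters: `i` and `(p₀, Θ p₀)` now have the same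
    -- derivative, hence so do their images under `ρ`.
    rw [← hww'] at hi2
    have hρd := ((hρ.contDiffAt (hΩ.mem_nhds hiΩ)).differentiableAt (by simp)).hasFDerivAt
    have e1 : (i ∘ a'.symm) (a' x) = i x := by simp [a'.left_inv hx']
    have e2 : (p₀ (a'.symm (a' x)), Θ (p₀ (a'.symm (a' x)))) = i x := by
      rw [a'.left_inv hx', hix]
    have k1 : HasFDerivAt (ρ ∘ (i ∘ a'.symm)) _ (a' x) :=
      HasFDerivAt.comp (a' x) (by rw [e1]; exact hρd) hi1
    have k2 : HasFDerivAt (ρ ∘ fun e => (p₀ (a'.symm e), Θ (p₀ (a'.symm e)))) _ (a' x) :=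
      HasFDerivAt.comp (a' x) (by rw [e2]; exact hρd) hi2
    have hpc : ContinuousAt p₀ x := (hpsm x hφ hxa hb hcx).continuousAt
    have k3 := k2.congr_of_eventuallyEq (f₁ := p₀ ∘ a'.symm)
      ((eventually_chart_symm hx' (hpc.eventually hρ₀)).mono fun e he => he.symm)
    have k4 := k1.snd
    have k5 := k3.snd
    exact k4.fderiv.trans k5.fderiv.symm
  refine ⟨x, φ, hφ, rfl, U, fun x' => Jet.mk q (a.1.symm (v x').1)
    (jetMap a.1 b.1 (b.1 (φ x')) (v x')), hU, hxU, ?_, ?_, ?_, ?_⟩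
  · refine smoothOn_mk (G := fun x' => jetMap a.1 b.1 (b.1 (φ x')) (v x'))
      (x := fun x' => a.1.symm (v x').1) (fun x' hx' => ?_) (fun x' hx' => ?_)
    · obtain ⟨h1, h2, h3, h4, h5, h6⟩ := hUgood x' hx'
      exact contMDiffAt_jetMap_family (y := fun x' => b.1 (φ x')) a.2 b.2
        (ContMDiffAt.comp x' (contMDiffAt_chart b.2 h3) h1.contMDiffAt) (hvsm x' hx')
        (b.1.map_source h3) (hvreg x' hx').1
    · exact ContMDiffAt.comp x' (I' := 𝓘(ℝ, Eu n)) (g := a.1.symm) (f := fun x' => (v x').1)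
        (contMDiffAt_chart_symm a.2 (hvreg x' hx').1.1)
        (ContMDiffAt.comp x' contDiffAt_fst.contMDiffAt (hvsm x' hx'))
  · intro x' hx'
    obtain ⟨h1, h2, h3, h4, h5, h6⟩ := hUgood x' hx'
    obtain ⟨r1, r2, r3⟩ := hvreg x' hx'
    have hsrc : jetMap a.1 b.1 (b.1 (φ x')) (v x') (a.1.symm (v x').1) = φ x' := by
      rw [jetMap_source _ r1, b.1.left_inv h3]
    refine ⟨r3, ⟨_, _, localDiffeoAt_jetMap a.2 b.2 (b.1.map_source h3) r1, rfl⟩, ?_⟩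
    change A.act (ω₀ (jetMap a.1 b.1 (b.1 (φ x')) (v x') (a.1.symm (v x').1))) _ =
      ω₀ (a.1.symm (v x').1)
    rw [hsrc, r3, ← r2]
    simp only [actCoord, ω₀.proj_toFun, r3]
  · dsimp only
    rw [hvx]
    exact mk_jetMap_coord hφ a b hxa hb
  · intro a' b' hx' hb'
    -- In the charts `a'`, `b'`, the coordinates of the new section and of `j_q(φ)` arise from `v`
    -- and `v₀` through the same smooth map, with the same target coordinates, so that equality of
    -- derivatives is preserved.
    let K : Eu n × Jet.Coord q n n → Jet.Coord q n n := fun r =>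
      Jet.coord a' b' (Jet.mk q (a.1.symm r.2.1) (jetMap a.1 b.1 r.1 r.2))
    have hbφ := b.1.map_source hb
    have hv₀x : a.1.symm (v₀ x).1 = x := by
      have := (hvreg x hxU).2.2
      rwa [hvx] at this
    have hK : DifferentiableAt ℝ K (b.1 (φ x), v₀ x) :=
      (contDiffAt_coord_jetMap a b a' b' hbφ hv₀ (by rwa [hv₀x])
        (by rwa [b.1.left_inv hb])).differentiableAt (by simp)
    have hsymm := contMDiffAt_chart_symm a'.2 (a'.1.map_source hx')
    have hdiff : ∀ (f : X → Jet.Coord q n n),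
        ContMDiffAt 𝓘(ℝ, Eu n) 𝓘(ℝ, Jet.Coord q n n) ∞ f x →
          DifferentiableAt ℝ (f ∘ a'.1.symm) (a'.1 x) := by
      intro f hf
      have : ContMDiffAt 𝓘(ℝ, Eu n) 𝓘(ℝ, Jet.Coord q n n) ∞ (f ∘ a'.1.symm) (a'.1 x) :=
        ContMDiffAt.comp (a'.1 x) (by rwa [a'.1.left_inv hx']) hsymm
      exact this.contDiffAt.differentiableAt (by simp)
    have hbd := ((contDiffAt_chart_comp a'.2 b.2 hφ.contMDiffAt hx' hb).differentiableAt
      (by simp)).hasFDerivAt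
    have hvd := (hdiff v (hvsm x hxU)).hasFDerivAt
    have hv₀d := (hdiff v₀ (contMDiffAt_coord (G := fun _ => φ) (x := id)
      (hφ.contMDiffAt.comp (x, x) contMDiffAt_snd) contMDiffAt_id a b hxa hb)).hasFDerivAt
    rw [← hvder a'.1 a'.2 hx'] at hv₀d
    have e1 : ((b.1 ∘ φ ∘ a'.1.symm) (a'.1 x), (v ∘ a'.1.symm) (a'.1 x)) =
        (b.1 (φ x), v₀ x) := by simp [a'.1.left_inv hx', hvx]
    have e2 : ((b.1 ∘ φ ∘ a'.1.symm) (a'.1 x), (v₀ ∘ a'.1.symm) (a'.1 x)) =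
        (b.1 (φ x), v₀ x) := by simp [a'.1.left_inv hx']
    have k1 : HasFDerivAt (K ∘ fun e => ((b.1 ∘ φ ∘ a'.1.symm) e, (v ∘ a'.1.symm) e)) _ (a'.1 x) :=
      HasFDerivAt.comp (a'.1 x) (by rw [e1]; exact hK.hasFDerivAt) (hbd.prodMk hvd)
    have k2 : HasFDerivAt (K ∘ fun e => ((b.1 ∘ φ ∘ a'.1.symm) e, (v₀ ∘ a'.1.symm) e)) _
        (a'.1 x) :=
      HasFDerivAt.comp (a'.1 x) (by rw [e2]; exact hK.hasFDerivAt) (hbd.prodMk hv₀d)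
    refine k1.fderiv.trans ?_
    refine (k2.congr_of_eventuallyEq ?_).fderiv.symm
    filter_upwards [eventually_chart_symm hx' hgood] with e ⟨h1, h2, h3, _⟩
    simp only [K, Function.comp, v₀]
    rw [mk_jetMap_coord h1 a b h2 h3]

end NaturalAction

/-! ### Smooth families of local diffeomorphisms -/

theorem Jet.SmoothOn.congr {d m n q : ℕ}
    {T : Type*} [TopologicalSpace T] [ChartedSpace (Eu d) T]
    {M : Type*} [TopologicalSpace M] [ChartedSpace (Eu m) M]
    {N : Type*} [TopologicalSpace N] [ChartedSpace (Eu n) N] {g g' : T → Jet m n q M N} {U : Set T}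
    (h : Jet.SmoothOn d g U) (hg : ∀ t ∈ U, g' t = g t) : Jet.SmoothOn d g' U := by
  refine ⟨h.1.congr fun t ht => by simp only [hg t ht],
    h.2.1.congr fun t ht => by simp only [hg t ht], fun a b => ?_⟩
  have e : U ∩ {t | (g' t).source ∈ a.1.source ∧ (g' t).target ∈ b.1.source} =
      U ∩ {t | (g t).source ∈ a.1.source ∧ (g t).target ∈ b.1.source} := by
    ext t
    simp only [mem_inter_iff, mem_ofPred_eq]
    exact and_congr_right fun ht => by rw [hg t ht]
  rw [e]
  exact (h.2.2 a b).congr fun t ht => by simp only [hg t ht.1]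

set_option maxHeartbeats 2000000 in
-- The `1`-jet of a pullback involves points near the source. Therefore the maps must be local
-- diffeomorphisms there too, and jointly with a variation of the parameter.
theorem eventually_localDiffeoAt_jetMap {n q : ℕ} {X : Type*} [TopologicalSpace X]
    [ChartedSpace (Eu n) X] [IsManifold 𝓘(ℝ, Eu n) ∞ X]
    {a b : OpenPartialHomeomorph X (Eu n)} (ha : a ∈ atlas (Eu n) X)
    (hb : b ∈ atlas (Eu n) X) {y : Eu n} (hy : y ∈ b.target) {v : Jet.Coord q n n}
    (hv : v ∈ regularCoord q a) :
    ∀ᶠ r : Jet.Coord q n n × X in 𝓝 (v, a.symm v.1), LocalDiffeoAt n (jetMap a b y r.1) r.2 := by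
  have hac : ContinuousAt (fun r : Jet.Coord q n n × X => (r.1, a r.2)) (v, a.symm v.1) :=
    continuousAt_fst.prodMk (ContinuousAt.comp (g := a) (f := fun r : Jet.Coord q n n × X => r.2)
      (a.continuousAt (a.map_target hv.1)) continuousAt_snd)
  have hT : Continuous (fun r : Jet.Coord q n n × Eu n => taylorMap r.1 r.2) :=
    contDiff_taylorMap.continuous
  have hT₁ : Continuous (fun r : Jet.Coord q n n × Eu n => taylorMap r.1 r.1.1) :=
    hT.comp (continuous_fst.prodMk (continuous_fst.comp continuous_fst))
  have hd : Continuous (fun r : Jet.Coord q n n × Eu n => fderiv ℝ (taylorMap r.1) r.2) := by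
    have : ContDiff ℝ ∞ (fun r : Jet.Coord q n n × Eu n => fderiv ℝ (taylorMap r.1) r.2) :=
      ContDiff.fderiv (f := fun (r : Jet.Coord q n n × Eu n) e => taylorMap r.1 e) (n := ∞)
        (contDiff_taylorMap.comp ((contDiff_fst.comp contDiff_fst).prodMk contDiff_snd))
        contDiff_snd (by simp)
    exact this.continuous
  have h1 : ∀ᶠ r : Jet.Coord q n n × X in 𝓝 (v, a.symm v.1),
      (fderiv ℝ (taylorMap r.1) (a r.2)).IsInvertible := by
    refine (hd.continuousAt.comp hac).preimage_mem_nhds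
      ((ContinuousLinearEquiv.isOpen (𝕜 := ℝ) (E := Eu n) (F := Eu n)).mem_nhds ?_)
    simp only [Function.comp, a.right_inv hv.1]
    exact hv.2
  have h2 : ∀ᶠ r : Jet.Coord q n n × X in 𝓝 (v, a.symm v.1),
      y + (taylorMap r.1 (a r.2) - taylorMap r.1 r.1.1) ∈ b.target := by
    refine ((continuous_const.add (hT.sub hT₁)).continuousAt.comp hac).preimage_mem_nhds
      (b.open_target.mem_nhds ?_)
    simpa [a.right_inv hv.1] using hy
  have h3 : ∀ᶠ r : Jet.Coord q n n × X in 𝓝 (v, a.symm v.1), r.2 ∈ a.source :=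
    continuousAt_snd.preimage_mem_nhds (a.open_source.mem_nhds (a.map_target hv.1))
  filter_upwards [h1, h2, h3] with r hr1 hr2 hr3
  have hTr : ContDiff ℝ ∞ (taylorMap r.1) := contDiff_taylorMap_right r.1
  refine localDiffeoAt_of_chart ha hb (f := fun e => y + (taylorMap r.1 e - taylorMap r.1 r.1.1))
    (by fun_prop) hr3 ?_ hr2
  have hT' : HasFDerivAt (taylorMap r.1) (fderiv ℝ (taylorMap r.1) (a r.2)) (a r.2) :=
    (hTr.contDiffAt.differentiableAt (by simp)).hasFDerivAt
  have hd : HasFDerivAt (fun e => y + (taylorMap r.1 e - taylorMap r.1 r.1.1))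
      (fderiv ℝ (taylorMap r.1) (a r.2)) (a r.2) :=
    (hT'.sub_const (taylorMap r.1 r.1.1)).const_add y
  rw [hd.fderiv]
  exact hr1

/-! ### Equivariant sections and lifting of symmetries -/

namespace NaturalAction

variable {n N q : ℕ}
  {X : Type*} [TopologicalSpace X] [ChartedSpace (Eu n) X] [IsManifold 𝓘(ℝ, Eu n) ∞ X]
  {Z : Type*} [TopologicalSpace Z] [ChartedSpace (Eu N) Z] [IsManifold 𝓘(ℝ, Eu N) ∞ Z]
  {π : Z → X} {A : NaturalAction n N q π}

omit [IsManifold 𝓘(ℝ, Eu n) ∞ X] [IsManifold 𝓘(ℝ, Eu N) ∞ Z] in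
theorem proj_pullback (ω₀ : GeometricObject n N π) {x : X} {φ : X → X} (hφ : LocalDiffeoAt n φ x) :
    π (A.pullback ω₀ φ x) = x :=
  A.proj_act_mk hφ (ω₀.proj_toFun _)

omit [IsManifold 𝓘(ℝ, Eu N) ∞ Z] in
theorem Homogeneous.exists_pullback_eq (hA : A.Homogeneous) (ω₀ : GeometricObject n N π) (z : Z) :
    ∃ φ : X → X, LocalDiffeoAt n φ (π z) ∧ φ (π z) = π z ∧ A.pullback ω₀ φ (π z) = z := by
  obtain ⟨φ, hφ, h1, h2⟩ := hA.exists_act_eq (ω₀ (π z)) z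
  rw [ω₀.proj_toFun] at h1
  exact ⟨φ, hφ, h1, by rw [pullback, h1, h2]⟩

/-- An equivariant map satisfying the structure equations is determined by the action on
`j_1(ω₀)`. -/
theorem JetAct.I_eq_of_equivariant (hπ : ContMDiff 𝓘(ℝ, Eu N) 𝓘(ℝ, Eu n) ∞ π)
    {ω₀ : GeometricObject n N π} {c : Z → A.Quot1} (hc : A.Equivariant c)
    (hω : A.StructureEquations ω₀ c) {x : X} {φ : X → X} (hφ : LocalDiffeoAt n φ x)
    {w : sectionJets n N π} (h : A.JetAct (ω₀.j1 (φ x)) (Jet.mk (q + 1) x φ) w) :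
    A.I w = c (A.pullback ω₀ φ x) := by
  obtain ⟨u, v, g, hu, hg, huv, hv⟩ :=
    hc (ω₀ (φ x)) (Jet.mk q x φ) ⟨x, φ, hφ, rfl⟩ (ω₀.proj_toFun _)
  exact (JetAct.I_eq hπ h huv (hg.symm : Jet.mk q x φ = g.proj) ((hω _).trans hu.symm)).trans hv

theorem jetAct_pullbackJet (hπ : ContMDiff 𝓘(ℝ, Eu N) 𝓘(ℝ, Eu n) ∞ π)
    (ω₀ : GeometricObject n N π) {x : X} {φ : X → X} (hφ : LocalDiffeoAt n φ x) :
    A.JetAct (ω₀.j1 (φ x)) (Jet.mk (q + 1) x φ)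
      (A.pullbackJet hπ hφ (ω₀.localSectionAt _)) :=
  (jetAct_mk_iff hπ hφ (ω₀.localSectionAt _) rfl).2 rfl

/-- By equivariance and the structure equations, `w` lies in the `K_{q+1}`-orbit of the product of
`j_1(ω₀)` with the jet of `φ`. The kernel element is absorbed into `φ`. -/
theorem Equivariant.exists_jetAct (hπ : ContMDiff 𝓘(ℝ, Eu N) 𝓘(ℝ, Eu n) ∞ π)
    {ω₀ : GeometricObject n N π} {c : Z → A.Quot1} (hc : A.Equivariant c)
    (hω : A.StructureEquations ω₀ c) {x : X} {φ : X → X} (hφ : LocalDiffeoAt n φ x)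
    {w : sectionJets n N π} (hw : A.I w = c (A.pullback ω₀ φ x)) :
    ∃ φ' : X → X, LocalDiffeoAt n φ' x ∧ SameJet n n q x φ φ' ∧
      A.JetAct (ω₀.j1 (φ' x)) (Jet.mk (q + 1) x φ') w := by
  have h := jetAct_pullbackJet (A := A) hπ ω₀ hφ
  obtain ⟨φ', hφ', hs, h'⟩ := JetAct.exists_of_kernelRel hπ hφ h
    ((JetAct.I_eq_of_equivariant hπ hc hω hφ h).trans hw.symm)
  exact ⟨φ', hφ', hs, hs.1 ▸ h'⟩

/-- If `φ` preserves the value of `ω₀` at `x`, then `exists_jetAct` applies to `j_1(ω₀)(x)` itself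
and yields a map with the same `q`-jet that fixes this `1`-jet; such maps belong to the
prolongation. -/
theorem Equivariant.surjective_prolongationProj [SecondCountableTopology X] (hA : A.Homogeneous)
    (hπ : ContMDiff 𝓘(ℝ, Eu N) 𝓘(ℝ, Eu n) ∞ π) {ω₀ : GeometricObject n N π} {c : Z → A.Quot1}
    (hc : A.Equivariant c) (hω : A.StructureEquations ω₀ c) :
    Function.Surjective (prolongationProj (A.symmetryGroupoid ω₀)) := by
  rintro ⟨_, ⟨x, φ, hφ, rfl⟩, h⟩
  have h' : A.pullback ω₀ φ x = ω₀ x := h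
  obtain ⟨φ', hφ', hs, hact⟩ := hc.exists_jetAct hπ hω hφ (w := ω₀.j1 x) (by rw [hω, h'])
  have h1 := (jetAct_mk_iff hπ hφ' (ω₀.localSectionAt _) rfl).1 hact
  exact ⟨⟨Jet.mk (q + 1) x φ', hA.mem_prolongation hπ ω₀ hφ' (Jet.mk_eq_mk.1 h1).2⟩,
    Subtype.ext (Jet.mk_eq_mk.2 ⟨rfl, hs.symm⟩)⟩

/-- Homogeneity writes the value of a `1`-jet as the pullback of `ω₀` by some `φ`; when its class is
the one prescribed by `c`, a correction of `φ` reaches the `1`-jet itself. -/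
theorem Equivariant.exact (hA : A.Homogeneous) (hπ : ContMDiff 𝓘(ℝ, Eu N) 𝓘(ℝ, Eu n) ∞ π)
    {ω₀ : GeometricObject n N π} {c : Z → A.Quot1} (hc : A.Equivariant c)
    (hω : A.StructureEquations ω₀ c) : A.Exact ω₀ c := by
  refine ⟨fun f hf => ⟨fun h => h.2, fun h => ⟨hf, h⟩⟩, fun u => ⟨fun h => ?_, ?_⟩⟩
  · obtain ⟨_, x, σ, hσ, rfl⟩ := u
    have hx : π (σ x) = x := hσ.self_of_nhds.2
    obtain ⟨φ, hφ, -, h1⟩ := hA.exists_pullback_eq ω₀ (σ x)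
    rw [hx] at hφ h1
    obtain ⟨φ', hφ', -, h2⟩ := hc.exists_jetAct hπ hω hφ (h.trans (congrArg c h1.symm))
    exact ⟨Jet.mk (q + 1) x φ', ⟨x, φ', hφ', rfl⟩, h2⟩
  · rintro ⟨_, ⟨x, φ, hφ, rfl⟩, h⟩
    have h1 := (jetAct_mk_iff hπ hφ (ω₀.localSectionAt _) rfl).1 h
    have h2 := JetAct.I_eq_of_equivariant hπ hc hω hφ h
    rw [h2, h1]
    rfl

/-- If every symmetry lifts, then the class of the prolonged action on `j_1(ω₀)` depends only on
the action on `ω₀`. -/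
theorem I_pullbackJet_eq (hπ : ContMDiff 𝓘(ℝ, Eu N) 𝓘(ℝ, Eu n) ∞ π) {ω₀ : GeometricObject n N π}
    (h : Function.Surjective (prolongationProj (A.symmetryGroupoid ω₀))) {x : X} {φ φ' : X → X}
    (hφ : LocalDiffeoAt n φ x) (hφ' : LocalDiffeoAt n φ' x)
    (he : A.pullback ω₀ φ x = A.pullback ω₀ φ' x) :
    A.I (A.pullbackJet hπ hφ (ω₀.localSectionAt _)) =
      A.I (A.pullbackJet hπ hφ' (ω₀.localSectionAt _)) := by
  obtain ⟨ψ, hψ, h1, h2⟩ := hφ.exists_inverse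
  have hψx : ψ (φ x) = x := h1.eq_of_nhds
  -- With `ψ` inverse to `φ`, the map `φ' ∘ ψ` is a symmetry of `ω₀` at `φ x`. A lift `γ` of its
  -- `q`-jet fixes `j_1(ω₀)`, so `φ` and `γ ∘ φ` act alike on `j_1(ω₀)`, and `γ ∘ φ` has the `q`-jet
  -- of `φ'`.
  have hχ : LocalDiffeoAt n (φ' ∘ ψ) (φ x) := hψ.comp (by rwa [hψx])
  have hpull : A.pullback ω₀ (φ' ∘ ψ) (φ x) = ω₀ (φ x) := by
    have e1 := (A.pullback_comp_eventuallyEq hψ (by rwa [hψx])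
      (ω₀.localSectionAt (φ' (ψ (φ x))))).eq_of_nhds
    have e2 := (A.pullback_comp_eventuallyEq hψ (by rwa [hψx])
      (ω₀.localSectionAt (φ (ψ (φ x))))).eq_of_nhds
    have e3 := (A.pullback_eventuallyEq_of_eventuallyEq (σ := ω₀) h2).eq_of_nhds
    have e4 := (A.pullback_id_eventuallyEq (ω₀.localSectionAt (φ x))).eq_of_nhds
    rw [e1, ← e4, ← e3, e2]
    change A.act (A.pullback ω₀ φ' (ψ (φ x))) _ = A.act (A.pullback ω₀ φ (ψ (φ x))) _
    rw [hψx, he]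
  obtain ⟨⟨g, hg⟩, hgp⟩ := h ⟨Jet.mk q (φ x) (φ' ∘ ψ), ⟨_, _, hχ, rfl⟩, hpull⟩
  obtain ⟨y, γ, hγ, rfl, hγω⟩ := exists_of_mem_prolongation hπ ω₀ hg
  obtain ⟨rfl, hγχ⟩ := Jet.mk_eq_mk.1
    (show Jet.mk q y γ = Jet.mk q (φ x) (φ' ∘ ψ) from congrArg Subtype.val hgp)
  have hγφ : LocalDiffeoAt n (γ ∘ φ) x := hφ.comp hγ
  have hs : SameJet n n q x (γ ∘ φ) φ' := by
    refine (SameJet.comp hφ.contMDiffAt hφ.contMDiffAt hγ.contMDiffAt hχ.contMDiffAt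
      (SameJet.of_eventuallyEq EventuallyEq.rfl) hγχ).trans (SameJet.of_eventuallyEq ?_)
    exact h1.mono fun y hy => congrArg φ' hy
  refine JetAct.I_eq hπ (g := Jet.mk (q + 1) x (γ ∘ φ)) (u := ω₀.j1 ((γ ∘ φ) x)) ?_
    (jetAct_pullbackJet hπ ω₀ hφ') (Jet.mk_eq_mk.2 ⟨rfl, hs⟩) (by rw [hs.1])
  refine (jetAct_mk_iff hπ hγφ (ω₀.localSectionAt _) rfl).2 (Jet.mk_eq_mk.2 ⟨rfl, ?_⟩)
  exact (sameJet_pullback_comp hπ hφ hγ (ω₀.localSectionAt _) (ω₀.localSectionAt _) hγω.symm).symm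

/-- Families of jets that carry `ω₀` to prescribed values. -/
theorem Homogeneous.exists_smoothOn_pullback [SecondCountableTopology X] (hA : A.Homogeneous)
    (hπ : ContMDiff 𝓘(ℝ, Eu N) 𝓘(ℝ, Eu n) ∞ π) (ω₀ : GeometricObject n N π) (z₀ : Z) :
    ∃ (U : Set Z) (G : Z → X → X), IsOpen U ∧ z₀ ∈ U ∧
      (∀ z ∈ U, LocalDiffeoAt n (G z) (π z) ∧ A.pullback ω₀ (G z) (π z) = z) ∧
      Jet.SmoothOn N (fun z => (Jet.mk 1 (π z) (A.pullback ω₀ (G z)) : Jet n N 1 X Z)) U := by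
  obtain ⟨φ, hφ, hφx, hφz⟩ := hA.exists_pullback_eq ω₀ z₀
  let a : atlas (Eu n) X := ⟨chartAt (Eu n) (π z₀), chart_mem_atlas _ _⟩
  let c := chartAt (Eu N) z₀
  have hc : c ∈ atlas (Eu N) Z := chart_mem_atlas _ _
  have ha : π z₀ ∈ a.1.source := mem_chart_source _ _
  have hz₀ : z₀ ∈ c.source := mem_chart_source _ _
  have hφa : φ (π z₀) ∈ a.1.source := by rwa [hφx]
  let z := ω₀ (π z₀)
  have hz : π z = π z₀ := ω₀.proj_toFun _
  have hza : π z ∈ a.1.source := by rwa [hz]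
  let v₀ : Jet.Coord q n n := Jet.coord a a (Jet.mk q (π z₀) φ)
  have hv₀ : v₀ ∈ regularCoord q a.1 := coord_mem_regularCoord hφ a a ha hφa
  have hactφ : A.act z (Jet.mk q (π z₀) φ) = z₀ := by
    rw [pullback, hφx] at hφz
    exact hφz
  have hact₀ : A.actCoord a.1 a.1 z v₀ = z₀ :=
    (A.actCoord_coord hφ a a ha hφa (hz.trans hφx.symm)).trans hactφ
  have hs := isOpen_actCoord_right_preimage (A := A) hπ a.2 a.2 c hza
  -- A local section of the orbit submersion through `z = ω₀ (π z₀)` gives jets carrying `z` to each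
  -- nearby `z'`. Their common target `π z` keeps the acted-on value equal to `z`.
  obtain ⟨ρ, Ω, hΩ, hvΩ, hρ, hρs, -⟩ := exists_contDiffOn_section_of_surjective hs
    (f := fun v => c (A.actCoord a.1 a.1 z v)) (a := v₀)
    (fun v hv => (contDiffAt_actCoord_right hπ a.2 a.2 hc hza hv.1 hv.2).contDiffWithinAt)
    ⟨hv₀, by rw [mem_preimage, hact₀]; exact hz₀⟩
    (hA.surjective_fderiv_actCoord hπ a a hc hφ (hφx.trans hz.symm) ha hφa
      (by rw [hactφ]; exact hz₀))
  rw [hact₀] at hvΩ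
  let v : Z → Jet.Coord q n n := fun z' => ρ (v₀, c z')
  let y := a.1 (π z)
  have hy : y ∈ a.1.target := a.1.map_source hza
  let U : Set Z := c.source ∩ c ⁻¹' {e | (v₀, e) ∈ Ω}
  have hU : IsOpen U := c.isOpen_inter_preimage (hΩ.preimage (Continuous.prodMk_right v₀))
  have hv : ∀ z' ∈ U, v z' ∈ regularCoord q a.1 ∧ A.actCoord a.1 a.1 z (v z') = z' ∧
      a.1.symm (v z').1 = π z' := by
    rintro z' ⟨h1, h2⟩
    obtain ⟨⟨h3, h4⟩, h5⟩ := hρs _ h2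
    have h6 : A.actCoord a.1 a.1 z (v z') = z' := c.injOn h4 h1 h5
    exact ⟨h3, h6, (proj_actCoord (A := A) a.2 a.2 hza h3).symm.trans (congrArg π h6)⟩
  have hvsm : ∀ z' ∈ U, ContMDiffAt 𝓘(ℝ, Eu N) 𝓘(ℝ, Jet.Coord q n n) ∞ v z' := by
    rintro z' ⟨h1, h2⟩
    have h3 : ContDiffAt ℝ ∞ (fun e => ρ (v₀, e)) (c z') :=
      ContDiffAt.comp (c z') (hρ.contDiffAt (hΩ.mem_nhds h2)) (contDiffAt_const.prodMk contDiffAt_id)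
    exact ContMDiffAt.comp z' (I' := 𝓘(ℝ, Eu N)) (g := fun e => ρ (v₀, e)) (f := c)
      h3.contMDiffAt (contMDiffAt_chart hc h1)
  let G : Z → X → X := fun z' => jetMap a.1 a.1 y (v z')
  have hGx : ∀ z' ∈ U, G z' (π z') = π z := by
    intro z' h
    obtain ⟨h1, h2, h3⟩ := hv z' h
    have := jetMap_source (b := a.1) y h1
    rwa [h3, a.1.left_inv hza] at this
  have hωz : ω₀ (π z) = z := congrArg ω₀ hz
  refine ⟨U, G, hU, ⟨hz₀, hvΩ⟩, fun z' h => ?_, smoothOn_mk (fun z' h => ?_)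
    (fun z' h => hπ.contMDiffAt)⟩
  · obtain ⟨h1, h2, h3⟩ := hv z' h
    have hd := localDiffeoAt_jetMap a.2 a.2 hy h1
    rw [h3] at hd
    refine ⟨hd, ?_⟩
    rw [pullback, hGx z' h, hωz, ← h3]
    exact h2
  · obtain ⟨h1, h2, h3⟩ := hv z' h
    have hG : ContMDiffAt (𝓘(ℝ, Eu N).prod 𝓘(ℝ, Eu n)) 𝓘(ℝ, Eu n) ∞
        (fun p : Z × X => G p.1 p.2) (z', π z') := by
      have := contMDiffAt_jetMap_family (y := fun _ => y) a.2 a.2 contMDiffAt_const (hvsm z' h)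
        hy h1
      rwa [h3] at this
    have hd := eventually_localDiffeoAt_jetMap a.2 a.2 hy h1
    rw [h3] at hd
    have hcont : ContinuousAt (fun p : Z × X => (v p.1, p.2)) (z', π z') :=
      (ContinuousAt.comp (g := v) (f := fun p : Z × X => p.1) (hvsm z' h).continuousAt
        continuousAt_fst).prodMk continuousAt_snd
    -- The point of `X` is treated as a parameter as well, since `1`-jets vary smoothly when the
    -- sections are smooth jointly in `z'` and this point.
    refine A.contMDiffAt_act hπ (T := Z × X) (u := fun p => ω₀ (G p.1 p.2)) (x := Prod.snd)
      (G := fun p => G p.1) (ω₀.smooth.contMDiffAt.comp _ hG) contMDiffAt_snd ?_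
      (hcont.eventually hd) (Eventually.of_forall fun p => ω₀.proj_toFun _)
    refine ContMDiffAt.comp ((z', π z'), π z') (g := fun p : Z × X => G p.1 p.2)
      (f := fun p : (Z × X) × X => (p.1.1, p.2)) hG ?_
    exact ContMDiffAt.prodMk (contMDiffAt_fst.comp _ contMDiffAt_fst) contMDiffAt_snd

/-- If every symmetry lifts, then there is a smooth equivariant section satisfying the structure
equations. -/
theorem Homogeneous.exists_smoothSection [SecondCountableTopology X] (hA : A.Homogeneous)
    (hπ : ContMDiff 𝓘(ℝ, Eu N) 𝓘(ℝ, Eu n) ∞ π) {ω₀ : GeometricObject n N π}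
    (h : Function.Surjective (prolongationProj (A.symmetryGroupoid ω₀))) :
    ∃ c : Z → A.Quot1, A.SmoothSection c ∧ A.Equivariant c ∧ A.StructureEquations ω₀ c := by
  choose Φ hΦ hΦx hΦz using hA.exists_pullback_eq ω₀
  -- The choice of `Φ z` is immaterial by `I_pullbackJet_eq`: `hc` allows any `φ` with the right
  -- value. The lift near `z₀`, equivariance and the structure equations each use a different `φ`.
  let c : Z → A.Quot1 := fun z => A.I (A.pullbackJet hπ (hΦ z) (ω₀.localSectionAt _))
  have hc : ∀ (x : X) (φ : X → X) (hφ : LocalDiffeoAt n φ x) (z : Z), A.pullback ω₀ φ x = z →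
      A.I (A.pullbackJet hπ hφ (ω₀.localSectionAt _)) = c z := by
    intro x φ hφ z hz
    have hx : x = π z := by rw [← hz, proj_pullback ω₀ hφ]
    subst hx
    exact I_pullbackJet_eq hπ h hφ (hΦ z) (hz.trans (hΦz z).symm)
  refine ⟨c, ⟨hΦz, fun z₀ => ?_⟩, ?_, fun x => ?_⟩
  · obtain ⟨U, G, hU, hz₀, hG, hsm⟩ := hA.exists_smoothOn_pullback hπ ω₀ z₀
    have hex : ∀ z, ∃ s : sectionJets n N π,
        z ∈ U → s.1 = Jet.mk 1 (π z) (A.pullback ω₀ (G z)) ∧ A.I s = c z := by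
      intro z
      by_cases hz : z ∈ U
      · exact ⟨A.pullbackJet hπ (hG z hz).1 (ω₀.localSectionAt _), fun _ =>
          ⟨rfl, hc _ _ _ _ (hG z hz).2⟩⟩
      -- Outside `U` an arbitrary `1`-jet serves as a default value.
      · exact ⟨ω₀.j1 (π z), fun h => absurd h hz⟩
    choose s hs using hex
    exact ⟨U, s, hU, hz₀, hsm.congr fun z hz => (hs z hz).1, fun z hz => (hs z hz).2⟩
  · rintro z _ ⟨x, φ, hφ, rfl⟩ hz
    have hz' : π z = φ x := hz
    have hΦ' := hΦ z
    have hΦz' := hΦz z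
    rw [hz'] at hΦ' hΦz'
    have hcomp : LocalDiffeoAt n (Φ z ∘ φ) x := hφ.comp hΦ'
    have hev := A.pullback_comp_eventuallyEq hφ hΦ' (ω₀.localSectionAt (Φ z (φ x)))
    -- If `Φ z` carries `ω₀` to `z`, then `Φ z ∘ φ` carries it to `z` transformed by `φ`, and by
    -- associativity the `1`-jets correspond in the same way.
    refine ⟨A.pullbackJet hπ hΦ' (ω₀.localSectionAt _),
      A.pullbackJet hπ hcomp (ω₀.localSectionAt _), Jet.mk (q + 1) x φ, hc _ _ _ _ hΦz', rfl, ?_,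
      hc _ _ _ _ ?_⟩
    · exact (jetAct_mk_iff hπ hφ (A.localSectionAt_pullback hπ hΦ' (ω₀.localSectionAt _)) rfl).2
        (Jet.mk_congr hev)
    · rw [hev.eq_of_nhds]
      change A.act (A.pullback ω₀ (Φ z) (φ x)) _ = _
      rw [hΦz']
  · have hev := A.pullback_id_eventuallyEq (ω₀.localSectionAt x)
    rw [← hc x id (localDiffeoAt_id x) _ hev.eq_of_nhds]
    exact congrArg A.I (Subtype.ext (Jet.mk_congr hev).symm)

end NaturalAction

end JetGroupoid

end

theorem mainTheorem1 {n N m q : ℕ}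
    {X : Type*} [TopologicalSpace X] [T2Space X] [SecondCountableTopology X]
    [ChartedSpace (JetGroupoid.Eu n) X] [IsManifold 𝓘(ℝ, JetGroupoid.Eu n) ∞ X]
    {Z : Type*} [TopologicalSpace Z] [T2Space Z] [SecondCountableTopology Z]
    [ChartedSpace (JetGroupoid.Eu N) Z] [IsManifold 𝓘(ℝ, JetGroupoid.Eu N) ∞ Z]
    {F : Type*} [TopologicalSpace F]
    [ChartedSpace (JetGroupoid.Eu m) F] [IsManifold 𝓘(ℝ, JetGroupoid.Eu m) ∞ F]
    (π : Z → X) (hπ : JetGroupoid.IsFibreBundle n N m F π)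
    (A : JetGroupoid.NaturalAction n N q π) (hA : A.Homogeneous)
    (ω₀ : JetGroupoid.GeometricObject n N π) :
    (Function.Surjective (JetGroupoid.prolongationProj (A.symmetryGroupoid ω₀)) ↔
      ∃ c : Z → A.Quot1, A.SmoothSection c ∧ A.Equivariant c ∧ A.StructureEquations ω₀ c) ∧
    ∀ c : Z → A.Quot1, A.Equivariant c → A.StructureEquations ω₀ c →
      Function.Surjective (JetGroupoid.prolongationProj (A.symmetryGroupoid ω₀)) ∧ A.Exact ω₀ c := by
  refine ⟨⟨hA.exists_smoothSection hπ.contMDiff, ?_⟩, fun c hc hω =>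
    ⟨hc.surjective_prolongationProj hA hπ.contMDiff hω, hc.exact hA hπ.contMDiff hω⟩⟩
  rintro ⟨c, -, hc, hω⟩
  exact hc.surjective_prolongationProj hA hπ.contMDiff hω
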